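/- For a finite simple undirected graph $G=(V,E)$, a set $D\subseteq V$ is a *connected dominating set* if every vertex outside $D$ has a neighbour in $D$ and the induced subgraph $G[D]$ is connected (has exactly one connected component, so $D\neq\emptyset$); it is *minimal* if no proper subset of $D$ is a connected dominating set of $G$. (1) There is an algorithm that, given an arbitrary graph $G$ with $n$ vertices (by its adjacency matrix), outputs all minimal connected dominating sets of $G$, each exactly once, in time $\mathcal{O}(1.9896^n)$ and using only polynomial space. More precisely, there are a single word-RAM program, a constant $C$ and a polynomial $p$ such that, for every $n$ and every graph $G$ on $n$ vertices, the program halts on input $G$ after at most $C\cdot 1.9896^n$ elementary steps, having appended to its write-only output stream (which does not count as working space) the characteristic vectors of the minimal connected dominating sets of $G$, each exactly once, while it uses only constantly many registers and arrays, with only addresses and values below $p(n)$. (2) Consequently, there is a constant $C'$ such that every graph with $n$ vertices has at most $C'\cdot 1.9896^n$ minimal connected dominating sets. -/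

import Mathlib

/-! ### Connected dominating sets -/

/-- `D` is a dominating set of `G`: every vertex is in `D` or adjacent to a vertex of `D`. -/
def IsDominatingSet {V : Type*} (G : SimpleGraph V) (D : Finset V) : Prop :=
  ∀ v, v ∈ D ∨ ∃ u ∈ D, G.Adj u v

/-- `D` is a connected dominating set of `G`: it dominates `G` and `G[D]` is connected
(it has exactly one connected component; in particular `D` is not empty). -/
def IsCDS {V : Type*} (G : SimpleGraph V) (D : Finset V) : Prop :=
  IsDominatingSet G D ∧ (G.induce (D : Set V)).Connected

/-- `D` is an inclusion-minimal connected dominating set of `G`. -/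
def IsMinimalCDS {V : Type*} (G : SimpleGraph V) (D : Finset V) : Prop :=
  Minimal (IsCDS G) D

/-! ### A word RAM with a write-only output stream

A program uses finitely many registers and finitely many named arrays, with indirect
access to the arrays.  The machine with parameter `W` has arrays of `W` cells and words that hold
the numbers below `W`; a run in which a larger number would be computed, or a cell outside an
array would be addressed, does not exist.  Hence a run of a fixed program on the machine with
parameter `W` takes place within `O(W)` words of `O(log W)` bits.  As usual for
enumeration problems, the output stream can only be appended to, and is not part of
the working space. -/

namespace WordRAM

/-- Contents of the registers `reg x`, of the arrays `mem a`, and the output written so far. -/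
structure State where
  reg : ℕ → ℕ
  mem : ℕ → ℕ → ℕ
  out : List ℕ

/-- Expressions: constants, registers, array cells, addition, truncated subtraction,
multiplication, and the comparisons `<` and `=` (with value `1` if true and `0` if false). -/
inductive Expr where
  | const (k : ℕ)
  | reg (x : ℕ)
  | read (a : ℕ) (i : Expr)
  | add (e f : Expr)
  | sub (e f : Expr)
  | mul (e f : Expr)
  | lt (e f : Expr)
  | eq (e f : Expr)

namespace Expr

/-- The value of an expression. -/
def eval (s : State) : Expr → ℕ
  | const k => k
  | reg x => s.reg x
  | read a i => s.mem a (i.eval s)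
  | add e f => e.eval s + f.eval s
  | sub e f => e.eval s - f.eval s
  | mul e f => e.eval s * f.eval s
  | lt e f => if e.eval s < f.eval s then 1 else 0
  | eq e f => if e.eval s = f.eval s then 1 else 0

/-- The evaluation of the expression is possible on the machine with parameter `W`: the values
of all its subexpressions, and hence all addresses of cells that are read, are below `W`. -/
def Fits (W : ℕ) (s : State) : Expr → Prop
  | const k => k < W
  | reg x => s.reg x < W
  | read a i => i.Fits W s ∧ s.mem a (i.eval s) < W
  | add e f => e.Fits W s ∧ f.Fits W s ∧ e.eval s + f.eval s < W
  | sub e f => e.Fits W s ∧ f.Fits W s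
  | mul e f => e.Fits W s ∧ f.Fits W s ∧ e.eval s * f.eval s < W
  | lt e f => e.Fits W s ∧ f.Fits W s ∧ 1 < W
  | eq e f => e.Fits W s ∧ f.Fits W s ∧ 1 < W

/-- The time for the evaluation of an expression: one unit for every operation, register access,
constant and cell access. -/
def cost : Expr → ℕ
  | const _ => 1
  | reg _ => 1
  | read _ i => i.cost + 1
  | add e f => e.cost + f.cost + 1
  | sub e f => e.cost + f.cost + 1
  | mul e f => e.cost + f.cost + 1
  | lt e f => e.cost + f.cost + 1
  | eq e f => e.cost + f.cost + 1

end Expr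

/-- Programs. A condition counts as true if its value is not `0`. -/
inductive Cmd where
  | skip
  | assign (x : ℕ) (e : Expr)
  | store (a : ℕ) (i e : Expr)
  | output (e : Expr)
  | seq (c d : Cmd)
  | ite (e : Expr) (c d : Cmd)
  | while (e : Expr) (c : Cmd)

/-- `Exec W c s t s'`: on the machine with parameter `W`, the program `c` started in state `s`
halts after exactly `t` time units in state `s'`. -/
inductive Exec (W : ℕ) : Cmd → State → ℕ → State → Prop
  | skip (s : State) : Exec W .skip s 1 s
  | assign (x : ℕ) (e : Expr) (s : State) (he : e.Fits W s) :
      Exec W (.assign x e) s (e.cost + 1)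
        { s with reg := Function.update s.reg x (e.eval s) }
  | store (a : ℕ) (i e : Expr) (s : State) (hi : i.Fits W s) (he : e.Fits W s) :
      Exec W (.store a i e) s (i.cost + e.cost + 1)
        { s with
          mem := Function.update s.mem a (Function.update (s.mem a) (i.eval s) (e.eval s)) }
  | output (e : Expr) (s : State) (he : e.Fits W s) :
      Exec W (.output e) s (e.cost + 1) { s with out := s.out ++ [e.eval s] }
  | seq (c d : Cmd) (s s₁ s₂ : State) (t₁ t₂ : ℕ)
      (hc : Exec W c s t₁ s₁) (hd : Exec W d s₁ t₂ s₂) :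
      Exec W (.seq c d) s (t₁ + t₂) s₂
  | iteTrue (e : Expr) (c d : Cmd) (s s₁ : State) (t : ℕ) (he : e.Fits W s)
      (h : e.eval s ≠ 0) (hc : Exec W c s t s₁) :
      Exec W (.ite e c d) s (e.cost + 1 + t) s₁
  | iteFalse (e : Expr) (c d : Cmd) (s s₁ : State) (t : ℕ) (he : e.Fits W s)
      (h : e.eval s = 0) (hd : Exec W d s t s₁) :
      Exec W (.ite e c d) s (e.cost + 1 + t) s₁
  | whileTrue (e : Expr) (c : Cmd) (s s₁ s₂ : State) (t₁ t₂ : ℕ) (he : e.Fits W s)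
      (h : e.eval s ≠ 0) (hc : Exec W c s t₁ s₁) (hw : Exec W (.while e c) s₁ t₂ s₂) :
      Exec W (.while e c) s (e.cost + 1 + t₁ + t₂) s₂
  | whileFalse (e : Expr) (c : Cmd) (s : State) (he : e.Fits W s) (h : e.eval s = 0) :
      Exec W (.while e c) s (e.cost + 1) s

open Classical in
/-- The initial state on input `G`: register `0` holds the number `n` of vertices, array `0`
holds the adjacency matrix of `G` row by row, everything else is `0`, and the output is empty. -/
noncomputable def inputState {n : ℕ} (G : SimpleGraph (Fin n)) : State where
  reg x := if x = 0 then n else 0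
  mem a k := if a = 0 ∧ ∃ i j : Fin n, k = (i : ℕ) * n + j ∧ G.Adj i j then 1 else 0
  out := []

end WordRAM

/-- The characteristic vector of a vertex set. -/
def charVector {n : ℕ} (D : Finset (Fin n)) : List ℕ :=
  List.ofFn fun i : Fin n => if i ∈ D then 1 else 0

/-- The output `out` is an enumeration of the minimal connected dominating sets of `G`: it is
the concatenation of their characteristic vectors, in some order, each of them exactly once. -/
def IsMinimalCDSEnumeration {n : ℕ} (G : SimpleGraph (Fin n)) (out : List ℕ) : Prop :=
  ∃ L : List (Finset (Fin n)), L.Nodup ∧ (∀ D, D ∈ L ↔ IsMinimalCDS G D) ∧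
    out = L.flatMap charVector

/-!
For each root vertex, the search branches on states `(D, X)` in which the connected set `D` is
chosen and the vertices of `X` are excluded: an undecided vertex dominated by `D` is added to `D` or
to `X`. If removing a vertex of a connected set leaves it connected and dominating what it
dominated before, then no connected superset reached by the search is a minimal connected
dominating set. Hence such branches can be cut off, and the sets `D` at the remaining leaves that
dominate the graph are the minimal connected dominating sets containing the root, each found once.

The leaves are counted by measure and conquer. A frontier vertex weighs more the more vertices it
would newly dominate, and an undominated vertex weighs more the more neighbours it has that are not
excluded; a vertex whose inclusion is known to create a redundant vertex weighs less. The product of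
the weights bounds the number of leaves because it is at least the sum of the products for the two
children, up to the cases of gain one and two, where the loss is recovered one level further down:
this is why sharper bounds for special states are carried through the induction. The weights are a
numerical solution of the resulting inequalities. All of them are at most `1.9884`, and the gap to
`1.9896` absorbs every polynomial factor.

The search uses polynomial space since the depth-first traversal stores only the current state and
the stack of branching vertices. A set found in the trees of several roots is written only in the
tree of its least vertex.
-/

namespace CDSEnum

/-! ### Cut-connected sets and closed neighbourhoods -/

section Connectivity

variable {V : Type*} {G : SimpleGraph V}

/-- No edge of `G` leads from `C` to a vertex of `D` outside `C`. -/
def IsClosedIn (G : SimpleGraph V) (C D : Finset V) : Prop :=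
  ∀ a ∈ C, ∀ b ∈ D, G.Adj a b → b ∈ C

/-- Connectedness of `G[D]`, phrased through cuts so that it can be tested on finsets:
`D` is nonempty and contained in each of its nonempty closed subsets. -/
def CutConnected (G : SimpleGraph V) (D : Finset V) : Prop :=
  D.Nonempty ∧ ∀ C ⊆ D, C.Nonempty → IsClosedIn G C D → D ⊆ C

theorem CutConnected.connected {D : Finset V} (hD : CutConnected G D) :
    (G.induce (D : Set V)).Connected := by
  classical
  obtain ⟨⟨x, hx⟩, hcut⟩ := hD
  have : Nonempty (D : Set V) := ⟨⟨x, hx⟩⟩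
  refine ⟨fun a b => ?_⟩
  let C : Finset V := {v ∈ D | ∃ hv : v ∈ D, (G.induce (D : Set V)).Reachable a ⟨v, hv⟩}
  have hDC : D ⊆ C := by
    refine hcut C (Finset.filter_subset _ _)
      ⟨a, Finset.mem_filter.2 ⟨a.2, a.2, SimpleGraph.Reachable.refl _⟩⟩ fun u hu _ hw huw => ?_
    obtain ⟨-, hu', hr⟩ := Finset.mem_filter.1 hu
    exact Finset.mem_filter.2 ⟨hw, hw, hr.trans (SimpleGraph.Adj.reachable (by simpa using huw))⟩
  exact (Finset.mem_filter.1 (hDC b.2)).2.2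

theorem cutConnected_of_connected {D : Finset V} (hD : (G.induce (D : Set V)).Connected) :
    CutConnected G D := by
  obtain ⟨⟨x, hx⟩⟩ := hD.nonempty
  refine ⟨⟨x, hx⟩, fun C hCD ⟨c, hc⟩ hclosed y hy => ?_⟩
  obtain ⟨p⟩ := hD.preconnected ⟨c, hCD hc⟩ ⟨y, hy⟩
  have walk_stays_in_C (a b : (D : Set V)) (p : (G.induce (D : Set V)).Walk a b) :
      (a : V) ∈ C → (b : V) ∈ C := by
    induction p with
    | nil => exact id
    | @cons u v _ huv _ ih => exact fun hu => ih (hclosed u hu v v.2 (by simpa using huv))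
  exact walk_stays_in_C _ _ p hc

theorem cutConnected_singleton (x : V) : CutConnected G {x} := by
  refine ⟨Finset.singleton_nonempty x, fun C hC ⟨c, hc⟩ _ => ?_⟩
  rwa [Finset.singleton_subset_iff, ← Finset.mem_singleton.1 (hC hc)]

section DecidableEq

variable [DecidableEq V]

theorem CutConnected.subset_of_isClosedIn {S C E : Finset V} (hS : CutConnected G S)
    (hSE : S ⊆ E) (hC : IsClosedIn G C E) (hne : (C ∩ S).Nonempty) : S ⊆ C := by
  refine (hS.2 (C ∩ S) Finset.inter_subset_right hne fun a ha b hb hab => ?_).trans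
    Finset.inter_subset_left
  exact Finset.mem_inter.2 ⟨hC a (Finset.mem_inter.1 ha).1 b (hSE hb) hab, hb⟩

theorem CutConnected.insert_of_adj {D : Finset V} (hD : CutConnected G D) {x y : V}
    (hy : y ∈ D) (hyx : G.Adj y x) : CutConnected G (insert x D) := by
  refine ⟨Finset.insert_nonempty x D, fun C hCD ⟨c, hc⟩ hclosed => ?_⟩
  have hDC : D ⊆ C := by
    refine hD.subset_of_isClosedIn (Finset.subset_insert x D) hclosed ?_
    rcases Finset.mem_insert.1 (hCD hc) with rfl | hcD
    · exact ⟨y, Finset.mem_inter.2 ⟨hclosed _ hc _ (by simp [hy]) hyx.symm, hy⟩⟩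
    · exact ⟨c, Finset.mem_inter.2 ⟨hc, hcD⟩⟩
  exact Finset.insert_subset (hclosed y (hDC hy) x (Finset.mem_insert_self x D) hyx) hDC

end DecidableEq

variable [Fintype V]

open Classical in
variable (G) in
/-- The closed neighbourhood `N[D]`. -/
noncomputable def closedNbhd (D : Finset V) : Finset V := {v | v ∈ D ∨ ∃ u ∈ D, G.Adj u v}

theorem mem_closedNbhd {D : Finset V} {v : V} :
    v ∈ closedNbhd G D ↔ v ∈ D ∨ ∃ u ∈ D, G.Adj u v := by
  simp [closedNbhd]

theorem subset_closedNbhd (D : Finset V) : D ⊆ closedNbhd G D :=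
  fun _ h => mem_closedNbhd.2 (Or.inl h)

theorem mem_closedNbhd_of_adj {D : Finset V} {u v : V} (hu : u ∈ D) (h : G.Adj u v) :
    v ∈ closedNbhd G D :=
  mem_closedNbhd.2 (Or.inr ⟨u, hu, h⟩)

theorem exists_adj_of_mem_closedNbhd {D : Finset V} {v : V} (h : v ∈ closedNbhd G D)
    (hv : v ∉ D) : ∃ u ∈ D, G.Adj u v :=
  (mem_closedNbhd.1 h).resolve_left hv

theorem closedNbhd_mono {D E : Finset V} (h : D ⊆ E) : closedNbhd G D ⊆ closedNbhd G E := by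
  intro v hv
  rcases mem_closedNbhd.1 hv with hv | ⟨u, hu, huv⟩
  · exact subset_closedNbhd E (h hv)
  · exact mem_closedNbhd_of_adj (h hu) huv

theorem isCDS_iff {D : Finset V} :
    IsCDS G D ↔ (∀ v, v ∈ closedNbhd G D) ∧ CutConnected G D :=
  and_congr (forall_congr' fun _ => mem_closedNbhd.symm)
    ⟨cutConnected_of_connected, CutConnected.connected⟩

theorem mem_closedNbhd_insert [DecidableEq V] {D : Finset V} {v w : V} :
    w ∈ closedNbhd G (insert v D) ↔ w ∈ closedNbhd G D ∨ w = v ∨ G.Adj v w := by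
  simp only [mem_closedNbhd, Finset.mem_insert, exists_eq_or_imp]
  grind

theorem CutConnected.insert_of_mem_closedNbhd [DecidableEq V] {D : Finset V}
    (hD : CutConnected G D) {x : V} (hx : x ∈ closedNbhd G D) : CutConnected G (insert x D) := by
  rcases mem_closedNbhd.1 hx with h | ⟨u, hu, h⟩
  · rwa [Finset.insert_eq_of_mem h]
  · exact hD.insert_of_adj hu h

theorem CutConnected.of_subset_closedNbhd {D E : Finset V} (hD : CutConnected G D)
    (hDE : D ⊆ E) (hE : E ⊆ closedNbhd G D) : CutConnected G E := by
  classical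
  suffices h : ∀ F ⊆ E, CutConnected G (D ∪ F) by
    simpa [Finset.union_eq_right.2 hDE] using h E subset_rfl
  intro F hF
  induction F using Finset.induction_on with
  | empty => simpa using hD
  | insert a F _ ih =>
    rw [Finset.union_insert]
    exact (ih ((Finset.subset_insert a F).trans hF)).insert_of_mem_closedNbhd
      (closedNbhd_mono Finset.subset_union_left (hE (hF (Finset.mem_insert_self a F))))

variable [DecidableEq V]

/-! ### Redundant vertices -/

variable (G) in
/-- `S` has a redundant vertex: one whose removal keeps `S` connected and loses none of the
vertices dominated by `S`. -/
def HasRedundantVertex (S : Finset V) : Prop :=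
  ∃ v ∈ S, CutConnected G (S.erase v) ∧ ∀ w, w = v ∨ G.Adj v w → w ∈ closedNbhd G (S.erase v)

theorem not_hasRedundantVertex_singleton (x : V) : ¬ HasRedundantVertex G {x} := by
  rintro ⟨v, hv, ⟨hne, -⟩, -⟩
  simp [Finset.mem_singleton.1 hv] at hne

section Erase

variable {S E C : Finset V} {v : V}

theorem CutConnected.erase_subset_of_isClosedIn (hE : CutConnected G E) (hv : v ∈ E)
    (hnbr : ∀ w ∈ E, G.Adj v w → w ∈ closedNbhd G S) (hSE : S ⊆ E.erase v) (hSC : S ⊆ C)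
    (hCE : C ⊆ E.erase v) (hclosed : IsClosedIn G C (E.erase v)) : E.erase v ⊆ C := by
  suffices hall : E ⊆ insert v C by
    intro x hx
    exact (Finset.mem_insert.1 (hall (Finset.mem_of_mem_erase hx))).resolve_left
      (Finset.ne_of_mem_erase hx)
  refine hE.2 _ (Finset.insert_subset hv (hCE.trans (Finset.erase_subset v E)))
    (Finset.insert_nonempty v C) fun a ha b hb hab => ?_
  by_cases hbv : b = v
  · simp [hbv]
  have hbE : b ∈ E.erase v := Finset.mem_erase.2 ⟨hbv, hb⟩
  refine Finset.mem_insert_of_mem ?_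
  rcases Finset.mem_insert.1 ha with rfl | ha
  · rcases mem_closedNbhd.1 (hnbr b hb hab) with h | ⟨u, hu, hub⟩
    · exact hSC h
    · exact hclosed u (hSC hu) b hbE hub
  · exact hclosed a ha b hbE hab

theorem CutConnected.inter_nonempty_of_isClosedIn (hE : CutConnected G E) (hv : v ∈ E)
    (hnbr : ∀ w ∈ E, G.Adj v w → w ∈ closedNbhd G S) (hSE : S ⊆ E.erase v)
    (hCE : C ⊆ E.erase v) (hC : C.Nonempty) (hclosed : IsClosedIn G C (E.erase v)) :
    (C ∩ S).Nonempty := by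
  by_contra hne
  have hvC : v ∉ C := fun h => by simpa using hCE h
  refine hvC (hE.2 C (hCE.trans (Finset.erase_subset v E)) hC (fun a ha b hb hab => ?_) hv)
  by_cases hbv : b = v
  · subst hbv
    refine absurd ?_ hne
    rcases mem_closedNbhd.1 (hnbr a (Finset.mem_of_mem_erase (hCE ha)) hab.symm) with
      h | ⟨u, hu, hua⟩
    · exact ⟨a, Finset.mem_inter.2 ⟨ha, h⟩⟩
    · exact ⟨u, Finset.mem_inter.2 ⟨hclosed a ha u (hSE hu) hua.symm, hu⟩⟩
  · exact hclosed a ha b (Finset.mem_erase.2 ⟨hbv, hb⟩) hab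

theorem CutConnected.erase (hE : CutConnected G E) (hv : v ∈ E) (hS : CutConnected G S)
    (hSE : S ⊆ E.erase v) (hnbr : ∀ w ∈ E, G.Adj v w → w ∈ closedNbhd G S) :
    CutConnected G (E.erase v) := by
  refine ⟨hS.1.mono hSE, fun C hCE hC hclosed => ?_⟩
  have hSC : S ⊆ C := hS.subset_of_isClosedIn hSE hclosed
    (hE.inter_nonempty_of_isClosedIn hv hnbr hSE hCE hC hclosed)
  exact hE.erase_subset_of_isClosedIn hv hnbr hSE hSC hCE hclosed

theorem closedNbhd_subset_erase {D : Finset V} (hSD : S ⊆ D.erase v)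
    (hnbr : ∀ w, w = v ∨ G.Adj v w → w ∈ closedNbhd G S) :
    closedNbhd G D ⊆ closedNbhd G (D.erase v) := by
  intro w hw
  by_cases hvw : w = v ∨ G.Adj v w
  · exact closedNbhd_mono hSD (hnbr w hvw)
  push Not at hvw
  rcases mem_closedNbhd.1 hw with h | ⟨u, hu, huw⟩
  · exact subset_closedNbhd _ (Finset.mem_erase.2 ⟨hvw.1, h⟩)
  · refine mem_closedNbhd_of_adj (Finset.mem_erase.2 ⟨?_, hu⟩) huw
    rintro rfl
    exact hvw.2 huw

end Erase

theorem HasRedundantVertex.not_isMinimalCDS {S D : Finset V} (hS : HasRedundantVertex G S)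
    (hSD : S ⊆ D) : ¬ IsMinimalCDS G D := by
  rintro ⟨hD, hmin⟩
  obtain ⟨v, hv, hconn, hnbr⟩ := hS
  obtain ⟨hdom, hDconn⟩ := isCDS_iff.1 hD
  have hsub : S.erase v ⊆ D.erase v := Finset.erase_subset_erase v hSD
  have herase : IsCDS G (D.erase v) := isCDS_iff.2
    ⟨fun w => closedNbhd_subset_erase hsub hnbr (hdom w),
      hDconn.erase (hSD hv) hconn hsub fun w _ h => hnbr w (Or.inr h)⟩
  exact Finset.notMem_erase v D (hmin herase (Finset.erase_subset v D) (hSD hv))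

theorem isMinimalCDS_of_not_hasRedundantVertex {D : Finset V} (hD : IsCDS G D)
    (h : ¬ HasRedundantVertex G D) : IsMinimalCDS G D := by
  refine ⟨hD, fun E hE hED => ?_⟩
  by_contra hne
  obtain ⟨v, hvD, hvE⟩ := Finset.not_subset.1 hne
  obtain ⟨hdom, hconn⟩ := isCDS_iff.1 hE
  have hEv : E ⊆ D.erase v := Finset.subset_erase.2 ⟨hED, hvE⟩
  exact h ⟨v, hvD, hconn.of_subset_closedNbhd hEv fun w _ => hdom w,
    fun w _ => closedNbhd_mono hEv (hdom w)⟩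

end Connectivity

/-! ### The search tree -/

section SearchTree

variable {V : Type*} [Fintype V] {G : SimpleGraph V}

variable (G) in
/-- The invariant of the search: the chosen vertices induce a connected subgraph, and the
excluded vertices are dominated and not chosen. -/
structure IsSearchState (D X : Finset V) : Prop where
  cutConnected : CutConnected G D
  subset_closedNbhd : X ⊆ closedNbhd G D
  disjoint : Disjoint D X

theorem isSearchState_singleton (x : V) : IsSearchState G {x} ∅ :=
  ⟨cutConnected_singleton x, Finset.empty_subset _, Finset.disjoint_empty_right _⟩

variable [DecidableEq V]

variable (G) in
/-- The vertices that are not dominated by `D`. -/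
noncomputable def undominated (D : Finset V) : Finset V := (closedNbhd G D)ᶜ

variable (G) in
/-- The vertices on which the search can branch at the state `(D, X)`, in which the vertices of
`D` are chosen and those of `X` are excluded: the undecided vertices dominated by `D`. -/
noncomputable def frontier (D X : Finset V) : Finset V := (closedNbhd G D \ D) \ X

open Classical in
variable (G) in
/-- The vertices that `v` would newly dominate when added to `D`. -/
noncomputable def undominatedNbrs (D : Finset V) (v : V) : Finset V :=
  {u ∈ undominated G D | G.Adj v u}

variable (G) in
/-- The number of vertices that `v` would newly dominate when added to `D`. -/
noncomputable def gain (D : Finset V) (v : V) : ℕ := (undominatedNbrs G D v).card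

open Classical in
variable (G) in
/-- The number of neighbours of `w` that are not excluded. -/
noncomputable def freeDegree (X : Finset V) (w : V) : ℕ :=
  (Finset.univ.filter fun u => G.Adj w u ∧ u ∉ X).card

variable (G) in
/-- The state `(D, X)` is dead: some undominated vertex has only excluded neighbours. -/
def IsDead (D X : Finset V) : Prop := ∃ w ∈ undominated G D, ∀ u, G.Adj w u → u ∈ X

variable {D E X : Finset V} {u v : V}

theorem mem_undominated : v ∈ undominated G D ↔ v ∉ closedNbhd G D := Finset.mem_compl

theorem mem_undominatedNbrs : u ∈ undominatedNbrs G D v ↔ u ∈ undominated G D ∧ G.Adj v u := by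
  simp [undominatedNbrs]

theorem mem_frontier : v ∈ frontier G D X ↔ v ∈ closedNbhd G D ∧ v ∉ D ∧ v ∉ X := by
  simp [frontier, and_assoc]

variable (G) in
/-- A rule for the vertex on which to branch: a frontier vertex whose inclusion creates a
redundant vertex if there is one, and otherwise a frontier vertex of largest gain. -/
def IsBranchingRule (rule : Finset V → Finset V → V) : Prop :=
  ∀ D X, (frontier G D X).Nonempty → rule D X ∈ frontier G D X ∧
    (HasRedundantVertex G (insert (rule D X) D) ∨
      ((∀ u ∈ frontier G D X, ¬ HasRedundantVertex G (insert u D)) ∧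
        ∀ u ∈ frontier G D X, gain G D u ≤ gain G D (rule D X)))

theorem exists_isBranchingRule [Nonempty V] :
    ∃ rule : Finset V → Finset V → V, IsBranchingRule G rule := by
  suffices h : ∀ D X, ∃ v, (frontier G D X).Nonempty → v ∈ frontier G D X ∧
      (HasRedundantVertex G (insert v D) ∨
        ((∀ u ∈ frontier G D X, ¬ HasRedundantVertex G (insert u D)) ∧
          ∀ u ∈ frontier G D X, gain G D u ≤ gain G D v)) by
    choose rule hrule using h
    exact ⟨rule, hrule⟩
  intro D X
  rcases (frontier G D X).eq_empty_or_nonempty with hF | hF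
  · exact ⟨Classical.arbitrary V, fun h => absurd hF h.ne_empty⟩
  by_cases hred : ∃ v ∈ frontier G D X, HasRedundantVertex G (insert v D)
  · obtain ⟨v, hv, h⟩ := hred
    exact ⟨v, fun _ => ⟨hv, Or.inl h⟩⟩
  · push Not at hred
    obtain ⟨v, hv, hmax⟩ := Finset.exists_max_image _ (gain G D) hF
    exact ⟨v, fun _ => ⟨hv, Or.inr ⟨hred, hmax⟩⟩⟩

open Classical in
variable (G) in
/-- The sets listed by the search below the state `(D, X)`, up to depth `m`. The branch that
includes the vertex `v = rule D X` is cut off if `insert v D` has a redundant vertex. -/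
noncomputable def enumerated (rule : Finset V → Finset V → V) :
    ℕ → Finset V → Finset V → List (Finset V)
  | 0, _, _ => []
  | m + 1, D, X =>
    if IsDead G D X then []
    else if frontier G D X = ∅ then (if undominated G D = ∅ then [D] else [])
    else (if HasRedundantVertex G (insert (rule D X) D) then []
      else enumerated rule m (insert (rule D X) D) X) ++ enumerated rule m D (insert (rule D X) X)

open Classical in
variable (G) in
/-- The number of leaves of the search tree below the state `(D, X)`, up to depth `m`; dead
states do not count, and a live state without live children counts as a leaf. -/
noncomputable def leafCount (rule : Finset V → Finset V → V) : ℕ → Finset V → Finset V → ℕ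
  | 0, _, _ => 0
  | m + 1, D, X =>
    if IsDead G D X then 0
    else if frontier G D X = ∅ then 1
    else max 1 ((if HasRedundantVertex G (insert (rule D X) D) then 0
      else leafCount rule m (insert (rule D X) D) X) + leafCount rule m D (insert (rule D X) X))

open Classical in
variable (G) in
/-- The number of moves of a depth-first traversal of the search tree below the state `(D, X)`:
one for the visit of each state and one for each return from a child to its parent. -/
noncomputable def stepCount (rule : Finset V → Finset V → V) : ℕ → Finset V → Finset V → ℕ
  | 0, _, _ => 0
  | m + 1, D, X =>
    if IsDead G D X then 1
    else if frontier G D X = ∅ then 1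
    else 1 + (if HasRedundantVertex G (insert (rule D X) D) then 0
      else stepCount rule m (insert (rule D X) D) X + 1) +
        stepCount rule m D (insert (rule D X) X) + 1

theorem stepCount_le (rule : Finset V → Finset V → V) (m : ℕ) (D X : Finset V) :
    stepCount G rule m D X ≤ 4 * m * leafCount G rule m D X + 1 := by
  induction m generalizing D X with
  | zero => simp [stepCount]
  | succ m ih =>
    have step (a b : ℕ) : 4 * m * a + 4 * m * b + 4 ≤ 4 * (m + 1) * max 1 (a + b) := by
      nlinarith [le_max_left 1 (a + b), Nat.mul_le_mul_left (4 * m) (le_max_right 1 (a + b))]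
    have hdel := ih D (insert (rule D X) X)
    have hins := ih (insert (rule D X) D) X
    rw [stepCount, leafCount]
    split_ifs
    · simp
    · simp
    · linarith [step 0 (leafCount G rule m D (insert (rule D X) X))]
    · linarith [step (leafCount G rule m (insert (rule D X) D) X)
        (leafCount G rule m D (insert (rule D X) X))]

theorem length_enumerated_le (rule : Finset V → Finset V → V) (m : ℕ) (D X : Finset V) :
    (enumerated G rule m D X).length ≤ leafCount G rule m D X := by
  induction m generalizing D X with
  | zero => simp [enumerated]
  | succ m ih =>
    rw [enumerated, leafCount]
    split_ifs
    · simp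
    · simp
    · simp
    · simpa using Or.inr (ih _ _)
    · simpa using Or.inr (add_le_add (ih _ _) (ih _ _))

theorem IsSearchState.insert_left (h : IsSearchState G D X) (hv : v ∈ frontier G D X) :
    IsSearchState G (insert v D) X := by
  obtain ⟨hdom, -, hvX⟩ := mem_frontier.1 hv
  exact ⟨h.cutConnected.insert_of_mem_closedNbhd hdom,
    h.subset_closedNbhd.trans (closedNbhd_mono (Finset.subset_insert _ _)),
    Finset.disjoint_insert_left.2 ⟨hvX, h.disjoint⟩⟩

theorem IsSearchState.insert_right (h : IsSearchState G D X) (hv : v ∈ frontier G D X) :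
    IsSearchState G D (insert v X) := by
  obtain ⟨hdom, hvD, -⟩ := mem_frontier.1 hv
  exact ⟨h.cutConnected, Finset.insert_subset hdom h.subset_closedNbhd,
    Finset.disjoint_insert_right.2 ⟨hvD, h.disjoint⟩⟩

theorem card_compl_insert_left (hv : v ∈ frontier G D X) :
    (insert v D ∪ X)ᶜ.card + 1 = (D ∪ X)ᶜ.card := by
  obtain ⟨-, hvD, hvX⟩ := mem_frontier.1 hv
  rw [Finset.insert_union, Finset.compl_insert, Finset.card_erase_add_one]
  simp [hvD, hvX]

theorem card_compl_insert_right (hv : v ∈ frontier G D X) :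
    (D ∪ insert v X)ᶜ.card + 1 = (D ∪ X)ᶜ.card := by
  rw [Finset.union_insert, ← Finset.insert_union, card_compl_insert_left hv]

theorem eq_of_frontier_eq_empty (hF : frontier G D X = ∅) (hD : D.Nonempty)
    (hE : CutConnected G E) (hDE : D ⊆ E) (hEX : Disjoint E X) : E = D := by
  refine Finset.Subset.antisymm (hE.2 D hDE hD fun x hx y hy hxy => ?_) hDE
  by_contra hyD
  have : y ∈ frontier G D X :=
    mem_frontier.2 ⟨mem_closedNbhd_of_adj hx hxy, hyD, Finset.disjoint_left.1 hEX hy⟩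
  simp [hF] at this

theorem IsSearchState.not_isDead_of_isCDS (h : IsSearchState G D X) (hE : IsCDS G E)
    (hDE : D ⊆ E) (hEX : Disjoint E X) : ¬ IsDead G D X := by
  rintro ⟨w, hw, hwX⟩
  obtain ⟨hdom, hconn⟩ := isCDS_iff.1 hE
  have hno : ∀ u ∈ E, ¬ G.Adj w u := fun u hu hwu => Finset.disjoint_left.1 hEX hu (hwX u hwu)
  have hwE : w ∈ E := (mem_closedNbhd.1 (hdom w)).resolve_right
    fun ⟨u, hu, huw⟩ => hno u hu huw.symm
  have hEw : E ⊆ {w} := hconn.2 {w} (by simpa using hwE) (Finset.singleton_nonempty w)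
    fun a ha b hb hab => absurd (Finset.mem_singleton.1 ha ▸ hab) (hno b hb)
  obtain ⟨d, hd⟩ := h.cutConnected.1
  rw [← Finset.mem_singleton.1 (hEw (hDE hd))] at hw
  exact mem_undominated.1 hw (CDSEnum.subset_closedNbhd D hd)

theorem IsSearchState.isCDS_of_undominated_eq_empty (h : IsSearchState G D X)
    (hU : undominated G D = ∅) : IsCDS G D := by
  refine isCDS_iff.2 ⟨fun v => ?_, h.cutConnected⟩
  by_contra hv
  simpa [hU] using mem_undominated.2 hv

theorem IsSearchState.isMinimalCDS_iff_of_frontier_eq_empty (h : IsSearchState G D X)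
    (hD : ¬ HasRedundantVertex G D) (hF : frontier G D X = ∅) :
    IsMinimalCDS G E ∧ D ⊆ E ∧ Disjoint E X ↔ undominated G D = ∅ ∧ E = D := by
  constructor
  · rintro ⟨hE, hDE, hEX⟩
    obtain rfl : E = D :=
      eq_of_frontier_eq_empty hF h.cutConnected.1 (isCDS_iff.1 hE.1).2 hDE hEX
    refine ⟨Finset.eq_empty_of_forall_notMem fun w hw => ?_, rfl⟩
    exact mem_undominated.1 hw ((isCDS_iff.1 hE.1).1 w)
  · rintro ⟨hU, rfl⟩
    exact ⟨isMinimalCDS_of_not_hasRedundantVertex (h.isCDS_of_undominated_eq_empty hU) hD,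
      subset_rfl, h.disjoint⟩

theorem HasRedundantVertex.isMinimalCDS_and_disjoint_insert_iff
    (h : HasRedundantVertex G (insert v D)) :
    IsMinimalCDS G E ∧ D ⊆ E ∧ Disjoint E (insert v X) ↔
      IsMinimalCDS G E ∧ D ⊆ E ∧ Disjoint E X := by
  refine and_congr_right fun hE => and_congr_right fun hDE => ?_
  rw [Finset.disjoint_insert_right, and_iff_right]
  exact fun hvE => h.not_isMinimalCDS (Finset.insert_subset hvE hDE) hE

theorem nodup_enumerated_and_mem_iff {rule : Finset V → Finset V → V}
    (hrule : IsBranchingRule G rule) (m : ℕ) (D X : Finset V) (hDX : IsSearchState G D X)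
    (hD : ¬ HasRedundantVertex G D) (hm : (D ∪ X)ᶜ.card < m) :
    (enumerated G rule m D X).Nodup ∧
      ∀ E, E ∈ enumerated G rule m D X ↔ IsMinimalCDS G E ∧ D ⊆ E ∧ Disjoint E X := by
  induction m generalizing D X with
  | zero => simp at hm
  | succ m ih =>
    rw [enumerated]
    split_ifs with hdead hF hU hred
    · exact ⟨List.nodup_nil, fun E => ⟨by simp, fun ⟨hE, hDE, hEX⟩ =>
        absurd hdead (hDX.not_isDead_of_isCDS hE.1 hDE hEX)⟩⟩
    · exact ⟨List.nodup_singleton _, fun E => by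
        simp [hDX.isMinimalCDS_iff_of_frontier_eq_empty hD hF, hU]⟩
    · exact ⟨List.nodup_nil, fun E => by
        simp [hDX.isMinimalCDS_iff_of_frontier_eq_empty hD hF, hU]⟩
    all_goals
      have hv := (hrule D X (Finset.nonempty_iff_ne_empty.2 hF)).1
      set v := rule D X
      obtain ⟨hnodup, hmem⟩ := ih D (insert v X) (hDX.insert_right hv) hD
        (by have := card_compl_insert_right hv; omega)
    · rw [List.nil_append]
      exact ⟨hnodup, fun E => (hmem E).trans hred.isMinimalCDS_and_disjoint_insert_iff⟩
    · obtain ⟨hnodup', hmem'⟩ := ih (insert v D) X (hDX.insert_left hv) hred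
        (by have := card_compl_insert_left hv; omega)
      refine ⟨List.nodup_append'.2 ⟨hnodup', hnodup, fun E hE' hE => ?_⟩, fun E => ?_⟩
      · exact (Finset.disjoint_insert_right.1 ((hmem E).1 hE).2.2).1
          (((hmem' E).1 hE').2.1 (Finset.mem_insert_self v D))
      · rw [List.mem_append, hmem', hmem, Finset.insert_subset_iff, Finset.disjoint_insert_right]
        tauto

end SearchTree

/-! ### The potential of a search state -/

/-- The weight of a frontier vertex that would newly dominate `k` vertices. -/
noncomputable def frontierWeight : ℕ → ℝ
  | 0 => 1
  | 1 => 1.7275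
  | 2 => 1.8095
  | _ + 3 => 1.8277

/-- The weight of an undominated vertex with `d` neighbours that are not excluded. -/
noncomputable def undominatedWeight : ℕ → ℝ
  | 0 => 1.49
  | 1 => 1.49
  | 2 => 1.8794
  | 3 => 1.9686
  | _ + 4 => 1.9884

theorem frontierWeight_mono : Monotone frontierWeight := by
  refine monotone_nat_of_le_succ fun n => ?_
  match n with
  | 0 | 1 | 2 | _ + 3 => norm_num [frontierWeight]

theorem undominatedWeight_mono : Monotone undominatedWeight := by
  refine monotone_nat_of_le_succ fun n => ?_
  match n with
  | 0 | 1 | 2 | 3 | _ + 4 => norm_num [undominatedWeight]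

theorem one_le_frontierWeight (k : ℕ) : 1 ≤ frontierWeight k :=
  frontierWeight_mono (Nat.zero_le k)

theorem frontierWeight_le (k : ℕ) : frontierWeight k ≤ 1.8277 :=
  frontierWeight_mono (Nat.le_add_right k 3)

theorem frontierWeight_of_three_le {k : ℕ} (h : 3 ≤ k) : frontierWeight k = 1.8277 := by
  obtain ⟨j, rfl⟩ := Nat.exists_eq_add_of_le' h
  rfl

theorem le_undominatedWeight (d : ℕ) : 1.49 ≤ undominatedWeight d :=
  undominatedWeight_mono (Nat.zero_le d)

theorem undominatedWeight_pos (d : ℕ) : 0 < undominatedWeight d :=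
  (show (0 : ℝ) < 1.49 by norm_num).trans_le (le_undominatedWeight d)

theorem undominatedWeight_le (d : ℕ) : undominatedWeight d ≤ 1.9884 :=
  undominatedWeight_mono (Nat.le_add_right d 4)

theorem undominatedWeight_of_four_le {k : ℕ} (h : 4 ≤ k) : undominatedWeight k = 1.9884 := by
  obtain ⟨j, rfl⟩ := Nat.exists_eq_add_of_le' h
  rfl

theorem frontierWeight_le_mul_undominatedWeight {k d : ℕ} (h : k + 1 ≤ d) :
    frontierWeight k ≤ 0.9192 * undominatedWeight d := by
  refine le_trans ?_ (mul_le_mul_of_nonneg_left (undominatedWeight_mono h) (by norm_num))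
  match k with
  | 0 | 1 | 2 | _ + 3 => norm_num [frontierWeight, undominatedWeight]

theorem prod_le_list_prod_mul_prod {ι R : Type*} [Fintype ι] [CommSemiring R] [PartialOrder R]
    [IsOrderedRing R] {f g : ι → R} (l : List (ι × R)) (hl : (l.map Prod.fst).Nodup)
    (hf : ∀ u, 0 ≤ f u) (hfg : ∀ p ∈ l, f p.1 ≤ p.2 * g p.1)
    (h : ∀ u ∉ l.map Prod.fst, f u ≤ g u) :
    ∏ u, f u ≤ (l.map Prod.snd).prod * ∏ u, g u := by
  classical
  induction l generalizing g with
  | nil => simpa using Finset.prod_le_prod (fun u _ => hf u) fun u _ => h u (by simp)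
  | cons p l ih =>
    obtain ⟨a, c⟩ := p
    obtain ⟨ha, hl⟩ := List.nodup_cons.1 hl
    have hprod : ∏ u, Function.update g a (c * g a) u = c * ∏ u, g u := by
      rw [Finset.prod_update_of_mem (Finset.mem_univ a), mul_assoc,
        ← Finset.prod_eq_mul_prod_sdiff_singleton_of_mem (Finset.mem_univ a)]
    rw [List.map_cons, List.prod_cons, mul_comm c, mul_assoc, ← hprod]
    refine ih hl (fun p hp => ?_) fun u hu => ?_
    · rw [Function.update_of_ne (ne_of_mem_of_not_mem (List.mem_map_of_mem hp) ha)]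
      exact hfg p (List.mem_cons_of_mem _ hp)
    · by_cases hua : u = a
      · subst hua
        simpa using hfg (u, c) List.mem_cons_self
      · rw [Function.update_of_ne hua]
        exact h u (by simpa [hua] using hu)

section Potential

variable {V : Type*} [Fintype V] [DecidableEq V] {G : SimpleGraph V}
  {D X B : Finset V} {u v w : V}

variable (G) in
/-- The vertex `u` is blocked at the state `(D, X)`: including `u`, now or later, makes some
vertex of `D` redundant. -/
def IsBlocked (D X : Finset V) (u : V) : Prop :=
  ∃ v ∈ D, CutConnected G (D.erase v) ∧
    (∀ w, w = v ∨ G.Adj v w → w ∈ closedNbhd G (insert u (D.erase v))) ∧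
    ∀ w, w ∉ X → G.Adj v w → w ∈ closedNbhd G (D.erase v)

theorem mem_closedNbhd_erase_of_mem_frontier (hu : u ∈ frontier G D X)
    (h : ∀ w, w ∉ X → G.Adj v w → w ∈ closedNbhd G (D.erase v)) :
    u ∈ closedNbhd G (D.erase v) := by
  obtain ⟨hdom, huD, huX⟩ := mem_frontier.1 hu
  obtain ⟨x, hx, hxu⟩ := exists_adj_of_mem_closedNbhd hdom huD
  by_cases hxv : x = v
  · exact h u huX (hxv ▸ hxu)
  · exact mem_closedNbhd_of_adj (Finset.mem_erase.2 ⟨hxv, hx⟩) hxu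

theorem ne_of_mem_frontier_of_mem (hu : u ∈ frontier G D X) (hv : v ∈ D) : u ≠ v :=
  fun h => (mem_frontier.1 hu).2.1 (h ▸ hv)

theorem IsBlocked.hasRedundantVertex (h : IsBlocked G D X u) (hu : u ∈ frontier G D X) :
    HasRedundantVertex G (insert u D) := by
  obtain ⟨v, hv, hconn, hdom, hX⟩ := h
  refine ⟨v, by simp [hv], ?_⟩
  rw [Finset.erase_insert_of_ne (ne_of_mem_frontier_of_mem hu hv)]
  exact ⟨hconn.insert_of_mem_closedNbhd (mem_closedNbhd_erase_of_mem_frontier hu hX), hdom⟩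

theorem IsBlocked.mono_right {Y : Finset V} (h : IsBlocked G D X u) (hXY : X ⊆ Y) :
    IsBlocked G D Y u := by
  obtain ⟨v, hv, hconn, hdom, hX⟩ := h
  exact ⟨v, hv, hconn, hdom, fun w hw => hX w fun h => hw (hXY h)⟩

theorem IsBlocked.insert_left (h : IsBlocked G D X u) (hv : v ∈ frontier G D X) :
    IsBlocked G (insert v D) X u := by
  obtain ⟨x, hx, hconn, hdom, hX⟩ := h
  refine ⟨x, by simp [hx], ?_⟩
  rw [Finset.erase_insert_of_ne (ne_of_mem_frontier_of_mem hv hx)]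
  exact ⟨hconn.insert_of_mem_closedNbhd (mem_closedNbhd_erase_of_mem_frontier hv hX),
    fun w hw => closedNbhd_mono
      (Finset.insert_subset_insert _ (Finset.subset_insert _ _)) (hdom w hw),
    fun w hw hxw => closedNbhd_mono (Finset.subset_insert _ _) (hX w hw hxw)⟩

variable (G) in
/-- The weight of the vertex `u` at the state `(D, X)`, where the vertices of `B` are known to be
blocked. -/
noncomputable def weight (D X B : Finset V) (u : V) : ℝ :=
  if u ∈ D ∪ X then 1
  else if u ∈ closedNbhd G D then (if u ∈ B then 1 else frontierWeight (gain G D u))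
  else if u ∈ B then 1.49 else undominatedWeight (freeDegree G X u)

variable (G) in
/-- The potential of the state `(D, X)`: the product of the weights of all vertices. It bounds
the number of leaves of the search tree below `(D, X)`. -/
noncomputable def potential (D X B : Finset V) : ℝ := ∏ u, weight G D X B u

theorem one_le_weight (D X B : Finset V) (u : V) : 1 ≤ weight G D X B u := by
  unfold weight
  split_ifs
  · exact le_rfl
  · exact le_rfl
  · exact one_le_frontierWeight _
  · norm_num
  · exact le_trans (by norm_num) (le_undominatedWeight _)

theorem weight_nonneg (D X B : Finset V) (u : V) : 0 ≤ weight G D X B u :=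
  zero_le_one.trans (one_le_weight D X B u)

theorem weight_le (D X B : Finset V) (u : V) : weight G D X B u ≤ 1.9884 := by
  unfold weight
  split_ifs
  · norm_num
  · norm_num
  · exact (frontierWeight_le _).trans (by norm_num)
  · norm_num
  · exact undominatedWeight_le _

theorem one_le_potential (D X B : Finset V) : 1 ≤ potential G D X B := by
  simpa [potential] using Finset.prod_le_prod (fun _ _ => zero_le_one)
    fun u (_ : u ∈ Finset.univ) => one_le_weight (G := G) D X B u

theorem potential_nonneg (D X B : Finset V) : 0 ≤ potential G D X B :=
  zero_le_one.trans (one_le_potential D X B)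

theorem potential_le (D X B : Finset V) : potential G D X B ≤ 1.9884 ^ Fintype.card V := by
  simpa [potential] using Finset.prod_le_prod (fun u _ => weight_nonneg D X B u)
    fun u (_ : u ∈ Finset.univ) => weight_le (G := G) D X B u

theorem potential_le_list_prod_mul {D' X' B' : Finset V} (l : List (V × ℝ))
    (hl : (l.map Prod.fst).Nodup) (h : ∀ u, weight G D' X' B' u ≤ weight G D X B u)
    (hc : ∀ p ∈ l, weight G D' X' B' p.1 ≤ p.2 * weight G D X B p.1) :
    potential G D' X' B' ≤ (l.map Prod.snd).prod * potential G D X B :=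
  prod_le_list_prod_mul_prod l hl (weight_nonneg D' X' B') hc fun u _ => h u

theorem weight_of_mem_frontier (hv : v ∈ frontier G D X) (hB : v ∉ B) :
    weight G D X B v = frontierWeight (gain G D v) := by
  obtain ⟨hdom, hvD, hvX⟩ := mem_frontier.1 hv
  simp [weight, hdom, hvD, hvX, hB]

theorem weight_of_mem_frontier_of_mem (hv : v ∈ frontier G D X) (hB : v ∈ B) :
    weight G D X B v = 1 := by
  simp [weight, (mem_frontier.1 hv).1, hB]

theorem weight_insert_left_self (D X B : Finset V) (v : V) :
    weight G (insert v D) X B v = 1 := by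
  simp [weight]

theorem weight_insert_right_self (D X B : Finset V) (v : V) :
    weight G D (insert v X) B v = 1 := by
  simp [weight]

theorem IsSearchState.notMem_union (hDX : IsSearchState G D X) (hw : w ∈ undominated G D) :
    w ∉ D ∪ X := by
  rw [mem_undominated] at hw
  exact fun h => hw (Finset.union_subset (CDSEnum.subset_closedNbhd D) hDX.subset_closedNbhd h)

theorem IsSearchState.weight_of_mem_undominated (hDX : IsSearchState G D X)
    (hw : w ∈ undominated G D) (hB : w ∉ B) :
    weight G D X B w = undominatedWeight (freeDegree G X w) := by
  rw [weight, if_neg (hDX.notMem_union hw), if_neg (mem_undominated.1 hw), if_neg hB]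

theorem IsSearchState.weight_of_mem_undominated_of_mem (hDX : IsSearchState G D X)
    (hw : w ∈ undominated G D) (hB : w ∈ B) : weight G D X B w = 1.49 := by
  rw [weight, if_neg (hDX.notMem_union hw), if_neg (mem_undominated.1 hw), if_pos hB]

theorem mem_undominated_insert (hv : v ∈ closedNbhd G D) :
    w ∈ undominated G (insert v D) ↔ w ∈ undominated G D ∧ ¬ G.Adj v w := by
  simp only [mem_undominated, mem_closedNbhd_insert]
  have : w = v → w ∈ closedNbhd G D := fun h => h ▸ hv
  tauto

theorem undominatedNbrs_insert (hv : v ∈ closedNbhd G D) (w : V) :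
    undominatedNbrs G (insert v D) w = undominatedNbrs G D w \ undominatedNbrs G D v := by
  ext u
  simp only [mem_undominatedNbrs, mem_undominated_insert hv, Finset.mem_sdiff]
  tauto

theorem gain_insert_le (hv : v ∈ closedNbhd G D) : gain G (insert v D) w ≤ gain G D w := by
  rw [gain, undominatedNbrs_insert hv]
  exact Finset.card_le_card Finset.sdiff_subset

theorem gain_insert_lt {x : V} (hv : v ∈ closedNbhd G D) (hw : w ∈ undominatedNbrs G D v)
    (hxw : G.Adj x w) : gain G (insert v D) x < gain G D x := by
  rw [gain, undominatedNbrs_insert hv]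
  refine Finset.card_lt_card ((Finset.ssubset_iff_of_subset Finset.sdiff_subset).2
    ⟨w, mem_undominatedNbrs.2 ⟨(mem_undominatedNbrs.1 hw).1, hxw⟩, ?_⟩)
  simp [hw]

theorem freeDegree_insert_le : freeDegree G (insert v X) w ≤ freeDegree G X w := by
  refine Finset.card_le_card fun u => ?_
  simp only [Finset.mem_filter, Finset.mem_insert]
  tauto

theorem freeDegree_insert_add_one (hv : v ∉ X) (h : G.Adj w v) :
    freeDegree G (insert v X) w + 1 = freeDegree G X w := by
  classical
  have : ({u | G.Adj w u ∧ u ∉ insert v X} : Finset V) =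
      ({u | G.Adj w u ∧ u ∉ X} : Finset V).erase v := by
    ext u
    simp only [Finset.mem_filter, Finset.mem_insert, Finset.mem_erase]
    tauto
  rw [freeDegree, freeDegree, ← Finset.card_erase_add_one
    (by simp [hv, h] : v ∈ ({u | G.Adj w u ∧ u ∉ X} : Finset V)), ← this]

theorem IsSearchState.gain_insert_lt_freeDegree (hDX : IsSearchState G D X)
    (hv : v ∈ frontier G D X) (hvw : G.Adj v w) :
    gain G (insert v D) w < freeDegree G X w := by
  rw [← freeDegree_insert_add_one (mem_frontier.1 hv).2.2 hvw.symm]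
  refine Nat.lt_succ_of_le (Finset.card_le_card fun u => ?_)
  simp only [mem_undominatedNbrs, Finset.mem_filter, Finset.mem_univ, true_and]
  rintro ⟨hu, hwu⟩
  have hu' := (hDX.insert_left hv).notMem_union hu
  refine ⟨hwu, fun h => hu' ?_⟩
  rcases Finset.mem_insert.1 h with rfl | h
  · simp
  · exact Finset.mem_union_right _ h

theorem IsSearchState.mem_frontier_insert_left (hDX : IsSearchState G D X)
    (hw : w ∈ undominatedNbrs G D v) : w ∈ frontier G (insert v D) X := by
  obtain ⟨hw, hvw⟩ := mem_undominatedNbrs.1 hw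
  have hw' := hDX.notMem_union hw
  exact mem_frontier.2 ⟨mem_closedNbhd_of_adj (Finset.mem_insert_self v D) hvw,
    by simpa [hvw.ne'] using fun h => hw' (Finset.mem_union_left X h),
    fun h => hw' (Finset.mem_union_right D h)⟩

theorem IsSearchState.weight_insert_left_le_mul_of_mem (hDX : IsSearchState G D X)
    (hw : w ∈ undominatedNbrs G D v) (hB : w ∈ B) :
    weight G (insert v D) X B w ≤ 0.6712 * weight G D X B w := by
  rw [hDX.weight_of_mem_undominated_of_mem (mem_undominatedNbrs.1 hw).1 hB,
    weight_of_mem_frontier_of_mem (hDX.mem_frontier_insert_left hw) hB]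
  norm_num

theorem IsSearchState.weight_insert_left_le_mul (hDX : IsSearchState G D X)
    (hv : v ∈ frontier G D X) (hw : w ∈ undominatedNbrs G D v) :
    weight G (insert v D) X B w ≤ 0.9192 * weight G D X B w := by
  by_cases hB : w ∈ B
  · exact (hDX.weight_insert_left_le_mul_of_mem hw hB).trans
      (mul_le_mul_of_nonneg_right (by norm_num) (weight_nonneg D X B w))
  · rw [hDX.weight_of_mem_undominated (mem_undominatedNbrs.1 hw).1 hB,
      weight_of_mem_frontier (hDX.mem_frontier_insert_left hw) hB]
    exact frontierWeight_le_mul_undominatedWeight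
      (hDX.gain_insert_lt_freeDegree hv (mem_undominatedNbrs.1 hw).2)

theorem IsSearchState.weight_insert_left_le (hDX : IsSearchState G D X)
    (hv : v ∈ frontier G D X) (u : V) : weight G (insert v D) X B u ≤ weight G D X B u := by
  have hvdom := (mem_frontier.1 hv).1
  by_cases hu : u ∈ insert v D ∪ X
  · rw [weight, if_pos hu]
    exact one_le_weight _ _ _ _
  have hu' : u ∉ D ∪ X :=
    fun h => hu (Finset.union_subset_union_left (Finset.subset_insert v D) h)
  by_cases hdom : u ∈ closedNbhd G D
  · rw [weight, weight, if_neg hu, if_neg hu', if_pos hdom,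
      if_pos (closedNbhd_mono (Finset.subset_insert _ _) hdom)]
    split_ifs
    · exact le_rfl
    · exact frontierWeight_mono (gain_insert_le hvdom)
  by_cases hvu : G.Adj v u
  · refine (hDX.weight_insert_left_le_mul hv
      (mem_undominatedNbrs.2 ⟨mem_undominated.2 hdom, hvu⟩)).trans ?_
    linarith [weight_nonneg (G := G) D X B u]
  · have hdom' : u ∉ closedNbhd G (insert v D) := fun h => by
      rcases mem_closedNbhd_insert.1 h with h | rfl | h
      exacts [hdom h, hdom hvdom, hvu h]
    rw [weight, weight, if_neg hu, if_neg hu', if_neg hdom, if_neg hdom']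

theorem weight_insert_right_le {B' : Finset V} (hB : B ⊆ B') (u : V) :
    weight G D (insert v X) B' u ≤ weight G D X B u := by
  by_cases hu : u ∈ D ∪ insert v X
  · rw [weight, if_pos hu]
    exact one_le_weight _ _ _ _
  have hu' : u ∉ D ∪ X :=
    fun h => hu (Finset.union_subset_union_right (Finset.subset_insert v X) h)
  rw [weight, weight, if_neg hu, if_neg hu']
  split_ifs with hdom hB' hu hu hB' hu hu
  · exact le_rfl
  · exact one_le_frontierWeight _
  · exact absurd (hB hu) hB'
  · exact le_rfl
  · exact le_rfl
  · exact le_undominatedWeight _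
  · exact absurd (hB hu) hB'
  · exact undominatedWeight_mono freeDegree_insert_le

end Potential

/-! ### Leaves below a state and the potential of its children -/

section LeafBounds

variable {V : Type*} [Fintype V] [DecidableEq V] {G : SimpleGraph V}
  {D X B : Finset V} {u v w : V}

variable (G) in
/-- A search state together with a set `B` of vertices that are known to be blocked. -/
structure IsMarkedState (D X B : Finset V) : Prop extends IsSearchState G D X where
  isBlocked : ∀ u ∈ B, IsBlocked G D X u

theorem IsMarkedState.insert_left (h : IsMarkedState G D X B) (hv : v ∈ frontier G D X) :
    IsMarkedState G (insert v D) X B :=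
  ⟨h.toIsSearchState.insert_left hv, fun u hu => (h.isBlocked u hu).insert_left hv⟩

theorem IsMarkedState.insert_right (h : IsMarkedState G D X B) (hv : v ∈ frontier G D X) :
    IsMarkedState G D (insert v X) B :=
  ⟨h.toIsSearchState.insert_right hv,
    fun u hu => (h.isBlocked u hu).mono_right (Finset.subset_insert v X)⟩

theorem mem_frontier_insert_right :
    w ∈ frontier G D (insert v X) ↔ w ∈ frontier G D X ∧ w ≠ v := by
  simp only [mem_frontier, Finset.mem_insert]
  tauto

theorem IsSearchState.hasRedundantVertex_of_gain_eq_zero (hDX : IsSearchState G D X)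
    (hv : v ∈ frontier G D X) (h : gain G D v = 0) : HasRedundantVertex G (insert v D) := by
  obtain ⟨hdom, hvD, -⟩ := mem_frontier.1 hv
  refine ⟨v, Finset.mem_insert_self v D, ?_⟩
  rw [Finset.erase_insert hvD]
  refine ⟨hDX.cutConnected, ?_⟩
  rintro w (rfl | hvw)
  · exact hdom
  · by_contra hw
    exact Finset.eq_empty_iff_forall_notMem.1 (Finset.card_eq_zero.1 h) w
      (mem_undominatedNbrs.2 ⟨mem_undominated.2 hw, hvw⟩)

theorem isDead_of_freeDegree_eq_zero (hw : w ∈ undominated G D) (h : freeDegree G X w = 0) :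
    IsDead G D X := by
  classical
  refine ⟨w, hw, fun u hwu => ?_⟩
  by_contra hu
  exact Finset.filter_eq_empty_iff.1 (Finset.card_eq_zero.1 h) (Finset.mem_univ u) ⟨hwu, hu⟩

theorem IsSearchState.freeDegree_eq_gain_add_one (hDX : IsSearchState G D X)
    (hv : v ∈ frontier G D X) (hw : w ∈ undominatedNbrs G D v)
    (honly : ∀ x ∈ frontier G D X, G.Adj x w → x = v) :
    freeDegree G X w = gain G D w + 1 := by
  classical
  obtain ⟨hdom, -, hvX⟩ := mem_frontier.1 hv
  obtain ⟨hw, hvw⟩ := mem_undominatedNbrs.1 hw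
  have hnbrs : ({u | G.Adj w u ∧ u ∉ X} : Finset V) = insert v (undominatedNbrs G D w) := by
    ext u
    simp only [Finset.mem_filter, Finset.mem_univ, true_and, Finset.mem_insert,
      mem_undominatedNbrs]
    constructor
    · rintro ⟨hwu, huX⟩
      by_cases hu : u ∈ closedNbhd G D
      · exact Or.inl (honly u (mem_frontier.2 ⟨hu, fun huD =>
          mem_undominated.1 hw (mem_closedNbhd_of_adj huD hwu.symm), huX⟩) hwu.symm)
      · exact Or.inr ⟨mem_undominated.2 hu, hwu⟩
    · rintro (rfl | ⟨hu, hwu⟩)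
      · exact ⟨hvw.symm, hvX⟩
      · exact ⟨hwu, fun huX => hDX.notMem_union hu (Finset.mem_union_right D huX)⟩
  have hvU : v ∉ undominatedNbrs G D w := by
    simp [mem_undominatedNbrs, mem_undominated, hdom]
  rw [freeDegree, gain, ← Finset.card_insert_of_notMem hvU, ← hnbrs]

variable (G) in
/-- The factor by which the weights of the undominated neighbours of a frontier vertex `v`
decrease when `v` is included. -/
noncomputable def insertCoeff (D B : Finset V) (v : V) : ℝ :=
  0.9192 ^ (undominatedNbrs G D v \ B).card * 0.6712 ^ (undominatedNbrs G D v ∩ B).card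

variable (G) in
/-- The factor by which the weights of the undominated neighbours of a frontier vertex `v`
decrease when the exclusion of `v` makes them all blocked. -/
noncomputable def excludeCoeff (D B : Finset V) (v : V) : ℝ :=
  0.7929 ^ (undominatedNbrs G D v \ B).card

theorem insertCoeff_nonneg (D B : Finset V) (v : V) : 0 ≤ insertCoeff G D B v := by
  unfold insertCoeff
  positivity

theorem excludeCoeff_nonneg (D B : Finset V) (v : V) : 0 ≤ excludeCoeff G D B v := by
  unfold excludeCoeff
  positivity

theorem insertCoeff_le_pow {k : ℕ} (hk : k ≤ gain G D v) :
    insertCoeff G D B v ≤ 0.9192 ^ k :=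
  calc insertCoeff G D B v
      ≤ 0.9192 ^ (undominatedNbrs G D v \ B).card * 0.9192 ^ (undominatedNbrs G D v ∩ B).card := by
        unfold insertCoeff
        gcongr
        norm_num
    _ = 0.9192 ^ gain G D v := by
        rw [← pow_add, Finset.card_sdiff_add_card_inter, gain]
    _ ≤ 0.9192 ^ k := pow_le_pow_of_le_one (by norm_num) (by norm_num) hk

theorem inv_frontierWeight_nonneg (k : ℕ) : 0 ≤ (frontierWeight k)⁻¹ :=
  inv_nonneg.2 (zero_le_one.trans (one_le_frontierWeight k))

theorem inv_frontierWeight_mul_weight (hv : v ∈ frontier G D X) (hB : v ∉ B) :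
    (frontierWeight (gain G D v))⁻¹ * weight G D X B v = 1 := by
  rw [weight_of_mem_frontier hv hB, inv_mul_cancel₀]
  linarith [one_le_frontierWeight (gain G D v)]

theorem notMem_undominatedNbrs_of_mem_frontier (hu : u ∈ frontier G D X) :
    u ∉ undominatedNbrs G D v :=
  fun h => mem_undominated.1 (mem_undominatedNbrs.1 h).1 (mem_frontier.1 hu).1

theorem IsSearchState.potential_insert_left_le_list_prod (hDX : IsSearchState G D X)
    (hv : v ∈ frontier G D X) (hvB : v ∉ B) (l : List (V × ℝ))
    (hl : (v :: l.map Prod.fst).Nodup)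
    (hc : ∀ p ∈ l, weight G (insert v D) X B p.1 ≤ p.2 * weight G D X B p.1) :
    potential G (insert v D) X B ≤
      (frontierWeight (gain G D v))⁻¹ * (l.map Prod.snd).prod * potential G D X B := by
  refine potential_le_list_prod_mul ((v, (frontierWeight (gain G D v))⁻¹) :: l) hl
    (hDX.weight_insert_left_le hv) fun p hp => ?_
  rcases List.mem_cons.1 hp with rfl | hp
  · rw [weight_insert_left_self, inv_frontierWeight_mul_weight hv hvB]
  · exact hc p hp

theorem potential_insert_right_le_list_prod {B' : Finset V} (hv : v ∈ frontier G D X)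
    (hvB : v ∉ B) (hB : B ⊆ B') (l : List (V × ℝ)) (hl : (v :: l.map Prod.fst).Nodup)
    (hc : ∀ p ∈ l, weight G D (insert v X) B' p.1 ≤ p.2 * weight G D X B p.1) :
    potential G D (insert v X) B' ≤
      (frontierWeight (gain G D v))⁻¹ * (l.map Prod.snd).prod * potential G D X B := by
  refine potential_le_list_prod_mul ((v, (frontierWeight (gain G D v))⁻¹) :: l) hl
    (weight_insert_right_le hB) fun p hp => ?_
  rcases List.mem_cons.1 hp with rfl | hp
  · rw [weight_insert_right_self, inv_frontierWeight_mul_weight hv hvB]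
  · exact hc p hp

theorem IsSearchState.potential_insert_left_le (hDX : IsSearchState G D X)
    (hv : v ∈ frontier G D X) (hvB : v ∉ B) :
    potential G (insert v D) X B ≤
      (frontierWeight (gain G D v))⁻¹ * insertCoeff G D B v * potential G D X B := by
  have key := hDX.potential_insert_left_le_list_prod hv hvB
    ((undominatedNbrs G D v \ B).toList.map (·, 0.9192) ++
      (undominatedNbrs G D v ∩ B).toList.map (·, 0.6712)) ?_ ?_
  · simpa [Function.comp_def, insertCoeff] using key
  · simp only [List.map_append, List.map_map, Function.comp_def, List.map_id']
    refine List.nodup_cons.2 ⟨?_, List.nodup_append'.2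
      ⟨Finset.nodup_toList _, Finset.nodup_toList _, fun u hu hu' => ?_⟩⟩
    · simp [notMem_undominatedNbrs_of_mem_frontier hv]
    · exact Finset.disjoint_left.1 (Finset.disjoint_sdiff_inter _ _)
        (Finset.mem_toList.1 hu) (Finset.mem_toList.1 hu')
  · simp only [List.mem_append, List.mem_map, Finset.mem_toList, Finset.mem_sdiff,
      Finset.mem_inter]
    rintro _ (⟨u, ⟨hu, -⟩, rfl⟩ | ⟨u, ⟨hu, huB⟩, rfl⟩)
    · exact hDX.weight_insert_left_le_mul hv hu
    · exact hDX.weight_insert_left_le_mul_of_mem hu huB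

theorem potential_insert_right_le (hv : v ∈ frontier G D X) (hvB : v ∉ B) :
    potential G D (insert v X) B ≤ (frontierWeight (gain G D v))⁻¹ * potential G D X B := by
  simpa using potential_insert_right_le_list_prod hv hvB subset_rfl [] (List.nodup_singleton v)
    (by simp)

theorem potential_insert_right_le_self :
    potential G D (insert v X) B ≤ potential G D X B :=
  Finset.prod_le_prod (fun u _ => weight_nonneg _ _ _ u)
    fun u _ => weight_insert_right_le subset_rfl u

theorem IsSearchState.potential_insert_right_union_le (hDX : IsSearchState G D X)
    (hv : v ∈ frontier G D X) (hvB : v ∉ B) (hlive : ¬ IsDead G D (insert v X)) :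
    potential G D (insert v X) (B ∪ undominatedNbrs G D v) ≤
      (frontierWeight (gain G D v))⁻¹ * excludeCoeff G D B v * potential G D X B := by
  have key := potential_insert_right_le_list_prod (G := G) hv hvB
    (Finset.subset_union_left (s₁ := B) (s₂ := undominatedNbrs G D v))
    ((undominatedNbrs G D v \ B).toList.map (·, 0.7929)) ?_ ?_
  · simpa [Function.comp_def, excludeCoeff] using key
  · simp only [List.map_map, Function.comp_def, List.map_id']
    exact List.nodup_cons.2 ⟨by simp [notMem_undominatedNbrs_of_mem_frontier hv],
      Finset.nodup_toList _⟩
  · simp only [List.mem_map, Finset.mem_toList, Finset.mem_sdiff]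
    rintro _ ⟨u, ⟨hu, huB⟩, rfl⟩
    obtain ⟨huU, hvu⟩ := mem_undominatedNbrs.1 hu
    have hdeg := freeDegree_insert_add_one (mem_frontier.1 hv).2.2 hvu.symm
    have hdeg0 : freeDegree G (insert v X) u ≠ 0 :=
      fun h => hlive (isDead_of_freeDegree_eq_zero huU h)
    have hweight : 1.8794 ≤ undominatedWeight (freeDegree G X u) :=
      undominatedWeight_mono (show 2 ≤ freeDegree G X u by omega)
    rw [hDX.weight_of_mem_undominated huU huB,
      (hDX.insert_right hv).weight_of_mem_undominated_of_mem huU (Finset.mem_union_right B hu)]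
    linarith

theorem weight_le_potential (D X B : Finset V) (u : V) :
    weight G D X B u ≤ potential G D X B := by
  rw [potential, ← Finset.mul_prod_erase Finset.univ _ (Finset.mem_univ u)]
  refine le_mul_of_one_le_right (weight_nonneg D X B u) ?_
  simpa using Finset.prod_le_prod (fun _ _ => zero_le_one)
    fun x (_ : x ∈ Finset.univ.erase u) => one_le_weight (G := G) D X B x

theorem le_potential_of_three_le_gain (hw : w ∈ frontier G D X) (hwB : w ∉ B)
    (h3 : 3 ≤ gain G D w) : 1.8277 ≤ potential G D X B := by
  have h := weight_le_potential (G := G) D X B w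
  rwa [weight_of_mem_frontier hw hwB, frontierWeight_of_three_le h3] at h

/-! ### The bounds on the number of leaves -/

variable {rule : Finset V → Finset V → V} {m : ℕ}

variable (G) in
/-- The bounds on the number of leaves below a state that are proved simultaneously by induction.
The field `unique` concerns a state with a unique frontier vertex of gain at least `2`
whose exclusion blocks all the vertices that it would dominate. -/
structure LeafBounds (rule : Finset V → Finset V → V) (m : ℕ) (D X B : Finset V) : Prop where
  basic : (leafCount G rule m D X : ℝ) ≤ potential G D X B
  large : ∀ w ∈ frontier G D X, w ∉ B → 3 ≤ gain G D w →
    (leafCount G rule m D X : ℝ) ≤ 0.9721 * potential G D X B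
  large_pair : ∀ w ∈ frontier G D X, ∀ w' ∈ frontier G D X, w ≠ w' → w ∉ B → w' ∉ B →
    3 ≤ gain G D w → 3 ≤ gain G D w' →
    (leafCount G rule m D X : ℝ) ≤ 0.9569 * potential G D X B
  unique : ∀ w ∈ frontier G D X, w ∉ B → 2 ≤ gain G D w →
    (∀ x ∈ frontier G D X, x ≠ w → gain G D x ≤ 1) →
    (∀ u ∈ undominatedNbrs G D w, IsBlocked G D (insert w X) u) →
    (leafCount G rule m D X : ℝ) ≤ (frontierWeight (gain G D w))⁻¹ *
      (insertCoeff G D B w + excludeCoeff G D B w) * potential G D X B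

variable (G) in
/-- The bounds `LeafBounds` hold for all marked states at depth `m`. -/
def LeafBoundsAtDepth (rule : Finset V → Finset V → V) (m : ℕ) : Prop :=
  ∀ D X B, IsMarkedState G D X B → LeafBounds G rule m D X B

theorem LeafBounds.of_leafCount_eq_zero (h : leafCount G rule m D X = 0) :
    LeafBounds G rule m D X B := by
  have hpot := potential_nonneg (G := G) D X B
  constructor
  · simpa [h] using hpot
  · intros
    rw [h, Nat.cast_zero]
    positivity
  · intros
    rw [h, Nat.cast_zero]
    positivity
  · intro w _ _ _ _ _
    rw [h, Nat.cast_zero]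
    exact mul_nonneg (mul_nonneg (inv_frontierWeight_nonneg _)
      (add_nonneg (insertCoeff_nonneg D B w) (excludeCoeff_nonneg D B w))) hpot

theorem leafCount_eq_zero_of_isDead (h : IsDead G D X) : leafCount G rule m D X = 0 := by
  cases m with
  | zero => rfl
  | succ m => rw [leafCount, if_pos h]

theorem leafCount_succ_le {a b c : ℝ} (hF : (frontier G D X).Nonempty)
    (hleft : ¬ HasRedundantVertex G (insert (rule D X) D) →
      (leafCount G rule m (insert (rule D X) D) X : ℝ) ≤ a)
    (hright : (leafCount G rule m D (insert (rule D X) X) : ℝ) ≤ b)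
    (ha : 0 ≤ a) (hab : a + b ≤ c) (hc : 1 ≤ c) :
    (leafCount G rule (m + 1) D X : ℝ) ≤ c := by
  rw [leafCount]
  split_ifs with hdead hF' hred
  · simpa using zero_le_one.trans hc
  · exact absurd hF' hF.ne_empty
  · push_cast
    exact max_le hc (by linarith)
  · push_cast
    exact max_le hc (by linarith [hleft hred])

theorem leafCount_succ_le_of_hasRedundantVertex {c : ℝ} (hv : rule D X ∈ frontier G D X)
    (hred : HasRedundantVertex G (insert (rule D X) D)) (hc : 0 ≤ c)
    (h : (leafCount G rule m D (insert (rule D X) X) : ℝ) ≤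
      c * potential G D (insert (rule D X) X) B)
    (hone : 1 ≤ c * potential G D X B) :
    (leafCount G rule (m + 1) D X : ℝ) ≤ c * potential G D X B :=
  leafCount_succ_le ⟨_, hv⟩ (fun h => absurd hred h)
    (h.trans (mul_le_mul_of_nonneg_left potential_insert_right_le_self hc)) le_rfl
    (zero_add _).le hone

namespace LeafBoundsAtDepth

theorem insert_left (h : LeafBoundsAtDepth G rule m) (hs : IsMarkedState G D X B)
    (hv : v ∈ frontier G D X) : LeafBounds G rule m (insert v D) X B :=
  h _ _ _ (hs.insert_left hv)

theorem insert_right (h : LeafBoundsAtDepth G rule m) (hs : IsMarkedState G D X B)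
    (hv : v ∈ frontier G D X) : LeafBounds G rule m D (insert v X) B :=
  h _ _ _ (hs.insert_right hv)

theorem leafCount_insert_left_le (h : LeafBoundsAtDepth G rule m) (hs : IsMarkedState G D X B)
    (hv : v ∈ frontier G D X) (hvB : v ∉ B) :
    (leafCount G rule m (insert v D) X : ℝ) ≤
      (frontierWeight (gain G D v))⁻¹ * insertCoeff G D B v * potential G D X B :=
  (h.insert_left hs hv).basic.trans (hs.potential_insert_left_le hv hvB)

theorem leafCount_insert_left_le_of_three_le_gain (h : LeafBoundsAtDepth G rule m)
    (hs : IsMarkedState G D X B) (hv : v ∈ frontier G D X) (hvB : v ∉ B)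
    (h3 : 3 ≤ gain G D v) :
    (leafCount G rule m (insert v D) X : ℝ) ≤
      1.8277⁻¹ * 0.9192 ^ 3 * potential G D X B := by
  have hle := h.leafCount_insert_left_le hs hv hvB
  rw [frontierWeight_of_three_le h3] at hle
  have hpot := potential_nonneg (G := G) D X B
  have hcoeff := insertCoeff_le_pow (B := B) h3
  exact hle.trans (by gcongr)

theorem leafCount_rule_large_le (h : LeafBoundsAtDepth G rule m) (hs : IsMarkedState G D X B)
    (hv : rule D X ∈ frontier G D X) (hvB : rule D X ∉ B) (h3 : 3 ≤ gain G D (rule D X)) :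
    (leafCount G rule (m + 1) D X : ℝ) ≤ 0.9721 * potential G D X B := by
  have hpot := le_potential_of_three_le_gain hv hvB h3
  have hright := potential_insert_right_le hv hvB
  rw [frontierWeight_of_three_le h3] at hright
  refine leafCount_succ_le ⟨_, hv⟩
    (fun _ => h.leafCount_insert_left_le_of_three_le_gain hs hv hvB h3)
    ((h.insert_right hs hv).basic.trans hright) (by positivity) ?_ (by linarith)
  rw [← add_mul]
  exact mul_le_mul_of_nonneg_right (by norm_num) (by linarith)

theorem leafCount_rule_large_pair_le (h : LeafBoundsAtDepth G rule m)
    (hs : IsMarkedState G D X B) (hv : rule D X ∈ frontier G D X) (hvB : rule D X ∉ B)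
    (h3 : 3 ≤ gain G D (rule D X)) (hw : w ∈ frontier G D X) (hwv : w ≠ rule D X)
    (hwB : w ∉ B) (hw3 : 3 ≤ gain G D w) :
    (leafCount G rule (m + 1) D X : ℝ) ≤ 0.9569 * potential G D X B := by
  have hpot := le_potential_of_three_le_gain hv hvB h3
  have hright := potential_insert_right_le hv hvB
  rw [frontierWeight_of_three_le h3] at hright
  refine leafCount_succ_le ⟨_, hv⟩
    (fun _ => h.leafCount_insert_left_le_of_three_le_gain hs hv hvB h3)
    (((h.insert_right hs hv).large w (mem_frontier_insert_right.2 ⟨hw, hwv⟩) hwB hw3).trans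
      (mul_le_mul_of_nonneg_left hright (by norm_num))) (by positivity) ?_ (by linarith)
  rw [← mul_assoc, ← add_mul]
  exact mul_le_mul_of_nonneg_right (by norm_num) (by linarith)

theorem leafCount_insert_right_le_of_isBlocked (h : LeafBoundsAtDepth G rule m)
    (hs : IsMarkedState G D X B) (hv : v ∈ frontier G D X) (hvB : v ∉ B)
    (hblocked : ∀ u ∈ undominatedNbrs G D v, IsBlocked G D (insert v X) u) :
    (leafCount G rule m D (insert v X) : ℝ) ≤
      (frontierWeight (gain G D v))⁻¹ * excludeCoeff G D B v * potential G D X B := by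
  by_cases hdead : IsDead G D (insert v X)
  · rw [leafCount_eq_zero_of_isDead hdead, Nat.cast_zero]
    exact mul_nonneg (mul_nonneg (inv_frontierWeight_nonneg _) (excludeCoeff_nonneg D B v))
      (potential_nonneg D X B)
  have hs' : IsMarkedState G D (insert v X) (B ∪ undominatedNbrs G D v) :=
    ⟨hs.toIsSearchState.insert_right hv, fun u hu => (Finset.mem_union.1 hu).elim
      ((hs.insert_right hv).isBlocked u) (hblocked u)⟩
  exact (h _ _ _ hs').basic.trans (hs.potential_insert_right_union_le hv hvB hdead)

end LeafBoundsAtDepth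

theorem IsSearchState.one_le_mul_potential (hDX : IsSearchState G D X)
    (hw : w ∈ frontier G D X) (hwB : w ∉ B) :
    1 ≤ (frontierWeight (gain G D w))⁻¹ * (insertCoeff G D B w + excludeCoeff G D B w) *
      potential G D X B := by
  refine ((one_le_potential (insert w D) X B).trans (hDX.potential_insert_left_le hw hwB)).trans ?_
  have hweight := inv_frontierWeight_nonneg (gain G D w)
  have hpot := potential_nonneg (G := G) D X B
  gcongr
  exact le_add_of_nonneg_right (excludeCoeff_nonneg D B w)

namespace LeafBoundsAtDepth

theorem leafCount_rule_unique_le (h : LeafBoundsAtDepth G rule m)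
    (hs : IsMarkedState G D X B) (hv : rule D X ∈ frontier G D X) (hvB : rule D X ∉ B)
    (hblocked : ∀ u ∈ undominatedNbrs G D (rule D X),
      IsBlocked G D (insert (rule D X) X) u) :
    (leafCount G rule (m + 1) D X : ℝ) ≤ (frontierWeight (gain G D (rule D X)))⁻¹ *
      (insertCoeff G D B (rule D X) + excludeCoeff G D B (rule D X)) * potential G D X B :=
  leafCount_succ_le ⟨_, hv⟩ (fun _ => h.leafCount_insert_left_le hs hv hvB)
    (h.leafCount_insert_right_le_of_isBlocked hs hv hvB hblocked)
    (mul_nonneg (mul_nonneg (inv_frontierWeight_nonneg _) (insertCoeff_nonneg _ _ _))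
      (potential_nonneg _ _ _))
    (by rw [mul_add, add_mul]) (hs.one_le_mul_potential hv hvB)

theorem leafCount_large_le_of_hasRedundantVertex (h : LeafBoundsAtDepth G rule m)
    (hs : IsMarkedState G D X B) (hv : rule D X ∈ frontier G D X)
    (hred : HasRedundantVertex G (insert (rule D X) D)) (hw : w ∈ frontier G D X)
    (hwB : w ∉ B) (hw3 : 3 ≤ gain G D w) :
    (leafCount G rule (m + 1) D X : ℝ) ≤ 0.9721 * potential G D X B := by
  by_cases hwv : w = rule D X
  · subst hwv
    exact h.leafCount_rule_large_le hs hv hwB hw3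
  · exact leafCount_succ_le_of_hasRedundantVertex hv hred (by norm_num)
      ((h.insert_right hs hv).large w (mem_frontier_insert_right.2 ⟨hw, hwv⟩) hwB hw3)
      (by linarith [le_potential_of_three_le_gain hw hwB hw3])

theorem leafCount_large_pair_le_of_hasRedundantVertex (h : LeafBoundsAtDepth G rule m)
    (hs : IsMarkedState G D X B) (hv : rule D X ∈ frontier G D X)
    (hred : HasRedundantVertex G (insert (rule D X) D)) {w' : V} (hw : w ∈ frontier G D X)
    (hw' : w' ∈ frontier G D X) (hne : w ≠ w') (hwB : w ∉ B) (hwB' : w' ∉ B)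
    (hw3 : 3 ≤ gain G D w) (hw3' : 3 ≤ gain G D w') :
    (leafCount G rule (m + 1) D X : ℝ) ≤ 0.9569 * potential G D X B := by
  by_cases hwv : w = rule D X
  · subst hwv
    exact h.leafCount_rule_large_pair_le hs hv hwB hw3 hw' hne.symm hwB' hw3'
  by_cases hwv' : w' = rule D X
  · subst hwv'
    exact h.leafCount_rule_large_pair_le hs hv hwB' hw3' hw hne hwB hw3
  · exact leafCount_succ_le_of_hasRedundantVertex hv hred (by norm_num)
      ((h.insert_right hs hv).large_pair w (mem_frontier_insert_right.2 ⟨hw, hwv⟩) w'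
        (mem_frontier_insert_right.2 ⟨hw', hwv'⟩) hne hwB hwB' hw3 hw3')
      (by linarith [le_potential_of_three_le_gain hw hwB hw3])

theorem leafCount_unique_le_of_hasRedundantVertex (h : LeafBoundsAtDepth G rule m)
    (hs : IsMarkedState G D X B) (hv : rule D X ∈ frontier G D X)
    (hred : HasRedundantVertex G (insert (rule D X) D)) (hw : w ∈ frontier G D X)
    (hwB : w ∉ B) (hw2 : 2 ≤ gain G D w)
    (huniq : ∀ x ∈ frontier G D X, x ≠ w → gain G D x ≤ 1)
    (hblocked : ∀ u ∈ undominatedNbrs G D w, IsBlocked G D (insert w X) u) :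
    (leafCount G rule (m + 1) D X : ℝ) ≤ (frontierWeight (gain G D w))⁻¹ *
      (insertCoeff G D B w + excludeCoeff G D B w) * potential G D X B := by
  by_cases hwv : w = rule D X
  · subst hwv
    exact h.leafCount_rule_unique_le hs hv hwB hblocked
  refine leafCount_succ_le_of_hasRedundantVertex hv hred ?_
    ((h.insert_right hs hv).unique w (mem_frontier_insert_right.2 ⟨hw, hwv⟩) hwB hw2
      (fun x hx => huniq x (mem_frontier_insert_right.1 hx).1) fun u hu =>
        (hblocked u hu).mono_right
          (Finset.insert_subset_insert _ (Finset.subset_insert _ _)))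
    (hs.one_le_mul_potential hw hwB)
  exact mul_nonneg (inv_frontierWeight_nonneg _)
    (add_nonneg (insertCoeff_nonneg D B w) (excludeCoeff_nonneg D B w))

theorem leafBounds_succ_of_hasRedundantVertex (h : LeafBoundsAtDepth G rule m)
    (hs : IsMarkedState G D X B) (hv : rule D X ∈ frontier G D X)
    (hred : HasRedundantVertex G (insert (rule D X) D)) :
    LeafBounds G rule (m + 1) D X B where
  basic := by
    simpa using leafCount_succ_le_of_hasRedundantVertex hv hred zero_le_one
      (by simpa using (h.insert_right hs hv).basic) (by simpa using one_le_potential D X B)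
  large _ hw hwB hw3 := h.leafCount_large_le_of_hasRedundantVertex hs hv hred hw hwB hw3
  large_pair _ hw _ hw' hne hwB hwB' hw3 hw3' :=
    h.leafCount_large_pair_le_of_hasRedundantVertex hs hv hred hw hw' hne hwB hwB' hw3 hw3'
  unique _ hw hwB hw2 huniq hblocked :=
    h.leafCount_unique_le_of_hasRedundantVertex hs hv hred hw hwB hw2 huniq hblocked

end LeafBoundsAtDepth

end LeafBounds

section LeafBounds

variable {V : Type*} [Fintype V] [DecidableEq V] {G : SimpleGraph V}
  {D X B : Finset V} {u v w w' x : V}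

theorem mem_frontier_insert_left_of_ne (hx : x ∈ frontier G D X) (hxv : x ≠ v) :
    x ∈ frontier G (insert v D) X := by
  obtain ⟨hdom, hxD, hxX⟩ := mem_frontier.1 hx
  exact mem_frontier.2 ⟨closedNbhd_mono (Finset.subset_insert _ _) hdom, by simp [hxv, hxD], hxX⟩

theorem weight_insert_left_le_of_gain_eq_one (hv : v ∈ frontier G D X)
    (hx : x ∈ frontier G D X) (hxv : x ≠ v) (hxB : x ∉ B) (hw : w ∈ undominatedNbrs G D v)
    (hxw : G.Adj x w) (hgain : gain G D x = 1) :
    weight G (insert v D) X B x ≤ 1.7275⁻¹ * weight G D X B x := by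
  have hlt := gain_insert_lt (mem_frontier.1 hv).1 hw hxw
  rw [weight_of_mem_frontier (mem_frontier_insert_left_of_ne hx hxv) hxB,
    weight_of_mem_frontier hx hxB, hgain, show gain G (insert v D) x = 0 by omega]
  norm_num [frontierWeight]

theorem weight_insert_left_le_of_gain_le_two (hv : v ∈ frontier G D X)
    (hx : x ∈ frontier G D X) (hxv : x ≠ v) (hxB : x ∉ B) (hw : w ∈ undominatedNbrs G D v)
    (hxw : G.Adj x w) (hgain : gain G D x ≤ 2) :
    weight G (insert v D) X B x ≤ 0.9547 * weight G D X B x := by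
  have hlt := gain_insert_lt (mem_frontier.1 hv).1 hw hxw
  rw [weight_of_mem_frontier (mem_frontier_insert_left_of_ne hx hxv) hxB,
    weight_of_mem_frontier hx hxB]
  have hcases : gain G D x = 1 ∨ gain G D x = 2 := by omega
  rcases hcases with hx | hx <;> rw [hx] at hlt ⊢
  · rw [show gain G (insert v D) x = 0 by omega]
    norm_num [frontierWeight]
  · refine (frontierWeight_mono (show gain G (insert v D) x ≤ 1 by omega)).trans ?_
    norm_num [frontierWeight]

theorem IsSearchState.weight_insert_right_of_mem_undominatedNbrs (hDX : IsSearchState G D X)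
    (hv : v ∈ frontier G D X) (hw : w ∈ undominatedNbrs G D v) (hwB : w ∉ B) :
    weight G D (insert v X) B w = undominatedWeight (freeDegree G X w - 1) := by
  obtain ⟨hw, hvw⟩ := mem_undominatedNbrs.1 hw
  rw [(hDX.insert_right hv).weight_of_mem_undominated hw hwB,
    ← freeDegree_insert_add_one (mem_frontier.1 hv).2.2 hvw.symm, Nat.add_sub_cancel]

theorem gain_insert_of_disjoint (hv : v ∈ closedNbhd G D)
    (h : Disjoint (undominatedNbrs G D w) (undominatedNbrs G D v)) :
    gain G (insert v D) w = gain G D w := by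
  rw [gain, undominatedNbrs_insert hv, Finset.sdiff_eq_self_of_disjoint h, gain]

theorem gain_insert_of_not_adj (hv : v ∈ closedNbhd G D)
    (hN : undominatedNbrs G D v = {w, w'}) (hadj : ¬ G.Adj w w') :
    gain G (insert v D) w = gain G D w := by
  refine gain_insert_of_disjoint hv ?_
  simp [hN, mem_undominatedNbrs, hadj]

theorem gain_insert_add_one_of_adj (hv : v ∈ closedNbhd G D)
    (hN : undominatedNbrs G D v = {w, w'}) (hadj : G.Adj w w') :
    gain G (insert v D) w + 1 = gain G D w := by
  have hw' : w' ∈ undominated G D :=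
    (mem_undominatedNbrs.1 (hN ▸ Finset.mem_insert_of_mem (Finset.mem_singleton_self w'))).1
  have hsdiff : undominatedNbrs G D w \ {w, w'} = (undominatedNbrs G D w).erase w' := by
    rw [Finset.sdiff_insert, Finset.sdiff_singleton_eq_erase,
      Finset.erase_eq_of_notMem (by simp [mem_undominatedNbrs])]
  rw [gain, undominatedNbrs_insert hv, hN, hsdiff,
    Finset.card_erase_add_one (mem_undominatedNbrs.2 ⟨hw', hadj⟩), gain]

variable {rule : Finset V → Finset V → V} {m : ℕ}

/-- The combination of the bounds for the two children of a state, in which `a` and `b` are the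
factors due to the vertices other than the branching vertex. -/
theorem leafCount_succ_le_potential {a b : ℝ} (hF : (frontier G D X).Nonempty)
    (hleft : (leafCount G rule m (insert (rule D X) D) X : ℝ) ≤
      (frontierWeight (gain G D (rule D X)))⁻¹ * a * potential G D X B)
    (hright : (leafCount G rule m D (insert (rule D X) X) : ℝ) ≤
      (frontierWeight (gain G D (rule D X)))⁻¹ * b * potential G D X B)
    (ha : 0 ≤ a) (hab : a + b ≤ frontierWeight (gain G D (rule D X))) :
    (leafCount G rule (m + 1) D X : ℝ) ≤ potential G D X B := by
  have hpot := potential_nonneg (G := G) D X B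
  have hweight := one_le_frontierWeight (gain G D (rule D X))
  refine leafCount_succ_le hF (fun _ => hleft) hright (by positivity) ?_ (one_le_potential D X B)
  rw [← add_mul, ← mul_add]
  refine mul_le_of_le_one_left hpot ?_
  rwa [inv_mul_le_iff₀ (by positivity), mul_one]

namespace LeafBoundsAtDepth

theorem leafCount_insert_right_le (h : LeafBoundsAtDepth G rule m) (hs : IsMarkedState G D X B)
    (hv : v ∈ frontier G D X) (hvB : v ∉ B) :
    (leafCount G rule m D (insert v X) : ℝ) ≤
      (frontierWeight (gain G D v))⁻¹ * 1 * potential G D X B := by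
  rw [mul_one]
  exact (h.insert_right hs hv).basic.trans (potential_insert_right_le hv hvB)

theorem leafCount_insert_right_le_mul (h : LeafBoundsAtDepth G rule m)
    (hs : IsMarkedState G D X B) (hv : v ∈ frontier G D X) (hvB : v ∉ B)
    (hw : w ∈ undominatedNbrs G D v) (hwB : w ∉ B) {c : ℝ} (hc : 0 ≤ c)
    (hweight : freeDegree G X w ≠ 1 →
      undominatedWeight (freeDegree G X w - 1) ≤ c * undominatedWeight (freeDegree G X w)) :
    (leafCount G rule m D (insert v X) : ℝ) ≤
      (frontierWeight (gain G D v))⁻¹ * c * potential G D X B := by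
  obtain ⟨hwU, hvw⟩ := mem_undominatedNbrs.1 hw
  by_cases hdeg : freeDegree G X w = 1
  · have hdeg' := freeDegree_insert_add_one (mem_frontier.1 hv).2.2 hvw.symm
    rw [leafCount_eq_zero_of_isDead (isDead_of_freeDegree_eq_zero hwU (by omega)), Nat.cast_zero]
    exact mul_nonneg (mul_nonneg (inv_frontierWeight_nonneg _) hc) (potential_nonneg _ _ _)
  · refine (h.insert_right hs hv).basic.trans ?_
    simpa using potential_insert_right_le_list_prod hv hvB subset_rfl [(w, c)]
      (by simp [hvw.ne]) (by
        simpa [hs.weight_insert_right_of_mem_undominatedNbrs hv hw hwB,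
          hs.weight_of_mem_undominated hwU hwB] using hweight hdeg)

/-! ### Branching on a vertex of gain one -/

theorem leafCount_le_of_exists_adj_of_gain_eq_one (h : LeafBoundsAtDepth G rule m)
    (hs : IsMarkedState G D X B) (hv : rule D X ∈ frontier G D X) (hvB : rule D X ∉ B)
    (hgain : gain G D (rule D X) = 1) (hw : w ∈ undominatedNbrs G D (rule D X))
    (hx : x ∈ frontier G D X) (hxv : x ≠ rule D X) (hxB : x ∉ B) (hxw : G.Adj x w)
    (hxgain : gain G D x = 1) :
    (leafCount G rule (m + 1) D X : ℝ) ≤ potential G D X B := by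
  have hvw := (mem_undominatedNbrs.1 hw).2
  have hleft := hs.potential_insert_left_le_list_prod hv hvB [(w, 0.9192), (x, 1.7275⁻¹)]
    (by simp [hvw.ne, hxv.symm, hxw.ne']) (by
      simpa using ⟨hs.weight_insert_left_le_mul hv hw,
        weight_insert_left_le_of_gain_eq_one hv hx hxv hxB hw hxw hxgain⟩)
  refine leafCount_succ_le_potential ⟨_, hv⟩ ((h.insert_left hs hv).basic.trans hleft)
    (h.leafCount_insert_right_le hs hv hvB) (by norm_num) ?_
  rw [hgain]
  norm_num [frontierWeight]

theorem leafCount_le_of_mem_of_gain_eq_one (h : LeafBoundsAtDepth G rule m)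
    (hs : IsMarkedState G D X B) (hv : rule D X ∈ frontier G D X) (hvB : rule D X ∉ B)
    (hgain : gain G D (rule D X) = 1) (hw : w ∈ undominatedNbrs G D (rule D X)) (hwB : w ∈ B) :
    (leafCount G rule (m + 1) D X : ℝ) ≤ potential G D X B := by
  have hvw := (mem_undominatedNbrs.1 hw).2
  have hleft := hs.potential_insert_left_le_list_prod hv hvB [(w, 0.6712)]
    (by simp [hvw.ne]) (by simpa using hs.weight_insert_left_le_mul_of_mem hw hwB)
  refine leafCount_succ_le_potential ⟨_, hv⟩ ((h.insert_left hs hv).basic.trans hleft)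
    (h.leafCount_insert_right_le hs hv hvB) (by norm_num) ?_
  rw [hgain]
  norm_num [frontierWeight]

theorem leafCount_le_of_gain_le_one (h : LeafBoundsAtDepth G rule m)
    (hs : IsMarkedState G D X B) (hv : rule D X ∈ frontier G D X) (hvB : rule D X ∉ B)
    (hgain : gain G D (rule D X) = 1) (hw : w ∈ undominatedNbrs G D (rule D X)) (hwB : w ∉ B)
    (hpriv : ∀ x ∈ frontier G D X, G.Adj x w → x = rule D X) (hwgain : gain G D w ≤ 1) :
    (leafCount G rule (m + 1) D X : ℝ) ≤ potential G D X B := by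
  have hvw := (mem_undominatedNbrs.1 hw).2
  have hdeg := hs.freeDegree_eq_gain_add_one hv hw hpriv
  have hleft := hs.potential_insert_left_le_list_prod hv hvB [(w, 0.9192)]
    (by simp [hvw.ne]) (by simpa using hs.weight_insert_left_le_mul hv hw)
  have hright := h.leafCount_insert_right_le_mul hs hv hvB hw hwB (c := 0.7929) (by norm_num)
    fun hne => by
      rw [show freeDegree G X w = 2 by omega]
      norm_num [undominatedWeight]
  refine leafCount_succ_le_potential ⟨_, hv⟩ ((h.insert_left hs hv).basic.trans hleft)
    hright (by norm_num) ?_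
  rw [hgain]
  norm_num [frontierWeight]

theorem pow_mul_pow_add_pow_le_of_three_le {s t : ℕ} (hst : 3 ≤ s + t) :
    (0.9192 : ℝ) ^ s * 0.6712 ^ t + 0.7929 ^ s ≤ 1.44 := by
  have anti {c : ℝ} (hc : 0 ≤ c) (hc' : c ≤ 1) {i j : ℕ} (hij : i ≤ j) : c ^ j ≤ c ^ i :=
    pow_le_pow_of_le_one hc hc' hij
  have reduce (i j : ℕ) (hi : i ≤ s) (hj : j ≤ t)
      (hij : (0.9192 : ℝ) ^ i * 0.6712 ^ j + 0.7929 ^ i ≤ 1.44) :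
      (0.9192 : ℝ) ^ s * 0.6712 ^ t + 0.7929 ^ s ≤ 1.44 := by
    refine le_trans (add_le_add (mul_le_mul (anti ?_ ?_ hi) (anti ?_ ?_ hj) ?_ ?_)
      (anti ?_ ?_ hi)) hij <;> first | positivity | norm_num
  have hcases : s = 0 ∨ s = 1 ∨ s = 2 ∨ 3 ≤ s := by omega
  rcases hcases with hs | hs | hs | hs
  · exact reduce 0 3 (by omega) (by omega) (by norm_num)
  · exact reduce 1 2 (by omega) (by omega) (by norm_num)
  · exact reduce 2 1 (by omega) (by omega) (by norm_num)
  · exact reduce 3 0 (by omega) (by omega) (by norm_num)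

theorem undominatedWeight_add_le {q s t : ℕ} (hq : 2 ≤ q) (hst : s + t = q) :
    undominatedWeight q + ((0.9192 : ℝ) ^ s * 0.6712 ^ t + 0.7929 ^ s) ≤
      1.7275 * undominatedWeight (q + 1) := by
  rcases hq.eq_or_lt with rfl | hq
  · have hcases : s = 0 ∧ t = 2 ∨ s = 1 ∧ t = 1 ∨ s = 2 ∧ t = 0 := by omega
    rcases hcases with ⟨rfl, rfl⟩ | ⟨rfl, rfl⟩ | ⟨rfl, rfl⟩ <;> norm_num [undominatedWeight]
  · rw [undominatedWeight_of_four_le (show 4 ≤ q + 1 by omega)]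
    linarith [undominatedWeight_le q, pow_mul_pow_add_pow_le_of_three_le (hst ▸ hq)]

theorem undominatedWeight_gain_add_le (B : Finset V) (hw : 2 ≤ gain G D w) :
    undominatedWeight (gain G D w) + (insertCoeff G D B w + excludeCoeff G D B w) ≤
      1.7275 * undominatedWeight (gain G D w + 1) :=
  undominatedWeight_add_le hw (Finset.card_sdiff_add_card_inter _ _)

theorem isBlocked_insert_of_undominatedNbrs_eq_singleton (hDX : IsSearchState G D X)
    (hv : v ∈ frontier G D X) (hN : undominatedNbrs G D v = {w}) (hwu : G.Adj w u) :
    IsBlocked G (insert v D) (insert w X) u := by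
  obtain ⟨hdom, hvD, -⟩ := mem_frontier.1 hv
  have hnbr : ∀ z, G.Adj v z → z ∉ closedNbhd G D → z = w := fun z hvz hz =>
    Finset.mem_singleton.1 (hN ▸ mem_undominatedNbrs.2 ⟨mem_undominated.2 hz, hvz⟩)
  refine ⟨v, by simp, ?_⟩
  rw [Finset.erase_insert hvD]
  refine ⟨hDX.cutConnected, fun z hz => ?_, fun z hzX hvz => ?_⟩
  · by_cases hzdom : z ∈ closedNbhd G D
    · exact closedNbhd_mono (Finset.subset_insert _ _) hzdom
    rcases hz with rfl | hvz
    · exact absurd hdom hzdom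
    · rw [hnbr z hvz hzdom]
      exact mem_closedNbhd_of_adj (Finset.mem_insert_self _ _) hwu.symm
  · by_contra hzdom
    exact hzX (hnbr z hvz hzdom ▸ Finset.mem_insert_self _ _)

theorem mem_frontier_of_mem_frontier_insert_left (hN : undominatedNbrs G D v = {w})
    (hx : x ∈ frontier G (insert v D) X) (hxw : x ≠ w) : x ∈ frontier G D X := by
  obtain ⟨hdom, hxD, hxX⟩ := mem_frontier.1 hx
  rw [Finset.mem_insert, not_or] at hxD
  refine mem_frontier.2 ⟨?_, hxD.2, hxX⟩
  rcases mem_closedNbhd_insert.1 hdom with hdom | hxv | hvx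
  · exact hdom
  · exact absurd hxv hxD.1
  · by_contra hdom
    exact hxw (Finset.mem_singleton.1
      (hN ▸ mem_undominatedNbrs.2 ⟨mem_undominated.2 hdom, hvx⟩))

theorem leafCount_insert_left_le_of_two_le_gain (h : LeafBoundsAtDepth G rule m)
    (hs : IsMarkedState G D X B) (hv : v ∈ frontier G D X) (hvB : v ∉ B)
    (hN : undominatedNbrs G D v = {w}) (hwB : w ∉ B)
    (hpriv : ∀ x ∈ frontier G D X, G.Adj x w → x = v)
    (hgain : ∀ x ∈ frontier G D X, gain G D x ≤ 1) (hw2 : 2 ≤ gain G D w) :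
    (leafCount G rule m (insert v D) X : ℝ) ≤ (frontierWeight (gain G D v))⁻¹ *
      ((insertCoeff G (insert v D) B w + excludeCoeff G (insert v D) B w) /
        undominatedWeight (gain G D w + 1)) * potential G D X B := by
  have hvdom := (mem_frontier.1 hv).1
  have hw : w ∈ undominatedNbrs G D v := by simp [hN]
  obtain ⟨hwU, hvw⟩ := mem_undominatedNbrs.1 hw
  have hwF := hs.mem_frontier_insert_left hw
  have hwgain : gain G (insert v D) w = gain G D w :=
    gain_insert_of_not_adj (w' := w) hvdom (by simp [hN]) (SimpleGraph.irrefl G)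
  have hunique := (h.insert_left hs hv).unique w hwF hwB (hwgain ▸ hw2)
    (fun x hx hxw => (gain_insert_le hvdom).trans
      (hgain x (mem_frontier_of_mem_frontier_insert_left hN hx hxw)))
    (fun u hu => isBlocked_insert_of_undominatedNbrs_eq_singleton hs.toIsSearchState hv hN
      (mem_undominatedNbrs.1 hu).2)
  have hpot := hs.potential_insert_left_le_list_prod hv hvB
    [(w, frontierWeight (gain G D w) / undominatedWeight (gain G D w + 1))]
    (by simp [hvw.ne]) (by
      simp [weight_of_mem_frontier hwF hwB, hs.weight_of_mem_undominated hwU hwB, hwgain,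
        hs.freeDegree_eq_gain_add_one hv hw hpriv, (undominatedWeight_pos _).ne'])
  rw [hwgain] at hunique
  have hweight := one_le_frontierWeight (gain G D w)
  have hcoeff : 0 ≤ insertCoeff G (insert v D) B w + excludeCoeff G (insert v D) B w :=
    add_nonneg (insertCoeff_nonneg _ _ _) (excludeCoeff_nonneg _ _ _)
  refine (hunique.trans (mul_le_mul_of_nonneg_left hpot
    (mul_nonneg (inv_frontierWeight_nonneg _) hcoeff))).trans_eq ?_
  rw [List.map_singleton, List.prod_singleton]
  field_simp

theorem leafCount_le_of_two_le_gain (h : LeafBoundsAtDepth G rule m)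
    (hs : IsMarkedState G D X B) (hv : rule D X ∈ frontier G D X) (hvB : rule D X ∉ B)
    (hN : undominatedNbrs G D (rule D X) = {w}) (hwB : w ∉ B)
    (hpriv : ∀ x ∈ frontier G D X, G.Adj x w → x = rule D X)
    (hgain : ∀ x ∈ frontier G D X, gain G D x ≤ 1) (hw2 : 2 ≤ gain G D w) :
    (leafCount G rule (m + 1) D X : ℝ) ≤ potential G D X B := by
  have hw : w ∈ undominatedNbrs G D (rule D X) := by simp [hN]
  have hdeg := hs.freeDegree_eq_gain_add_one hv hw hpriv
  have hwgain : gain G (insert (rule D X) D) w = gain G D w :=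
    gain_insert_of_not_adj (w' := w) (mem_frontier.1 hv).1 (by simp [hN]) (SimpleGraph.irrefl G)
  have hvgain : gain G D (rule D X) = 1 := by simp [gain, hN]
  have hpos := undominatedWeight_pos (gain G D w + 1)
  have hright := h.leafCount_insert_right_le_mul hs hv hvB hw hwB
    (c := undominatedWeight (gain G D w) / undominatedWeight (gain G D w + 1))
    (div_nonneg (undominatedWeight_pos _).le hpos.le) fun _ => by
      rw [hdeg, Nat.add_sub_cancel, div_mul_cancel₀ _ hpos.ne']
  refine leafCount_succ_le_potential ⟨_, hv⟩
    (h.leafCount_insert_left_le_of_two_le_gain hs hv hvB hN hwB hpriv hgain hw2) hright ?_ ?_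
  · exact div_nonneg (add_nonneg (insertCoeff_nonneg _ _ _) (excludeCoeff_nonneg _ _ _)) hpos.le
  · rw [← add_div, div_le_iff₀ hpos, hvgain, add_comm]
    have hsum := undominatedWeight_gain_add_le (D := insert (rule D X) D) B (hwgain ▸ hw2)
    rwa [hwgain] at hsum

theorem leafCount_le_of_gain_eq_one (h : LeafBoundsAtDepth G rule m)
    (hs : IsMarkedState G D X B) (hv : rule D X ∈ frontier G D X)
    (hFB : Disjoint (frontier G D X) B) (hgain : ∀ x ∈ frontier G D X, gain G D x = 1) :
    (leafCount G rule (m + 1) D X : ℝ) ≤ potential G D X B := by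
  have hvB := Finset.disjoint_left.1 hFB hv
  have hvgain := hgain _ hv
  obtain ⟨w, hN⟩ := Finset.card_eq_one.1 hvgain
  have hw : w ∈ undominatedNbrs G D (rule D X) := by simp [hN]
  by_cases hpriv : ∀ x ∈ frontier G D X, G.Adj x w → x = rule D X
  · by_cases hwB : w ∈ B
    · exact h.leafCount_le_of_mem_of_gain_eq_one hs hv hvB hvgain hw hwB
    rcases Nat.lt_or_ge (gain G D w) 2 with hw2 | hw2
    · exact h.leafCount_le_of_gain_le_one hs hv hvB hvgain hw hwB hpriv (Nat.le_of_lt_succ hw2)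
    · exact h.leafCount_le_of_two_le_gain hs hv hvB hN hwB hpriv
        (fun x hx => (hgain x hx).le) hw2
  · push Not at hpriv
    obtain ⟨x, hx, hxw, hxv⟩ := hpriv
    exact h.leafCount_le_of_exists_adj_of_gain_eq_one hs hv hvB hvgain hw hx hxv
      (Finset.disjoint_left.1 hFB hx) hxw (hgain x hx)

/-! ### Branching on a vertex of gain two -/

theorem gain_eq_two (hN : undominatedNbrs G D v = {w, w'}) (hne : w ≠ w') : gain G D v = 2 := by
  rw [gain, hN, Finset.card_pair hne]

theorem leafCount_succ_le_of_pair (hs : IsMarkedState G D X B) (hv : rule D X ∈ frontier G D X)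
    (hvB : rule D X ∉ B) (hN : undominatedNbrs G D (rule D X) = {w, w'}) (hne : w ≠ w')
    {a c c' b : ℝ} (hleft : (leafCount G rule m (insert (rule D X) D) X : ℝ) ≤
      a * potential G (insert (rule D X) D) X B)
    (hc : weight G (insert (rule D X) D) X B w ≤ c * weight G D X B w)
    (hc' : weight G (insert (rule D X) D) X B w' ≤ c' * weight G D X B w')
    (hright : (leafCount G rule m D (insert (rule D X) X) : ℝ) ≤
      (frontierWeight (gain G D (rule D X)))⁻¹ * b * potential G D X B)
    (ha0 : 0 ≤ a) (hc0 : 0 ≤ c) (hc0' : 0 ≤ c') (hsum : a * (c * c') + b ≤ 1.8095) :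
    (leafCount G rule (m + 1) D X : ℝ) ≤ potential G D X B := by
  have hw : w ∈ undominatedNbrs G D (rule D X) := by simp [hN]
  have hw' : w' ∈ undominatedNbrs G D (rule D X) := by simp [hN]
  have hpot := hs.potential_insert_left_le_list_prod hv hvB [(w, c), (w', c')]
    (by simp [(mem_undominatedNbrs.1 hw).2.ne, (mem_undominatedNbrs.1 hw').2.ne, hne])
    (by simpa using ⟨hc, hc'⟩)
  refine leafCount_succ_le_potential (a := a * (c * c')) ⟨_, hv⟩
    ((hleft.trans (mul_le_mul_of_nonneg_left hpot ha0)).trans_eq ?_) hright (by positivity) ?_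
  · simp only [List.map_cons, List.map_nil, List.prod_cons, List.prod_nil]
    ring
  · rwa [gain_eq_two hN hne]

theorem leafCount_le_of_exists_adj_of_gain_eq_two (h : LeafBoundsAtDepth G rule m)
    (hs : IsMarkedState G D X B) (hv : rule D X ∈ frontier G D X) (hvB : rule D X ∉ B)
    (hN : undominatedNbrs G D (rule D X) = {w, w'}) (hne : w ≠ w')
    (hx : x ∈ frontier G D X) (hxv : x ≠ rule D X) (hxB : x ∉ B)
    (hu : u ∈ undominatedNbrs G D (rule D X)) (hxu : G.Adj x u) (hxgain : gain G D x ≤ 2) :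
    (leafCount G rule (m + 1) D X : ℝ) ≤ potential G D X B := by
  have hw : w ∈ undominatedNbrs G D (rule D X) := by simp [hN]
  have hw' : w' ∈ undominatedNbrs G D (rule D X) := by simp [hN]
  have hnex {z : V} (hz : z ∈ undominatedNbrs G D (rule D X)) : z ≠ x :=
    fun hzx => notMem_undominatedNbrs_of_mem_frontier hx (hzx ▸ hz)
  have hleft := hs.potential_insert_left_le_list_prod hv hvB
    [(w, 0.9192), (w', 0.9192), (x, 0.9547)]
    (by simp [(mem_undominatedNbrs.1 hw).2.ne, (mem_undominatedNbrs.1 hw').2.ne, hxv.symm, hne,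
      hnex hw, hnex hw'])
    (by simpa using ⟨hs.weight_insert_left_le_mul hv hw, hs.weight_insert_left_le_mul hv hw',
      weight_insert_left_le_of_gain_le_two hv hx hxv hxB hu hxu hxgain⟩)
  refine leafCount_succ_le_potential ⟨_, hv⟩ ((h.insert_left hs hv).basic.trans hleft)
    (h.leafCount_insert_right_le hs hv hvB) (by norm_num) ?_
  rw [gain_eq_two hN hne]
  norm_num [frontierWeight]

theorem leafCount_le_of_mem_of_gain_eq_two (h : LeafBoundsAtDepth G rule m)
    (hs : IsMarkedState G D X B) (hv : rule D X ∈ frontier G D X) (hvB : rule D X ∉ B)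
    (hN : undominatedNbrs G D (rule D X) = {w, w'}) (hne : w ≠ w') (hwB : w ∈ B) :
    (leafCount G rule (m + 1) D X : ℝ) ≤ potential G D X B :=
  leafCount_succ_le_of_pair hs hv hvB hN hne
    ((h.insert_left hs hv).basic.trans_eq (one_mul _).symm)
    (hs.weight_insert_left_le_mul_of_mem (by simp [hN]) hwB)
    (hs.weight_insert_left_le_mul hv (by simp [hN])) (h.leafCount_insert_right_le hs hv hvB)
    (by norm_num) (by norm_num) (by norm_num) (by norm_num)

theorem leafCount_le_of_three_le_gain (h : LeafBoundsAtDepth G rule m)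
    (hs : IsMarkedState G D X B) (hv : rule D X ∈ frontier G D X) (hvB : rule D X ∉ B)
    (hN : undominatedNbrs G D (rule D X) = {w, w'}) (hne : w ≠ w') (hwB : w ∉ B) (hwB' : w' ∉ B)
    (hgain : 3 ≤ gain G (insert (rule D X) D) w) (hgain' : 3 ≤ gain G (insert (rule D X) D) w') :
    (leafCount G rule (m + 1) D X : ℝ) ≤ potential G D X B := by
  have hw : w ∈ undominatedNbrs G D (rule D X) := by simp [hN]
  have hw' : w' ∈ undominatedNbrs G D (rule D X) := by simp [hN]
  exact leafCount_succ_le_of_pair hs hv hvB hN hne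
    ((h.insert_left hs hv).large_pair w (hs.mem_frontier_insert_left hw) w'
      (hs.mem_frontier_insert_left hw') hne hwB hwB' hgain hgain')
    (hs.weight_insert_left_le_mul hv hw) (hs.weight_insert_left_le_mul hv hw')
    (h.leafCount_insert_right_le hs hv hvB) (by norm_num) (by norm_num) (by norm_num)
    (by norm_num)

theorem leafCount_le_of_not_adj (h : LeafBoundsAtDepth G rule m)
    (hs : IsMarkedState G D X B) (hv : rule D X ∈ frontier G D X) (hvB : rule D X ∉ B)
    (hN : undominatedNbrs G D (rule D X) = {w, w'}) (hne : w ≠ w') (hwB : w ∉ B)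
    (hpriv : ∀ x ∈ frontier G D X, G.Adj x w → x = rule D X) (hadj : ¬ G.Adj w w')
    (hgain : gain G (insert (rule D X) D) w ≤ 2) :
    (leafCount G rule (m + 1) D X : ℝ) ≤ potential G D X B := by
  have hw : w ∈ undominatedNbrs G D (rule D X) := by simp [hN]
  have hdeg := hs.freeDegree_eq_gain_add_one hv hw hpriv
  rw [gain_insert_of_not_adj (mem_frontier.1 hv).1 hN hadj] at hgain
  have hright := h.leafCount_insert_right_le_mul hs hv hvB hw hwB (c := 0.9547) (by norm_num)
    fun hne => by
      have hcases : freeDegree G X w = 2 ∨ freeDegree G X w = 3 := by omega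
      rcases hcases with hd | hd <;> rw [hd] <;> norm_num [undominatedWeight]
  exact leafCount_succ_le_of_pair hs hv hvB hN hne
    ((h.insert_left hs hv).basic.trans_eq (one_mul _).symm) (hs.weight_insert_left_le_mul hv hw)
    (hs.weight_insert_left_le_mul hv (by simp [hN])) hright (by norm_num) (by norm_num)
    (by norm_num) (by norm_num)

/-- An edge between the two vertices dominated by the branching vertex `v` disappears from the
gain of both when `v` is included, so their weights drop on either branch. -/
theorem weight_le_of_adj (hs : IsMarkedState G D X B) (hv : v ∈ frontier G D X)
    (hN : undominatedNbrs G D v = {w, w'}) (hwB : w ∉ B)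
    (hpriv : ∀ x ∈ frontier G D X, G.Adj x w → x = v) (hadj : G.Adj w w')
    (hgain : gain G (insert v D) w ≤ 2) :
    weight G (insert v D) X B w ≤ 0.9192 * 0.9901 * weight G D X B w ∧
      weight G D (insert v X) B w ≤ 0.9901 * weight G D X B w := by
  have hw : w ∈ undominatedNbrs G D v := by simp [hN]
  rw [weight_of_mem_frontier (hs.mem_frontier_insert_left hw) hwB,
    hs.weight_of_mem_undominated (mem_undominatedNbrs.1 hw).1 hwB,
    hs.weight_insert_right_of_mem_undominatedNbrs hv hw hwB,
    hs.freeDegree_eq_gain_add_one hv hw hpriv,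
    ← gain_insert_add_one_of_adj (mem_frontier.1 hv).1 hN hadj]
  interval_cases gain G (insert v D) w <;> norm_num [frontierWeight, undominatedWeight]

theorem leafCount_le_of_adj_of_three_le_gain (h : LeafBoundsAtDepth G rule m)
    (hs : IsMarkedState G D X B) (hv : rule D X ∈ frontier G D X) (hvB : rule D X ∉ B)
    (hN : undominatedNbrs G D (rule D X) = {w, w'}) (hne : w ≠ w') (hwB : w ∉ B) (hwB' : w' ∉ B)
    (hpriv : ∀ x ∈ frontier G D X, G.Adj x w → x = rule D X) (hadj : G.Adj w w')
    (hgain : gain G (insert (rule D X) D) w ≤ 2)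
    (hgain' : 3 ≤ gain G (insert (rule D X) D) w') :
    (leafCount G rule (m + 1) D X : ℝ) ≤ potential G D X B := by
  have hw : w ∈ undominatedNbrs G D (rule D X) := by simp [hN]
  have hw' : w' ∈ undominatedNbrs G D (rule D X) := by simp [hN]
  obtain ⟨hleft, hright⟩ := weight_le_of_adj hs hv hN hwB hpriv hadj hgain
  have hpot := potential_insert_right_le_list_prod hv hvB subset_rfl [(w, 0.9901)]
    (by simp [(mem_undominatedNbrs.1 hw).2.ne]) (by simpa using hright)
  exact leafCount_succ_le_of_pair hs hv hvB hN hne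
    ((h.insert_left hs hv).large w' (hs.mem_frontier_insert_left hw') hwB' hgain') hleft
    (hs.weight_insert_left_le_mul hv hw') ((h.insert_right hs hv).basic.trans hpot)
    (by norm_num) (by norm_num) (by norm_num) (by norm_num)

theorem leafCount_le_of_adj_of_gain_le_two (h : LeafBoundsAtDepth G rule m)
    (hs : IsMarkedState G D X B) (hv : rule D X ∈ frontier G D X) (hvB : rule D X ∉ B)
    (hN : undominatedNbrs G D (rule D X) = {w, w'}) (hne : w ≠ w') (hwB : w ∉ B) (hwB' : w' ∉ B)
    (hpriv : ∀ x ∈ frontier G D X, G.Adj x w → x = rule D X)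
    (hpriv' : ∀ x ∈ frontier G D X, G.Adj x w' → x = rule D X) (hadj : G.Adj w w')
    (hgain : gain G (insert (rule D X) D) w ≤ 2)
    (hgain' : gain G (insert (rule D X) D) w' ≤ 2) :
    (leafCount G rule (m + 1) D X : ℝ) ≤ potential G D X B := by
  have hw : w ∈ undominatedNbrs G D (rule D X) := by simp [hN]
  have hw' : w' ∈ undominatedNbrs G D (rule D X) := by simp [hN]
  obtain ⟨hleft, hright⟩ := weight_le_of_adj hs hv hN hwB hpriv hadj hgain
  obtain ⟨hleft', hright'⟩ :=
    weight_le_of_adj hs hv (hN.trans (Finset.pair_comm w w')) hwB' hpriv' hadj.symm hgain'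
  have hpot := potential_insert_right_le_list_prod hv hvB subset_rfl [(w, 0.9901), (w', 0.9901)]
    (by simp [(mem_undominatedNbrs.1 hw).2.ne, (mem_undominatedNbrs.1 hw').2.ne, hne])
    (by simpa using ⟨hright, hright'⟩)
  exact leafCount_succ_le_of_pair hs hv hvB hN hne
    ((h.insert_left hs hv).basic.trans_eq (one_mul _).symm) hleft hleft'
    ((h.insert_right hs hv).basic.trans hpot) (by norm_num) (by norm_num) (by norm_num)
    (by norm_num)

theorem leafCount_le_of_pair (h : LeafBoundsAtDepth G rule m)
    (hs : IsMarkedState G D X B) (hv : rule D X ∈ frontier G D X) (hvB : rule D X ∉ B)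
    (hN : undominatedNbrs G D (rule D X) = {w, w'}) (hne : w ≠ w') (hwB : w ∉ B) (hwB' : w' ∉ B)
    (hpriv : ∀ x ∈ frontier G D X, G.Adj x w → x = rule D X)
    (hpriv' : ∀ x ∈ frontier G D X, G.Adj x w' → x = rule D X) :
    (leafCount G rule (m + 1) D X : ℝ) ≤ potential G D X B := by
  have hN' := hN.trans (Finset.pair_comm w w')
  rcases Nat.lt_or_ge 2 (gain G (insert (rule D X) D) w) with hgain | hgain <;>
    rcases Nat.lt_or_ge 2 (gain G (insert (rule D X) D) w') with hgain' | hgain'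
  · exact h.leafCount_le_of_three_le_gain hs hv hvB hN hne hwB hwB' hgain hgain'
  all_goals by_cases hadj : G.Adj w w'
  · exact h.leafCount_le_of_adj_of_three_le_gain hs hv hvB hN' hne.symm hwB' hwB hpriv' hadj.symm
      hgain' hgain
  · exact h.leafCount_le_of_not_adj hs hv hvB hN' hne.symm hwB' hpriv'
      (fun hadj' => hadj hadj'.symm) hgain'
  · exact h.leafCount_le_of_adj_of_three_le_gain hs hv hvB hN hne hwB hwB' hpriv hadj hgain hgain'
  · exact h.leafCount_le_of_not_adj hs hv hvB hN hne hwB hpriv hadj hgain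
  · exact h.leafCount_le_of_adj_of_gain_le_two hs hv hvB hN hne hwB hwB' hpriv hpriv' hadj hgain
      hgain'
  · exact h.leafCount_le_of_not_adj hs hv hvB hN hne hwB hpriv hadj hgain

theorem leafCount_le_of_gain_eq_two (h : LeafBoundsAtDepth G rule m)
    (hs : IsMarkedState G D X B) (hv : rule D X ∈ frontier G D X)
    (hFB : Disjoint (frontier G D X) B) (hgain : ∀ x ∈ frontier G D X, gain G D x ≤ 2)
    (hvgain : gain G D (rule D X) = 2) :
    (leafCount G rule (m + 1) D X : ℝ) ≤ potential G D X B := by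
  have hvB := Finset.disjoint_left.1 hFB hv
  obtain ⟨w, w', hne, hN⟩ := Finset.card_eq_two.1 hvgain
  by_cases hpriv : ∀ u ∈ undominatedNbrs G D (rule D X), ∀ x ∈ frontier G D X,
      G.Adj x u → x = rule D X
  · by_cases hwB : w ∈ B
    · exact h.leafCount_le_of_mem_of_gain_eq_two hs hv hvB hN hne hwB
    by_cases hwB' : w' ∈ B
    · exact h.leafCount_le_of_mem_of_gain_eq_two hs hv hvB
        (hN.trans (Finset.pair_comm w w')) hne.symm hwB'
    exact h.leafCount_le_of_pair hs hv hvB hN hne hwB hwB' (hpriv w (by simp [hN]))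
      (hpriv w' (by simp [hN]))
  · push Not at hpriv
    obtain ⟨u, hu, x, hx, hxu, hxv⟩ := hpriv
    exact h.leafCount_le_of_exists_adj_of_gain_eq_two hs hv hvB hN hne hx hxv
      (Finset.disjoint_left.1 hFB hx) hu hxu (hgain x hx)

/-! ### The number of leaves of the search tree -/

theorem leafBounds_succ_of_not_hasRedundantVertex (h : LeafBoundsAtDepth G rule m)
    (hs : IsMarkedState G D X B) (hv : rule D X ∈ frontier G D X)
    (hnred : ∀ u ∈ frontier G D X, ¬ HasRedundantVertex G (insert u D))
    (hmax : ∀ u ∈ frontier G D X, gain G D u ≤ gain G D (rule D X)) :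
    LeafBounds G rule (m + 1) D X B := by
  have hFB : Disjoint (frontier G D X) B := Finset.disjoint_left.2 fun u hu huB =>
    hnred u hu ((hs.isBlocked u huB).hasRedundantVertex hu)
  have hpos : ∀ u ∈ frontier G D X, gain G D u ≠ 0 := fun u hu h0 =>
    hnred u hu (hs.hasRedundantVertex_of_gain_eq_zero hu h0)
  have hvB := Finset.disjoint_left.1 hFB hv
  have hlarge := h.leafCount_rule_large_le hs hv hvB
  refine ⟨?_, fun w hw _ hw3 => hlarge (hw3.trans (hmax w hw)),
    fun w hw w' hw' hne hwB hwB' hw3 hw3' => ?_, fun w hw hwB hw2 huniq hblocked => ?_⟩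
  · have hv0 := hpos _ hv
    have hcases : gain G D (rule D X) = 1 ∨ gain G D (rule D X) = 2 ∨
      3 ≤ gain G D (rule D X) := by omega
    rcases hcases with hv1 | hv2 | hv3
    · exact h.leafCount_le_of_gain_eq_one hs hv hFB fun u hu =>
        le_antisymm (hv1 ▸ hmax u hu) (Nat.pos_of_ne_zero (hpos u hu))
    · exact h.leafCount_le_of_gain_eq_two hs hv hFB (fun u hu => hv2 ▸ hmax u hu) hv2
    · linarith [hlarge hv3, potential_nonneg (G := G) D X B]
  · have hv3 := hw3.trans (hmax w hw)
    by_cases hwv : w = rule D X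
    · exact h.leafCount_rule_large_pair_le hs hv hvB hv3 hw' (hwv ▸ hne.symm) hwB' hw3'
    · exact h.leafCount_rule_large_pair_le hs hv hvB hv3 hw hwv hwB hw3
  · obtain rfl : rule D X = w := by
      by_contra hne
      have := huniq _ hv hne
      have := hmax w hw
      omega
    exact h.leafCount_rule_unique_le hs hv hwB hblocked

end LeafBoundsAtDepth

theorem leafBoundsAtDepth (hrule : IsBranchingRule G rule) (m : ℕ) :
    LeafBoundsAtDepth G rule m := by
  induction m with
  | zero => exact fun D X B _ => LeafBounds.of_leafCount_eq_zero rfl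
  | succ m h =>
    intro D X B hs
    by_cases hdead : IsDead G D X
    · exact LeafBounds.of_leafCount_eq_zero (leafCount_eq_zero_of_isDead hdead)
    by_cases hF : frontier G D X = ∅
    · refine ⟨?_, ?_, ?_, ?_⟩
      · rw [leafCount, if_neg hdead, if_pos hF, Nat.cast_one]
        exact one_le_potential D X B
      all_goals simp [hF]
    obtain ⟨hv, hred | ⟨hnred, hmax⟩⟩ := hrule D X (Finset.nonempty_iff_ne_empty.2 hF)
    · exact h.leafBounds_succ_of_hasRedundantVertex hs hv hred
    · exact h.leafBounds_succ_of_not_hasRedundantVertex hs hv hnred hmax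

theorem leafCount_singleton_le (hrule : IsBranchingRule G rule) (m : ℕ) (x : V) :
    (leafCount G rule m {x} ∅ : ℝ) ≤ 1.9884 ^ Fintype.card V :=
  (leafBoundsAtDepth hrule m {x} ∅ ∅ ⟨isSearchState_singleton x, by simp⟩).basic.trans
    (potential_le {x} ∅ ∅)

end LeafBounds

theorem ncard_isMinimalCDS_le {V : Type*} [Fintype V] (G : SimpleGraph V) :
    ({D : Finset V | IsMinimalCDS G D}.ncard : ℝ) ≤
      Fintype.card V * 1.9884 ^ Fintype.card V := by
  classical
  rcases isEmpty_or_nonempty V with hV | hV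
  · have hempty : {D : Finset V | IsMinimalCDS G D} = ∅ := Set.eq_empty_iff_forall_notMem.2
      fun D hD => hV.elim (isCDS_iff.1 hD.1).2.1.choose
    simp [hempty]
  obtain ⟨rule, hrule⟩ := exists_isBranchingRule (G := G)
  let m := Fintype.card V + 1
  let found : Finset (Finset V) :=
    Finset.univ.biUnion fun x => (enumerated G rule m {x} ∅).toFinset
  have hfound : {D : Finset V | IsMinimalCDS G D} ⊆ found := fun D hD => by
    obtain ⟨x, hx⟩ := (isCDS_iff.1 hD.1).2.1
    refine Finset.mem_coe.2 (Finset.mem_biUnion.2 ⟨x, Finset.mem_univ x, List.mem_toFinset.2 ?_⟩)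
    exact ((nodup_enumerated_and_mem_iff hrule m {x} ∅ (isSearchState_singleton x)
      (not_hasRedundantVertex_singleton x) (Nat.lt_succ_of_le (Finset.card_le_univ _))).2 D).2
        ⟨hD, Finset.singleton_subset_iff.2 hx, Finset.disjoint_empty_right D⟩
  have hcard : {D : Finset V | IsMinimalCDS G D}.ncard ≤ ∑ x, leafCount G rule m {x} ∅ :=
    calc {D : Finset V | IsMinimalCDS G D}.ncard
        ≤ found.card := (Set.ncard_le_ncard hfound).trans_eq (Set.ncard_coe_finset found)
      _ ≤ ∑ x, (enumerated G rule m {x} ∅).toFinset.card := Finset.card_biUnion_le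
      _ ≤ ∑ x, leafCount G rule m {x} ∅ := Finset.sum_le_sum fun x _ =>
          (List.toFinset_card_le _).trans (length_enumerated_le rule m {x} ∅)
  calc ({D : Finset V | IsMinimalCDS G D}.ncard : ℝ)
      ≤ ∑ x, (leafCount G rule m {x} ∅ : ℝ) := mod_cast hcard
    _ ≤ ∑ _x : V, (1.9884 : ℝ) ^ Fintype.card V :=
        Finset.sum_le_sum fun x _ => leafCount_singleton_le hrule m x
    _ = Fintype.card V * 1.9884 ^ Fintype.card V := by simp

end CDSEnum

namespace WordRAM

/-! ### Total correctness with time bounds -/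

/-- The register `x` occurs in the expression. -/
def Expr.uses (x : ℕ) : Expr → Bool
  | .const _ => false
  | .reg y => x == y
  | .read _ i => i.uses x
  | .add e f => e.uses x || f.uses x
  | .sub e f => e.uses x || f.uses x
  | .mul e f => e.uses x || f.uses x
  | .lt e f => e.uses x || f.uses x
  | .eq e f => e.uses x || f.uses x

/-- The state after the assignment of `k` to register `x`. -/
def State.set (s : State) (x k : ℕ) : State := { s with reg := Function.update s.reg x k }

/-- The state after the assignment of `k` to cell `i` of array `a`. -/
def State.put (s : State) (a i k : ℕ) : State :=
  { s with mem := Function.update s.mem a (Function.update (s.mem a) i k) }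

/-- The program may write register `x`. -/
def Cmd.wreg (x : ℕ) : Cmd → Bool
  | .skip => false
  | .assign y _ => x == y
  | .store _ _ _ => false
  | .output _ => false
  | .seq c d => c.wreg x || d.wreg x
  | .ite _ c d => c.wreg x || d.wreg x
  | .while _ c => c.wreg x

/-- The program may write array `a`. -/
def Cmd.wmem (a : ℕ) : Cmd → Bool
  | .skip => false
  | .assign _ _ => false
  | .store b _ _ => a == b
  | .output _ => false
  | .seq c d => c.wmem a || d.wmem a
  | .ite _ c d => c.wmem a || d.wmem a
  | .while _ c => c.wmem a

/-- The program has no output command. -/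
def Cmd.quiet : Cmd → Bool
  | .skip => true
  | .assign _ _ => true
  | .store _ _ _ => true
  | .output _ => false
  | .seq c d => c.quiet && d.quiet
  | .ite _ c d => c.quiet && d.quiet
  | .while _ c => c.quiet

/-- What `c` does not write is the same in both states. -/
structure Frame (c : Cmd) (s s' : State) : Prop where
  reg : ∀ x, c.wreg x = false → s'.reg x = s.reg x
  mem : ∀ a, c.wmem a = false → s'.mem a = s.mem a
  out : c.quiet = true → s'.out = s.out

/-- Started in `s`, the program halts within `K` steps in a state that satisfies `Q`. -/
def Run (W : ℕ) (c : Cmd) (K : ℕ) (s : State) (Q : State → Prop) : Prop :=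
  ∃ t s', t ≤ K ∧ Exec W c s t s' ∧ Q s'

namespace State

@[simp] theorem set_reg (s : State) (x k y : ℕ) :
    (s.set x k).reg y = if y = x then k else s.reg y := by
  simp [set, Function.update_apply]

@[simp] theorem set_mem (s : State) (x k : ℕ) : (s.set x k).mem = s.mem := rfl

@[simp] theorem set_out (s : State) (x k : ℕ) : (s.set x k).out = s.out := rfl

@[simp] theorem put_reg (s : State) (a i k : ℕ) : (s.put a i k).reg = s.reg := rfl

theorem put_mem (s : State) (a i k b j : ℕ) :
    (s.put a i k).mem b j = if b = a ∧ j = i then k else s.mem b j := by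
  by_cases h : b = a
  · subst h
    simp [put, Function.update_apply]
  · simp [put, h]

theorem put_mem_ne (s : State) {a b : ℕ} (i k : ℕ) (h : b ≠ a) :
    (s.put a i k).mem b = s.mem b := by
  funext j
  simp [put_mem, h]

end State

namespace Expr

variable {W x : ℕ} {s s' : State}

theorem eval_congr (hm : s'.mem = s.mem) (hr : ∀ y, y ≠ x → s'.reg y = s.reg y) (e : Expr)
    (he : e.uses x = false) : e.eval s' = e.eval s := by
  induction e with
  | const k => rfl
  | reg y =>
    simp only [uses, beq_eq_false_iff_ne] at he
    exact hr y he.symm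
  | read a i ih => simp only [uses] at he; simp [eval, hm, ih he]
  | add e f ihe ihf | sub e f ihe ihf | mul e f ihe ihf | lt e f ihe ihf | eq e f ihe ihf =>
    simp only [uses, Bool.or_eq_false_iff] at he
    simp [eval, ihe he.1, ihf he.2]

theorem fits_congr (hm : s'.mem = s.mem) (hr : ∀ y, y ≠ x → s'.reg y = s.reg y) (e : Expr)
    (he : e.uses x = false) : e.Fits W s' ↔ e.Fits W s := by
  induction e with
  | const k => rfl
  | reg y =>
    simp only [uses, beq_eq_false_iff_ne] at he
    simp [Fits, hr y he.symm]
  | read a i ih =>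
    simp only [uses] at he
    simp [Fits, hm, ih he, eval_congr hm hr i he]
  | add e f ihe ihf | sub e f ihe ihf | mul e f ihe ihf | lt e f ihe ihf | eq e f ihe ihf =>
    simp only [uses, Bool.or_eq_false_iff] at he
    simp [Fits, ihe he.1, ihf he.2, eval_congr hm hr e he.1, eval_congr hm hr f he.2]

end Expr

section Frame

variable {c d : Cmd} {s s₁ s₂ : State}

theorem Frame.refl (c : Cmd) (s : State) : Frame c s s :=
  ⟨fun _ _ => rfl, fun _ _ => rfl, fun _ => rfl⟩

theorem Frame.trans (h₁ : Frame c s s₁) (h₂ : Frame c s₁ s₂) : Frame c s s₂ :=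
  ⟨fun x hx => (h₂.reg x hx).trans (h₁.reg x hx), fun a ha => (h₂.mem a ha).trans (h₁.mem a ha),
    fun hq => (h₂.out hq).trans (h₁.out hq)⟩

theorem Frame.mono (h : Frame c s s₁) (hreg : ∀ x, d.wreg x = false → c.wreg x = false)
    (hmem : ∀ a, d.wmem a = false → c.wmem a = false)
    (hout : d.quiet = true → c.quiet = true) : Frame d s s₁ :=
  ⟨fun x hx => h.reg x (hreg x hx), fun a ha => h.mem a (hmem a ha), fun hq => h.out (hout hq)⟩

theorem Frame.seq_left (h : Frame c s s₁) : Frame (.seq c d) s s₁ :=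
  h.mono (by simp +contextual [Cmd.wreg]) (by simp +contextual [Cmd.wmem])
    (by simp +contextual [Cmd.quiet])

theorem Frame.seq_right (h : Frame d s s₁) : Frame (.seq c d) s s₁ :=
  h.mono (by simp +contextual [Cmd.wreg]) (by simp +contextual [Cmd.wmem])
    (by simp +contextual [Cmd.quiet])

theorem frame_set {x k : ℕ} (hx : c.wreg x = true) : Frame c s (s.set x k) := by
  refine ⟨fun y hy => ?_, fun _ _ => rfl, fun _ => rfl⟩
  have hne : y ≠ x := by
    rintro rfl
    simp [hx] at hy
  simp [hne]

theorem Exec.frame {W t : ℕ} (h : Exec W c s t s₁) : Frame c s s₁ := by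
  induction h with
  | skip | whileFalse => exact Frame.refl _ _
  | assign => exact frame_set (by simp [Cmd.wreg])
  | store a =>
    refine ⟨fun _ _ => rfl, fun b hb => ?_, fun _ => rfl⟩
    simp only [Cmd.wmem, beq_eq_false_iff_ne] at hb
    simp [hb]
  | output => exact ⟨fun _ _ => rfl, fun _ _ => rfl, by simp [Cmd.quiet]⟩
  | seq _ _ _ _ _ _ _ _ _ ihc ihd => exact ihc.seq_left.trans ihd.seq_right
  | iteTrue _ _ _ _ _ _ _ _ _ ih | iteFalse _ _ _ _ _ _ _ _ _ ih =>
    exact ih.mono (by simp +contextual [Cmd.wreg]) (by simp +contextual [Cmd.wmem])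
      (by simp +contextual [Cmd.quiet])
  | whileTrue _ _ _ _ _ _ _ _ _ _ _ ihc ihw =>
    exact Frame.trans (ihc.mono (fun _ => id) (fun _ => id) id) ihw

end Frame

/-! ### Values of expressions -/

open Classical in
/-- The number `1` if `p` holds and `0` otherwise. -/
noncomputable def ind (p : Prop) : ℕ := if p then 1 else 0

theorem ind_le (p : Prop) : ind p ≤ 1 := by
  unfold ind
  split_ifs <;> simp

theorem ind_congr {p q : Prop} (h : p ↔ q) : ind p = ind q := by rw [propext h]

@[simp] theorem ind_eq_zero {p : Prop} : ind p = 0 ↔ ¬ p := by simp [ind]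

@[simp] theorem ind_eq_one {p : Prop} : ind p = 1 ↔ p := by simp [ind]

theorem ind_true {p : Prop} (h : p) : ind p = 1 := ind_eq_one.2 h

theorem ind_false {p : Prop} (h : ¬ p) : ind p = 0 := ind_eq_zero.2 h

open Classical in
/-- The number of elements that satisfy `P`. -/
noncomputable def count {n : ℕ} (P : Fin n → Prop) : ℕ := (Finset.univ.filter P).card

section count

variable {n : ℕ} (P : Fin n → Prop)

theorem count_eq_card [DecidablePred P] : count P = (Finset.univ.filter P).card := by
  unfold count
  congr

variable {P} in
theorem count_eq_zero : count P = 0 ↔ ∀ i, ¬ P i := by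
  simp [count, Finset.filter_eq_empty_iff]

theorem count_le : count P ≤ n := by
  classical exact (Finset.card_le_univ _).trans_eq (Fintype.card_fin n)

theorem count_lt_succ_and (j : Fin n) :
    (count fun i : Fin n => (i : ℕ) < j + 1 ∧ P i) =
      (count fun i : Fin n => (i : ℕ) < j ∧ P i) + ind (P j) := by
  classical
  simp only [count_eq_card, Nat.lt_succ_iff_lt_or_eq, ← Fin.ext_iff]
  by_cases hj : P j
  · rw [ind_true hj, ← Finset.card_insert_of_notMem (a := j) (by simp)]
    congr 1
    ext i
    simp only [Finset.mem_filter, Finset.mem_univ, true_and, Finset.mem_insert]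
    grind
  · rw [ind_false hj, add_zero]
    congr 1
    ext i
    simp only [Finset.mem_filter, Finset.mem_univ, true_and]
    grind

theorem count_lt_self_and : (count fun i : Fin n => (i : ℕ) < n ∧ P i) = count P := by
  simp only [Fin.is_lt, true_and]

end count

/-- The expression can be evaluated and has value `v`. -/
def Val (W : ℕ) (s : State) (e : Expr) (v : ℕ) : Prop := e.Fits W s ∧ e.eval s = v

namespace Val

variable {W : ℕ} {s : State} {e f : Expr} {a b : ℕ} {p q : Prop}

theorem const {k : ℕ} (h : k < W) : Val W s (.const k) k := ⟨h, rfl⟩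

theorem reg {x k : ℕ} (hx : s.reg x = k) (h : k < W) : Val W s (.reg x) k :=
  ⟨by simpa [Expr.Fits, hx] using h, hx⟩

theorem read {i k : ℕ} (he : Val W s e i) (h : s.mem a i = k)
    (hk : k < W) : Val W s (.read a e) k := by
  obtain ⟨h1, rfl⟩ := he
  exact ⟨⟨h1, by simpa [h] using hk⟩, h⟩

theorem add (he : Val W s e a) (hf : Val W s f b)
    (h : a + b < W) : Val W s (.add e f) (a + b) := by
  obtain ⟨h1, rfl⟩ := he
  obtain ⟨h2, rfl⟩ := hf
  exact ⟨⟨h1, h2, h⟩, rfl⟩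

theorem mul (he : Val W s e a) (hf : Val W s f b)
    (h : a * b < W) : Val W s (.mul e f) (a * b) := by
  obtain ⟨h1, rfl⟩ := he
  obtain ⟨h2, rfl⟩ := hf
  exact ⟨⟨h1, h2, h⟩, rfl⟩

theorem sub (he : Val W s e a) (hf : Val W s f b) :
    Val W s (.sub e f) (a - b) := by
  obtain ⟨h1, rfl⟩ := he
  obtain ⟨h2, rfl⟩ := hf
  exact ⟨⟨h1, h2⟩, rfl⟩

theorem lt (hW : 1 < W) (he : Val W s e a)
    (hf : Val W s f b) : Val W s (.lt e f) (ind (a < b)) := by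
  obtain ⟨h1, rfl⟩ := he
  obtain ⟨h2, rfl⟩ := hf
  refine ⟨⟨h1, h2, hW⟩, ?_⟩
  simp only [Expr.eval, ind]
  split_ifs <;> rfl

theorem eq (hW : 1 < W) (he : Val W s e a)
    (hf : Val W s f b) : Val W s (.eq e f) (ind (a = b)) := by
  obtain ⟨h1, rfl⟩ := he
  obtain ⟨h2, rfl⟩ := hf
  refine ⟨⟨h1, h2, hW⟩, ?_⟩
  simp only [Expr.eval, ind]
  split_ifs <;> rfl

theorem congr (he : Val W s e (ind p)) (h : p ↔ q) :
    Val W s e (ind q) := by rwa [← ind_congr h]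

theorem and (hW : 1 < W) (he : Val W s e (ind p))
    (hf : Val W s f (ind q)) : Val W s (.mul e f) (ind (p ∧ q)) := by
  have h : ind p * ind q = ind (p ∧ q) := by
    by_cases hp : p <;> by_cases hq : q <;> simp [ind, hp, hq]
  rw [← h]
  exact Val.mul he hf (by rw [h]; have := ind_le (p ∧ q); omega)

theorem or (hW : 2 < W) (he : Val W s e (ind p))
    (hf : Val W s f (ind q)) : Val W s (.lt (.const 0) (.add e f)) (ind (p ∨ q)) := by
  have h1 := ind_le p
  have h2 := ind_le q
  refine ((Val.lt (by omega) (Val.const (by omega))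
    (Val.add he hf (by omega))).congr ?_)
  by_cases hp : p <;> by_cases hq : q <;> simp [ind, hp, hq]

end Val

/-! ### Rules for programs -/

/-- Run `c` for all values of register `i` below the number in register `0`. -/
def forN (i : ℕ) (c : Cmd) : Cmd :=
  .seq (.assign i (.const 0)) (.while (.lt (.reg i) (.reg 0))
    (.seq c (.assign i (.add (.reg i) (.const 1)))))

/-- Assign to register `a` the number of values of register `i` below the number in register `0`
for which `e` holds after `c`. -/
def countN (a i : ℕ) (c : Cmd) (e : Expr) : Cmd :=
  .seq (.assign a (.const 0)) (forN i (.seq c (.assign a (.add (.reg a) e))))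

/-- Assign to register `a` the number of values of register `i` below the number in register `0`
for which `e` holds. -/
def sumN (a i : ℕ) (e : Expr) : Cmd := countN a i .skip e

/-- Fill array `a` with the values of `e` after `c`, for all values of register `i` below the
number in register `0`. -/
def fillN (a i : ℕ) (c : Cmd) (e : Expr) : Cmd := forN i (.seq c (.store a (.reg i) e))

theorem Frame.forN_body {i : ℕ} {c : Cmd} {e : Expr} {s s' : State}
    (h : Frame (.seq c (.assign i e)) s s') : Frame (forN i c) s s' :=
  h.mono (by simp +contextual [forN, Cmd.wreg]) (by simp +contextual [forN, Cmd.wmem])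
    (by simp +contextual [forN, Cmd.quiet])

section Run

variable {W : ℕ} {c d : Cmd} {e : Expr} {K K' L : ℕ} {s : State} {P Q Q' : State → Prop}

namespace Run

theorem mono (h : Run W c K s Q) (hK : K ≤ K') (hQ : ∀ s', Frame c s s' → Q s' → Q' s') :
    Run W c K' s Q' := by
  obtain ⟨t, s', ht, he, hq⟩ := h
  exact ⟨t, s', ht.trans hK, he, hQ s' he.frame hq⟩

theorem mono_time (h : Run W c K s Q) (hK : K ≤ K') : Run W c K' s Q :=
  h.mono hK fun _ _ => id

theorem skip (h : Q s) : Run W .skip 1 s Q :=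
  ⟨1, s, le_rfl, .skip s, h⟩

theorem assign {x v : ℕ} (he : Val W s e v) (h : Q (s.set x v)) :
    Run W (.assign x e) (e.cost + 1) s Q := by
  obtain ⟨he, rfl⟩ := he
  exact ⟨_, _, le_rfl, .assign x e s he, h⟩

theorem store {a j v : ℕ} {i : Expr} (hi : Val W s i j) (he : Val W s e v)
    (h : Q (s.put a j v)) : Run W (.store a i e) (i.cost + e.cost + 1) s Q := by
  obtain ⟨hi, rfl⟩ := hi
  obtain ⟨he, rfl⟩ := he
  exact ⟨_, _, le_rfl, .store a i e s hi he, h⟩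

theorem output {v : ℕ} (he : Val W s e v) (h : Q { s with out := s.out ++ [v] }) :
    Run W (.output e) (e.cost + 1) s Q := by
  obtain ⟨he, rfl⟩ := he
  exact ⟨_, _, le_rfl, .output e s he, h⟩

theorem seq (hc : Run W c K s P) (hd : ∀ s', Frame c s s' → P s' → Run W d L s' Q) :
    Run W (.seq c d) (K + L) s Q := by
  obtain ⟨t, s', ht, he, hp⟩ := hc
  obtain ⟨t', s'', ht', he', hq⟩ := hd s' he.frame hp
  exact ⟨t + t', s'', by omega, .seq c d s s' s'' t t' he he', hq⟩

theorem ite {p : Prop} (he : Val W s e (ind p)) (hc : p → Run W c K s Q)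
    (hd : ¬ p → Run W d K s Q) : Run W (.ite e c d) (e.cost + 1 + K) s Q := by
  obtain ⟨hfits, heval⟩ := he
  by_cases hp : p
  · obtain ⟨t, s', ht, hx, hq⟩ := hc hp
    exact ⟨_, s', by omega, .iteTrue e c d s s' t hfits (by simp [heval, hp]) hx, hq⟩
  · obtain ⟨t, s', ht, hx, hq⟩ := hd hp
    exact ⟨_, s', by omega, .iteFalse e c d s s' t hfits (by simp [heval, hp]) hx, hq⟩

theorem while_countdown (I : ℕ → State → Prop)
    (hstep : ∀ k s, I (k + 1) s → e.Fits W s ∧ e.eval s ≠ 0 ∧ Run W c K s (I k))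
    (hend : ∀ s, I 0 s → e.Fits W s ∧ e.eval s = 0) (k : ℕ) (hs : I k s) :
    Run W (.while e c) ((e.cost + 1 + K) * k + (e.cost + 1)) s (I 0) := by
  induction k generalizing s with
  | zero => exact ⟨_, s, by omega, .whileFalse e c s (hend s hs).1 (hend s hs).2, hs⟩
  | succ k ih =>
    obtain ⟨he, h, t, s', ht, hc, hI⟩ := hstep k s hs
    obtain ⟨t', s'', ht', hw, hQ⟩ := ih hI
    refine ⟨_, s'', ?_, .whileTrue e c s s' s'' t t' he h hc hw, hQ⟩
    rw [Nat.mul_succ]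
    omega

theorem forN {n i : ℕ} (I : ℕ → State → Prop) (hW : n + 2 ≤ W) (hi : i ≠ 0)
    (hci : c.wreg i = false) (hc0 : c.wreg 0 = false) (hn : s.reg 0 = n) (h0 : I 0 (s.set i 0))
    (hbody : ∀ j < n, ∀ s', Frame (WordRAM.forN i c) s s' → s'.reg i = j → I j s' →
      Run W c K s' fun s'' => I (j + 1) (s''.set i (j + 1))) :
    Run W (WordRAM.forN i c) ((K + 12) * (n + 1)) s (I n) := by
  let J : ℕ → State → Prop := fun k s' =>
    ∃ j, j + k = n ∧ s'.reg i = j ∧ Frame (WordRAM.forN i c) s s' ∧ I j s'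
  have hguard : ∀ {s' j}, j ≤ n → s'.reg i = j → Frame (WordRAM.forN i c) s s' →
      Val W s' (.lt (.reg i) (.reg 0)) (ind (j < n)) := fun hj hij hf => by
    have hread0 := (hf.reg 0 (by simp [WordRAM.forN, Cmd.wreg, hi.symm, hc0])).trans hn
    exact Val.lt (by omega) (Val.reg hij (by omega)) (Val.reg hread0 (by omega))
  have hstep : ∀ k s', J (k + 1) s' → (Expr.lt (.reg i) (.reg 0)).Fits W s' ∧
      (Expr.lt (.reg i) (.reg 0)).eval s' ≠ 0 ∧
      Run W (.seq c (.assign i (.add (.reg i) (.const 1)))) (K + 4) s' (J k) := by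
    rintro k s' ⟨j, hjk, hij, hf, hI⟩
    obtain ⟨hfits, heval⟩ := hguard (by omega) hij hf
    refine ⟨hfits, by simp [heval, show j < n by omega], ?_⟩
    have hrun : Run W (.seq c (.assign i (.add (.reg i) (.const 1)))) (K + 4) s'
        fun s₂ => s₂.reg i = j + 1 ∧ I (j + 1) s₂ :=
      (hbody j (by omega) s' hf hij hI).seq fun s₁ hf₁ hI₁ =>
        assign (Val.add (Val.reg ((hf₁.reg i hci).trans hij) (by omega)) (Val.const (by omega))
          (by omega)) ⟨by simp, hI₁⟩
    exact hrun.mono le_rfl fun s₂ hf₂ h₂ =>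
      ⟨j + 1, by omega, h₂.1, hf.trans hf₂.forN_body, h₂.2⟩
  have hend : ∀ s', J 0 s' → (Expr.lt (.reg i) (.reg 0)).Fits W s' ∧
      (Expr.lt (.reg i) (.reg 0)).eval s' = 0 := by
    rintro s' ⟨j, rfl, hij, hf, -⟩
    obtain ⟨hfits, heval⟩ := hguard le_rfl hij hf
    exact ⟨hfits, by simp [heval]⟩
  have hinit : Run W (.assign i (.const 0)) 2 s (J n) :=
    assign (Val.const (by omega))
      ⟨0, by omega, by simp, frame_set (by simp [WordRAM.forN, Cmd.wreg]), h0⟩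
  refine (hinit.seq fun s' _ hs' => while_countdown J hstep hend n hs').mono ?_ ?_
  · simp only [Expr.cost]
    nlinarith
  · rintro s' - ⟨j, rfl, -, -, hI⟩
    exact hI

theorem countN {n a i k : ℕ} {p : Fin n → Prop} {J : State → Prop} (hW : n + 2 ≤ W) (hi : i ≠ 0)
    (ha : a ≠ 0) (hai : i ≠ a) (hca : c.wreg a = false) (hci : c.wreg i = false)
    (hc0 : c.wreg 0 = false) (hn : s.reg 0 = n) (he : e.cost ≤ k) (hJ : J s)
    (hJa : ∀ s k, J s → J (s.set a k)) (hJi : ∀ s k, J s → J (s.set i k))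
    (hbody : ∀ j : Fin n, ∀ s', Frame (WordRAM.countN a i c e) s s' → s'.reg i = j → J s' →
      Run W c K s' fun s'' => Val W s'' e (ind (p j)) ∧ J s'') :
    Run W (WordRAM.countN a i c e) ((K + k + 20) * (n + 1)) s
      fun s' => s'.reg a = count p ∧ J s' := by
  let I : ℕ → State → Prop := fun j s' =>
    s'.reg a = (count fun i : Fin n => (i : ℕ) < j ∧ p i) ∧ J s'
  have hloop : Run W (WordRAM.forN i (.seq c (.assign a (.add (.reg a) e))))
      ((K + (k + 3) + 12) * (n + 1)) (s.set a 0) (I n) := by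
    refine forN I hW hi (by simp [Cmd.wreg, hci, hai]) (by simp [Cmd.wreg, hc0, ha.symm])
      (by simp [ha.symm, hn]) ⟨?_, hJi _ _ (hJa _ _ hJ)⟩ fun j hj s' hf hij hI => ?_
    · simp [hai.symm, count]
    have hf' : Frame (WordRAM.countN a i c e) s s' :=
      (frame_set (by simp [WordRAM.countN, Cmd.wreg])).trans hf.seq_right
    refine seq (hbody ⟨j, hj⟩ s' hf' hij hI.2) fun s₁ hf₁ h₁ => ?_
    have hcount : (count fun i : Fin n => (i : ℕ) < j + 1 ∧ p i) =
        (count fun i : Fin n => (i : ℕ) < j ∧ p i) + ind (p ⟨j, hj⟩) := count_lt_succ_and p ⟨j, hj⟩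
    have hle := count_le fun i : Fin n => (i : ℕ) < j + 1 ∧ p i
    refine (assign (Val.add (Val.reg ((hf₁.reg a hca).trans hI.1) (by omega)) h₁.1
      (by omega)) ⟨?_, hJi _ _ (hJa _ _ h₁.2)⟩).mono_time (by simp only [Expr.cost]; omega)
    simp only [State.set_reg, hai.symm, if_false, if_true, hcount]
  refine (seq (P := fun s' => s' = s.set a 0) (assign (Val.const (by omega)) rfl)
    fun s' _ hs' => hs' ▸ hloop).mono ?_ fun s' _ hs' => ?_
  · simp only [Expr.cost]
    nlinarith
  · exact ⟨hs'.1.trans (count_lt_self_and p), hs'.2⟩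

theorem sumN {n a i k : ℕ} (p : Fin n → Prop) (hW : n + 2 ≤ W) (hi : i ≠ 0) (ha : a ≠ 0)
    (hai : i ≠ a) (hn : s.reg 0 = n) (hu : e.uses a = false) (he : e.cost ≤ k)
    (hv : ∀ j : Fin n, Val W (s.set i j) e (ind (p j))) :
    Run W (WordRAM.sumN a i e) ((k + 21) * (n + 1)) s fun s' => s'.reg a = count p := by
  refine (countN (J := fun _ => True) hW hi ha hai rfl rfl rfl hn he trivial
    (fun _ _ _ => trivial) (fun _ _ _ => trivial) fun j s' hf hij _ => skip ⟨?_, trivial⟩).mono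
    (Nat.mul_le_mul_right _ (by omega)) fun _ _ h => h.1
  have hmem : s'.mem = (s.set i j).mem := funext fun b =>
    hf.mem b (by simp [WordRAM.countN, WordRAM.forN, Cmd.wmem])
  have hreg : ∀ y, y ≠ a → s'.reg y = (s.set i j).reg y := fun y hy => by
    by_cases hyi : y = i
    · simp [hyi, hij]
    · rw [hf.reg y (by simp [WordRAM.countN, WordRAM.forN, Cmd.wreg, hy, hyi])]
      simp [hyi]
  exact ⟨(Expr.fits_congr hmem hreg e hu).2 (hv j).1,
    (Expr.eval_congr hmem hreg e hu).trans (hv j).2⟩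

theorem fillN {n a i k : ℕ} (f : Fin n → ℕ) (hW : n + 2 ≤ W) (hi : i ≠ 0)
    (hci : c.wreg i = false) (hc0 : c.wreg 0 = false) (hca : c.wmem a = false)
    (hn : s.reg 0 = n) (he : e.cost ≤ k)
    (hbody : ∀ j : Fin n, ∀ s', Frame (WordRAM.fillN a i c e) s s' → s'.reg i = j →
      Run W c K s' fun s'' => Val W s'' e (f j)) :
    Run W (WordRAM.fillN a i c e) ((K + k + 20) * (n + 1)) s
      fun s' => ∀ j : Fin n, s'.mem a j = f j := by
  let I : ℕ → State → Prop := fun j s' => ∀ l : Fin n, (l : ℕ) < j → s'.mem a l = f l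
  refine (forN (K := K + (k + 2)) I hW hi (by simp [Cmd.wreg, hci]) (by simp [Cmd.wreg, hc0]) hn
    (by simp [I]) fun j hj s' hf hij hI => ?_).mono (Nat.mul_le_mul_right _ (by omega))
    fun s' _ h l => h l l.2
  refine seq (hbody ⟨j, hj⟩ s' hf hij) fun s₁ hf₁ hv => ?_
  have hri : s₁.reg i = j := (hf₁.reg i hci).trans hij
  refine (store (Val.reg hri (by omega)) hv fun l hl => ?_).mono_time
    (by simp only [Expr.cost]; omega)
  simp only [State.set_mem, State.put_mem, true_and]
  split_ifs with h
  · rw [show l = ⟨j, hj⟩ from Fin.ext h]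
  · rw [hf₁.mem a hca]
    exact hI l (by omega)

end Run

end Run

end WordRAM

namespace CDSEnum

open WordRAM

/-! ### Search for a component -/

section Component

variable {V : Type*} {G : SimpleGraph V}

variable (G) in
/-- The state of a search through `S` from the seeds `F`: the set `R` found so far contains the
seeds and is contained in every closed subset of `S` that contains them. -/
structure IsReachedFrom (S F R : Finset V) : Prop where
  subset : R ⊆ S
  seeds_subset : F ⊆ R
  subset_of_isClosedIn : ∀ C ⊆ S, IsClosedIn G C S → F ⊆ C → R ⊆ C

variable {S F R R' : Finset V} {a : V}

theorem IsReachedFrom.refl (hF : F ⊆ S) : IsReachedFrom G S F F :=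
  ⟨hF, subset_rfl, fun _ _ _ h => h⟩

theorem IsReachedFrom.insert [DecidableEq V] (h : IsReachedFrom G S F R) {b : V} (ha : a ∈ R)
    (hb : b ∈ S) (hab : G.Adj a b) : IsReachedFrom G S F (insert b R) :=
  ⟨Finset.insert_subset hb h.subset, h.seeds_subset.trans (Finset.subset_insert b R),
    fun C hCS hC hFC =>
      have hRC := h.subset_of_isClosedIn C hCS hC hFC
      Finset.insert_subset (hC a (hRC ha) b hb hab) hRC⟩

theorem IsReachedFrom.isClosedIn_or_lt_card (h : IsReachedFrom G S F R)
    (h' : IsReachedFrom G S F R') (hRR' : R ⊆ R')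
    (hnbr : ∀ b ∈ S, (∃ a ∈ R, G.Adj a b) → b ∈ R') {j : ℕ} (hj : IsClosedIn G R S ∨ j ≤ R.card) :
    IsClosedIn G R' S ∨ j + 1 ≤ R'.card := by
  by_cases hR : IsClosedIn G R S
  · have hR' : R' = R :=
      (h'.subset_of_isClosedIn R h.subset hR h.seeds_subset).antisymm hRR'
    exact Or.inl (hR' ▸ hR)
  · have hjR : j ≤ R.card := hj.resolve_left hR
    unfold IsClosedIn at hR
    push Not at hR
    obtain ⟨a, ha, b, hb, hab, hbR⟩ := hR
    exact Or.inr (hjR.trans_lt (Finset.card_lt_card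
      ((Finset.ssubset_iff_of_subset hRR').2 ⟨b, hnbr b hb ⟨a, ha, hab⟩, hbR⟩)))

theorem IsReachedFrom.subset_iff_cutConnected (h : IsReachedFrom G S {a} R)
    (hR : IsClosedIn G R S) : S ⊆ R ↔ CutConnected G S := by
  classical
  have haR : a ∈ R := h.seeds_subset (Finset.mem_singleton_self a)
  refine ⟨fun hSR => ⟨⟨a, h.subset haR⟩, fun C hCS ⟨c, hc⟩ hC => ?_⟩,
    fun hS => hS.2 R h.subset ⟨a, haR⟩ hR⟩
  by_cases ha : a ∈ C
  · exact hSR.trans (h.subset_of_isClosedIn C hCS hC (Finset.singleton_subset_iff.2 ha))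
  have hcompl : IsClosedIn G (S \ C) S := fun x hx y hy hxy =>
    Finset.mem_sdiff.2 ⟨hy, fun hyC => (Finset.mem_sdiff.1 hx).2
      (hC y hyC x (Finset.mem_sdiff.1 hx).1 hxy.symm)⟩
  have hsub : R ⊆ S \ C := h.subset_of_isClosedIn _ Finset.sdiff_subset hcompl
    (Finset.singleton_subset_iff.2 (Finset.mem_sdiff.2 ⟨h.subset haR, ha⟩))
  exact absurd hc (Finset.mem_sdiff.1 (hsub (hSR (hCS hc)))).2

/-- The singleton of the least element of `S`, or the empty set if `S` is empty. -/
def leastSet {n : ℕ} (S : Finset (Fin n)) : Finset (Fin n) := {a ∈ S | ∀ b ∈ S, ¬ b < a}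

theorem leastSet_eq_singleton {n : ℕ} {S : Finset (Fin n)} (hS : S.Nonempty) :
    leastSet S = {S.min' hS} := by
  ext a
  simp only [leastSet, not_lt, Finset.mem_filter, Finset.mem_singleton]
  exact ⟨fun ⟨ha, hmin⟩ => (hmin _ (S.min'_mem hS)).antisymm (S.min'_le a ha),
    fun ha => ha ▸ ⟨S.min'_mem hS, fun b hb => S.min'_le b hb⟩⟩

theorem IsReachedFrom.exists_notMem_iff {n : ℕ} {G : SimpleGraph (Fin n)} {S R : Finset (Fin n)}
    (h : IsReachedFrom G S (leastSet S) R) (hR : IsClosedIn G R S) :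
    (∃ i, i ∈ S ∧ i ∉ R) ↔ S.Nonempty ∧ ¬ CutConnected G S := by
  rw [← Finset.not_subset]
  rcases S.eq_empty_or_nonempty with rfl | hS
  · simp
  · rw [leastSet_eq_singleton hS] at h
    rw [h.subset_iff_cutConnected hR, and_iff_right hS]

end Component

/-! ### Programs for the tests at a node of the search tree -/

/- Register `0` holds the number of vertices, register `1` the root of the search, and registers
`4` to `8` are loop variables. Results of tests: `10` (scratch), `9` and `18` (removal of a
vertex), `11` (dead state), `12` (redundant vertices), `16` (a chosen vertex below the root),
`17` (an undominated vertex). Registers `13` and `14` hold the best score so far and its vertex,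
and `15` the current score. Array `0` holds the adjacency matrix, array `1` the status of the
vertices (`1` chosen, `2` excluded, `0` undecided), array `3` the dominated vertices, and array
`4` the vertices found by the search for a component. -/

/-- Negation of a truth value. -/
def notE (e : Expr) : Expr := .eq e (.const 0)

/-- Adjacency of the vertices in registers `x` and `y`. -/
def adjE (x y : ℕ) : Expr := .read 0 (.add (.mul (.reg x) (.reg 0)) (.reg y))

/-- The vertices in registers `x` and `y` are equal or adjacent. -/
def closedE (x y : ℕ) : Expr := .lt (.const 0) (.add (.eq (.reg x) (.reg y)) (adjE x y))

/-- The vertex in register `x` has status `k`. -/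
def statusE (x k : ℕ) : Expr := .eq (.read 1 (.reg x)) (.const k)

/-- The vertex in register `x` belongs to the set in array `a`. -/
def memE (a x : ℕ) : Expr := .read a (.reg x)

/-- The test with outcome in register `x` succeeded. -/
def testE (x : ℕ) : Expr := .lt (.const 0) (.reg x)

/-- Test whether `e` holds for some vertex in register `5`, with outcome in register `a`. -/
def anyC (a : ℕ) (e : Expr) : Cmd := sumN a 5 e

/-- Run `c` while the vertex in register `x`, of status `k'`, has the status `k`. -/
def withStatusC (x k k' : ℕ) (c : Cmd) : Cmd :=
  .seq (.store 1 (.reg x) (.const k)) (.seq c (.store 1 (.reg x) (.const k')))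

/-- Test whether the vertex in register `x` is dominated by the vertices of status `1`. -/
def dominatedC (x : ℕ) : Cmd := anyC 10 (.mul (statusE 5 1) (closedE 5 x))

/-- Array `3` becomes the closed neighbourhood of the vertices of status `1`. -/
def domC : Cmd := fillN 3 4 (dominatedC 4) (testE 10)

/-- Test whether some undominated vertex has only neighbours of status `2`. -/
def deadC : Cmd :=
  countN 11 4 (anyC 10 (.mul (adjE 4 5) (notE (statusE 5 2))))
    (.mul (notE (memE 3 4)) (notE (testE 10)))

/-- Array `4` becomes the set of the first vertex of status `1`. -/
def startC : Cmd :=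
  fillN 4 8 (anyC 10 (.mul (statusE 5 1) (.lt (.reg 5) (.reg 8))))
    (.mul (statusE 8 1) (notE (testE 10)))

/-- Put the vertex in register `8` into array `4` if it has status `1` and is adjacent to a
vertex there. -/
def growC : Cmd :=
  .seq (anyC 10 (.mul (memE 4 5) (adjE 5 8)))
    (.ite (.mul (statusE 8 1) (testE 10)) (.store 4 (.reg 8) (.const 1)) .skip)

/-- Array `4` becomes the component of the first vertex of status `1` among these vertices. -/
def reachC : Cmd := .seq startC (forN 7 (forN 8 growC))

/-- Test whether the vertices of status `1` are disconnected. -/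
def disconnectedC : Cmd := .seq reachC (anyC 9 (.mul (statusE 5 1) (notE (memE 4 5))))

/-- Test whether some vertex of the closed neighbourhood of the vertex in register `6` is not
dominated by the vertices of status `1`. -/
def privateC : Cmd := countN 18 7 (dominatedC 7) (.mul (closedE 6 7) (notE (testE 10)))

/-- The two tests for the removal of the vertex in register `6` from those of status `1`. -/
def removeC : Cmd := withStatusC 6 0 1 (.seq disconnectedC privateC)

/-- Test whether the vertices of status `1` have a redundant vertex. -/
def redundantC : Cmd :=
  countN 12 6 (.ite (statusE 6 1) removeC (.seq (.assign 9 (.const 1)) (.assign 18 (.const 0))))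
    (.mul (notE (testE 9)) (notE (testE 18)))

section Tests

variable {n : ℕ} {G : SimpleGraph (Fin n)} {W : ℕ} {s s' : State} {c : Cmd}
  {D X S F R : Finset (Fin n)}

variable (G W) in
/-- The state holds the graph `G` and legal entries of the status array, and the machine is
large enough for the computations of the program. -/
structure HoldsGraph (s : State) : Prop where
  bound : n * n + 20 * n + 100 ≤ W
  size : s.reg 0 = n
  adj : ∀ i j : Fin n, s.mem 0 (i * n + j) = ind (G.Adj i j)
  status_le : ∀ i : Fin n, s.mem 1 i ≤ 2

/-- Array `a` holds the indicator function of `R`. -/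
def HoldsSet (s : State) (a : ℕ) (R : Finset (Fin n)) : Prop :=
  ∀ i : Fin n, s.mem a i = ind (i ∈ R)

/-- The vertices of status `k` are those of `S`. -/
def HoldsClass (s : State) (k : ℕ) (S : Finset (Fin n)) : Prop :=
  ∀ i : Fin n, s.mem 1 i = k ↔ i ∈ S

variable (n) in
/-- Register `x` holds the outcome of a test for `p`: a number that is positive if `p` holds and
`0` otherwise. -/
def HoldsTest (s : State) (x : ℕ) (p : Prop) : Prop := s.reg x ≤ n ∧ (0 < s.reg x ↔ p)

theorem HoldsSet.frame {a : ℕ} (h : HoldsSet s a R) (hf : Frame c s s')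
    (ha : c.wmem a = false) : HoldsSet s' a R := fun i => by rw [hf.mem a ha, h i]

theorem HoldsClass.of_mem_eq {k : ℕ} (h : HoldsClass s k S) (hm : s'.mem 1 = s.mem 1) :
    HoldsClass s' k S := fun i => by rw [hm, h i]

theorem HoldsClass.frame {k : ℕ} (h : HoldsClass s k S) (hf : Frame c s s')
    (hc : c.wmem 1 = false) : HoldsClass s' k S := h.of_mem_eq (hf.mem 1 hc)

namespace HoldsTest

variable {x : ℕ} {p q : Prop}

theorem frame (h : HoldsTest n s x p) (hf : Frame c s s') (hc : c.wreg x = false) :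
    HoldsTest n s' x p := by rwa [HoldsTest, hf.reg x hc]

theorem congr (h : HoldsTest n s x p) (hpq : p ↔ q) : HoldsTest n s x q :=
  ⟨h.1, h.2.trans hpq⟩

theorem of_count {p : Fin n → Prop} (h : s.reg x = count p) : HoldsTest n s x (∃ i, p i) := by
  refine ⟨h ▸ count_le p, ?_⟩
  rw [h, Nat.pos_iff_ne_zero, ne_eq, count_eq_zero]
  push Not
  rfl

end HoldsTest

namespace HoldsGraph

variable {x y a k : ℕ} {i j : Fin n} {e : Expr} {p : Prop}

theorem one_lt (h : HoldsGraph G W s) : 1 < W := by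
  have := h.bound
  omega

theorem add_two_le (h : HoldsGraph G W s) : n + 2 ≤ W := by
  have := h.bound
  omega

theorem of_status_le (h : HoldsGraph G W s) (hf : Frame c s s') (hreg : c.wreg 0 = false)
    (hmem : c.wmem 0 = false) (hs : ∀ i : Fin n, s'.mem 1 i ≤ 2) : HoldsGraph G W s' :=
  ⟨h.bound, by rw [hf.reg 0 hreg, h.size], fun i j => by rw [hf.mem 0 hmem, h.adj], hs⟩

theorem of_mem_eq (h : HoldsGraph G W s) (hf : Frame c s s') (hreg : c.wreg 0 = false)
    (hmem : c.wmem 0 = false) (hm : s'.mem 1 = s.mem 1) : HoldsGraph G W s' :=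
  h.of_status_le hf hreg hmem fun i => by rw [hm]; exact h.status_le i

theorem frame (h : HoldsGraph G W s) (hf : Frame c s s') (hreg : c.wreg 0 = false)
    (hmem : c.wmem 0 = false) (hmem1 : c.wmem 1 = false) : HoldsGraph G W s' :=
  h.of_mem_eq hf hreg hmem (hf.mem 1 hmem1)

theorem set (h : HoldsGraph G W s) (hx : x ≠ 0) : HoldsGraph G W (s.set x k) :=
  ⟨h.bound, by simp [hx.symm, h.size], h.adj, h.status_le⟩

theorem put (h : HoldsGraph G W s) {l : ℕ} (hk : k ≤ 2) : HoldsGraph G W (s.put 1 l k) := by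
  refine ⟨h.bound, h.size, fun i j => ?_, fun j => ?_⟩
  · rw [State.put_mem_ne _ _ _ (by norm_num)]
    exact h.adj i j
  · rw [State.put_mem]
    split_ifs
    · exact hk
    · exact h.status_le j

theorem val_vertex (h : HoldsGraph G W s) (hx : s.reg x = i) : Val W s (.reg x) i :=
  Val.reg hx (by have := h.add_two_le; omega)

theorem val_adj (h : HoldsGraph G W s) (hx : s.reg x = i) (hy : s.reg y = j) :
    Val W s (adjE x y) (ind (G.Adj i j)) := by
  have hb := h.bound
  have hcell : (i : ℕ) * n + j < n * n := calc
    (i : ℕ) * n + j < i * n + n := by omega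
    _ = (i + 1) * n := by ring
    _ ≤ n * n := Nat.mul_le_mul_right _ i.2
  have := ind_le (G.Adj i j)
  exact Val.read (Val.add (Val.mul (h.val_vertex hx) (Val.reg h.size (by omega)) (by omega))
    (h.val_vertex hy) (by omega)) (h.adj i j) (by omega)

theorem val_closed (h : HoldsGraph G W s) (hx : s.reg x = i) (hy : s.reg y = j) :
    Val W s (closedE x y) (ind (i = j ∨ G.Adj i j)) :=
  Val.or (by have := h.bound; omega)
    ((Val.eq h.one_lt (h.val_vertex hx) (h.val_vertex hy)).congr Fin.ext_iff.symm)
    (h.val_adj hx hy)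

theorem val_lt (h : HoldsGraph G W s) (hx : s.reg x = i) (hy : s.reg y = j) :
    Val W s (.lt (.reg x) (.reg y)) (ind (i < j)) :=
  (Val.lt h.one_lt (h.val_vertex hx) (h.val_vertex hy)).congr Fin.lt_def.symm

theorem val_status (h : HoldsGraph G W s) (hS : HoldsClass s k S) (hx : s.reg x = i)
    (hk : k ≤ 2) : Val W s (statusE x k) (ind (i ∈ S)) := by
  have hb := h.bound
  have := h.status_le i
  exact (Val.eq h.one_lt (Val.read (h.val_vertex hx) rfl (by omega))
    (Val.const (by omega))).congr (hS i)

theorem val_mem (h : HoldsGraph G W s) (hR : HoldsSet s a R) (hx : s.reg x = i) :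
    Val W s (memE a x) (ind (i ∈ R)) :=
  Val.read (h.val_vertex hx) (hR i) ((ind_le _).trans_lt h.one_lt)

theorem val_not (h : HoldsGraph G W s) (he : Val W s e (ind p)) : Val W s (notE e) (ind (¬ p)) :=
  (Val.eq h.one_lt he (Val.const (by have := h.one_lt; omega))).congr ind_eq_zero

theorem val_test (h : HoldsGraph G W s) (hp : HoldsTest n s x p) : Val W s (testE x) (ind p) := by
  have := h.add_two_le
  have := hp.1
  exact (Val.lt h.one_lt (Val.const (by omega)) (Val.reg rfl (by omega))).congr hp.2

theorem run_anyC (h : HoldsGraph G W s) (p : Fin n → Prop) (ha : a ≠ 0) (ha5 : 5 ≠ a)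
    (hu : e.uses a = false) (he : e.cost ≤ 39)
    (hv : ∀ i : Fin n, Val W (s.set 5 i) e (ind (p i))) :
    Run W (anyC a e) (60 * (n + 1)) s fun s' => HoldsTest n s' a (∃ i, p i) :=
  (Run.sumN p h.add_two_le (by decide) ha ha5 h.size hu he hv).mono le_rfl
    fun _ _ => HoldsTest.of_count

theorem run_withStatusC (h : HoldsGraph G W s) {k' K : ℕ} {Q : State → Prop} (hx : s.reg x = i)
    (hk : k ≤ 2) (hk' : k' ≤ 2) (hi : s.mem 1 i = k') (hcx : c.wreg x = false)
    (hc : Run W c K (s.put 1 i k) fun s' => s'.mem 1 = (s.put 1 i k).mem 1 ∧ Q s')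
    (hQ : ∀ s', Q s' → Q (s'.put 1 i k')) :
    Run W (withStatusC x k k' c) (K + 6) s fun s' => s'.mem 1 = s.mem 1 ∧ Q s' := by
  have hb := h.bound
  have hput : Run W (.store 1 (.reg x) (.const k)) 3 s (· = s.put 1 i k) :=
    Run.store (h.val_vertex hx) (Val.const (by omega)) rfl
  refine (hput.seq fun s₁ _ h₁ => ?_).mono_time (K := 3 + (K + 3)) (by omega)
  subst h₁
  refine hc.seq fun s₂ hf₂ ⟨hm₂, hQ₂⟩ => ?_
  refine Run.store (Val.reg (k := i) ((hf₂.reg x hcx).trans hx) (by omega))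
    (Val.const (by omega)) ⟨?_, hQ s₂ hQ₂⟩
  funext l
  simp only [State.put_mem, hm₂, true_and]
  grind

end HoldsGraph

/-! ### Correctness of the tests -/

theorem run_dominatedC (h : HoldsGraph G W s) (hS : HoldsClass s 1 S) {x : ℕ} {k : Fin n}
    (hx : s.reg x = k) (hx5 : x ≠ 5) (hx10 : x ≠ 10) :
    Run W (dominatedC x) (60 * (n + 1)) s fun s' => HoldsTest n s' 10 (k ∈ closedNbhd G S) := by
  refine (h.run_anyC (fun i => i ∈ S ∧ (i = k ∨ G.Adj i k)) (by decide) (by decide)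
    (by simp [Expr.uses, statusE, closedE, adjE, hx10.symm])
    (by simp [Expr.cost, statusE, closedE, adjE]) fun i => ?_).mono le_rfl
    fun s' _ ht => ht.congr ?_
  · have h' : HoldsGraph G W (s.set 5 i) := h.set (by decide)
    exact Val.and h.one_lt (h'.val_status hS (by simp) (by decide))
      (h'.val_closed (by simp) (by simpa [hx5] using hx))
  · rw [mem_closedNbhd]
    grind

theorem run_domC (h : HoldsGraph G W s) (hS : HoldsClass s 1 S) :
    Run W domC (110 * (n + 1) ^ 2) s fun s' => HoldsSet s' 3 (closedNbhd G S) := by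
  refine (Run.fillN (K := 60 * (n + 1)) (k := 30)
    (fun i : Fin n => ind (i ∈ closedNbhd G S)) h.add_two_le (by decide) rfl rfl rfl
    h.size (by decide) fun k s₁ hf₁ hk => ?_).mono (by nlinarith) fun _ _ => id
  have h₁ : HoldsGraph G W s₁ := h.frame hf₁ rfl rfl rfl
  exact (run_dominatedC h₁ (hS.frame hf₁ rfl) hk (by decide) (by decide)).mono le_rfl
    fun s₂ hf₂ ht => (h₁.frame hf₂ rfl rfl rfl).val_test ht

theorem run_deadC (h : HoldsGraph G W s) (hX : HoldsClass s 2 X)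
    (hD : HoldsSet s 3 (closedNbhd G D)) :
    Run W deadC (110 * (n + 1) ^ 2) s fun s' => HoldsTest n s' 11 (IsDead G D X) := by
  refine (Run.countN (K := 60 * (n + 1)) (k := 30) (J := fun _ => True)
    (p := fun i : Fin n => i ∉ closedNbhd G D ∧ ¬ ∃ u, G.Adj i u ∧ u ∉ X) h.add_two_le
    (by decide) (by decide) (by decide) rfl rfl rfl h.size (by decide) trivial
    (fun _ _ _ => trivial) (fun _ _ _ => trivial) fun k s₁ hf₁ hk _ => ?_).mono (by nlinarith)
    fun s' _ hs' => (HoldsTest.of_count hs'.1).congr ?_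
  · have h₁ : HoldsGraph G W s₁ := h.frame hf₁ rfl rfl rfl
    have hX₁ : HoldsClass s₁ 2 X := hX.frame hf₁ rfl
    refine (h₁.run_anyC (fun u => G.Adj k u ∧ u ∉ X) (by decide) (by decide) rfl (by decide)
      fun u => ?_).mono le_rfl fun s₂ hf₂ ht => ⟨?_, trivial⟩
    · have h' : HoldsGraph G W (s₁.set 5 u) := h₁.set (by decide)
      exact Val.and h.one_lt (h'.val_adj (by simpa using hk) (by simp))
        (h'.val_not (h'.val_status hX₁ (by simp) (by decide)))
    · have h₂ : HoldsGraph G W s₂ := h₁.frame hf₂ rfl rfl rfl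
      exact Val.and h.one_lt (h₂.val_not (h₂.val_mem ((hD.frame hf₁ rfl).frame hf₂ rfl)
        ((hf₂.reg 4 rfl).trans hk))) (h₂.val_not (h₂.val_test ht))
  · simp only [IsDead, mem_undominated]
    push Not
    rfl

theorem run_startC (h : HoldsGraph G W s) (hS : HoldsClass s 1 S) :
    Run W startC (110 * (n + 1) ^ 2) s fun s' => HoldsSet s' 4 (leastSet S) := by
  refine (Run.fillN (K := 60 * (n + 1)) (k := 30)
    (fun i : Fin n => ind (i ∈ leastSet S)) h.add_two_le (by decide) rfl rfl rfl
    h.size (by decide) fun k s₁ hf₁ hk => ?_).mono (by nlinarith) fun _ _ => id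
  have h₁ : HoldsGraph G W s₁ := h.frame hf₁ rfl rfl rfl
  have hS₁ : HoldsClass s₁ 1 S := hS.frame hf₁ rfl
  refine (h₁.run_anyC (fun i => i ∈ S ∧ i < k) (by decide) (by decide) rfl (by decide)
    fun i => ?_).mono le_rfl fun s₂ hf₂ ht => ?_
  · have h' : HoldsGraph G W (s₁.set 5 i) := h₁.set (by decide)
    exact Val.and h.one_lt (h'.val_status hS₁ (by simp) (by decide))
      (h'.val_lt (by simp) (by simpa using hk))
  · have h₂ : HoldsGraph G W s₂ := h₁.frame hf₂ rfl rfl rfl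
    refine (Val.and h.one_lt (h₂.val_status (hS₁.frame hf₂ rfl) ((hf₂.reg 8 rfl).trans hk)
      (by decide)) (h₂.val_not (h₂.val_test ht))).congr ?_
    simp [leastSet]

theorem HoldsSet.put_insert {a : ℕ} {k : Fin n} (hR : HoldsSet s a R) :
    HoldsSet (s.put a k 1) a (insert k R) := fun i => by
  rw [State.put_mem, hR]
  by_cases hik : i = k
  · simp [hik, ind_true]
  · simp [hik, Fin.val_ne_of_ne hik]

theorem HoldsClass.put_insert {k : Fin n} {l : ℕ} (hS : HoldsClass s l S) :
    HoldsClass (s.put 1 k l) l (insert k S) := fun i => by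
  rw [State.put_mem, Finset.mem_insert, ← hS i]
  by_cases hik : i = k
  · simp [hik]
  · simp [hik, Fin.val_ne_of_ne hik]

theorem HoldsClass.put_erase {k : Fin n} {l m : ℕ} (hS : HoldsClass s l S) (hm : m ≠ l) :
    HoldsClass (s.put 1 k m) l (S.erase k) := fun i => by
  rw [State.put_mem, Finset.mem_erase, ← hS i]
  by_cases hik : i = k
  · simp [hik, hm]
  · simp [hik, Fin.val_ne_of_ne hik]

theorem run_growC (h : HoldsGraph G W s) (hS : HoldsClass s 1 S) {k : Fin n} (hk : s.reg 8 = k)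
    (hR : HoldsSet s 4 R) (hreach : IsReachedFrom G S F R) :
    Run W growC (100 * (n + 1)) s fun s' => ∃ R', HoldsSet s' 4 R' ∧ IsReachedFrom G S F R' ∧
      R ⊆ R' ∧ (k ∈ S → (∃ a ∈ R, G.Adj a k) → k ∈ R') := by
  refine ((h.run_anyC (fun i => i ∈ R ∧ G.Adj i k) (by decide) (by decide) rfl (by decide)
    fun i => ?_).seq (L := 20) fun s₁ hf₁ ht => ?_).mono_time (by omega)
  · have h' : HoldsGraph G W (s.set 5 i) := h.set (by decide)
    exact Val.and h.one_lt (h'.val_mem hR (by simp)) (h'.val_adj (by simp) (by simpa using hk))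
  have h₁ : HoldsGraph G W s₁ := h.frame hf₁ rfl rfl rfl
  have hk₁ : s₁.reg 8 = k := (hf₁.reg 8 rfl).trans hk
  have hR₁ : HoldsSet s₁ 4 R := hR.frame hf₁ rfl
  refine (Run.ite (K := 3) (Val.and h.one_lt (h₁.val_status (hS.frame hf₁ rfl) hk₁ (by decide))
    (h₁.val_test ht)) (fun ⟨hkS, a, ha, hak⟩ => ?_) fun hno => ?_).mono_time (by decide)
  · exact Run.store (h₁.val_vertex hk₁) (Val.const h.one_lt) ⟨insert k R, hR₁.put_insert,
      hreach.insert ha hkS hak, Finset.subset_insert k R, fun _ _ => Finset.mem_insert_self k R⟩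
  · exact (Run.skip ⟨R, hR₁, hreach, subset_rfl,
      fun hkS hadj => absurd ⟨hkS, hadj⟩ hno⟩).mono_time (by decide)

theorem run_growC_round (h : HoldsGraph G W s) (hS : HoldsClass s 1 S) (hR : HoldsSet s 4 R)
    (hreach : IsReachedFrom G S F R) :
    Run W (forN 8 growC) (112 * (n + 1) ^ 2) s fun s' => ∃ R', HoldsSet s' 4 R' ∧
      IsReachedFrom G S F R' ∧ R ⊆ R' ∧ ∀ k ∈ S, (∃ a ∈ R, G.Adj a k) → k ∈ R' := by
  let I : ℕ → State → Prop := fun j s' => ∃ R', HoldsSet s' 4 R' ∧ IsReachedFrom G S F R' ∧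
    R ⊆ R' ∧ ∀ k : Fin n, (k : ℕ) < j → k ∈ S → (∃ a ∈ R, G.Adj a k) → k ∈ R'
  refine (Run.forN (K := 100 * (n + 1)) I h.add_two_le (by decide) rfl rfl h.size
    ⟨R, hR, hreach, subset_rfl, by simp⟩ ?_).mono (by nlinarith)
    fun s' _ ⟨R', hR', hreach', hsub, hnbr⟩ => ⟨R', hR', hreach', hsub, fun k => hnbr k k.2⟩
  rintro j hj s₁ hf₁ hij ⟨R₁, hR₁, hreach₁, hsub₁, hnbr₁⟩
  refine (run_growC (k := ⟨j, hj⟩) (h.frame hf₁ rfl rfl rfl) (hS.frame hf₁ rfl) hij hR₁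
    hreach₁).mono le_rfl fun s₂ _ ⟨R₂, hR₂, hreach₂, hsub₂, hnbr₂⟩ =>
    ⟨R₂, hR₂, hreach₂, hsub₁.trans hsub₂, fun k hk hkS ⟨a, ha, hak⟩ => ?_⟩
  rcases Nat.lt_succ_iff_lt_or_eq.1 hk with hk | hk
  · exact hsub₂ (hnbr₁ k hk hkS ⟨a, ha, hak⟩)
  · obtain rfl : k = ⟨j, hj⟩ := Fin.ext hk
    exact hnbr₂ hkS ⟨a, hsub₁ ha, hak⟩

theorem run_reachC (h : HoldsGraph G W s) (hS : HoldsClass s 1 S) :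
    Run W reachC (250 * (n + 1) ^ 3) s fun s' => ∃ R, HoldsSet s' 4 R ∧
      IsReachedFrom G S (leastSet S) R ∧ IsClosedIn G R S := by
  refine ((run_startC h hS).seq (Q := fun s' => ∃ R, HoldsSet s' 4 R ∧
    IsReachedFrom G S (leastSet S) R ∧ IsClosedIn G R S)
    (L := (112 * (n + 1) ^ 2 + 12) * (n + 1)) fun s₁ hf₁ hstart => ?_).mono_time
    (by nlinarith [sq_nonneg (n + 1 : ℤ)])
  let I : ℕ → State → Prop := fun j s' => ∃ R, HoldsSet s' 4 R ∧
    IsReachedFrom G S (leastSet S) R ∧ (IsClosedIn G R S ∨ j ≤ R.card)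
  have h₁ : HoldsGraph G W s₁ := h.frame hf₁ rfl rfl rfl
  refine (Run.forN I h.add_two_le (by decide) rfl rfl h₁.size
    ⟨leastSet S, hstart, .refl (Finset.filter_subset _ _), Or.inr (Nat.zero_le _)⟩ ?_).mono le_rfl
    fun s₂ _ ⟨R, hR, hreach, hcase⟩ => ⟨R, hR, hreach, hcase.elim id fun hn => ?_⟩
  · rintro j - s₂ hf₂ - ⟨R, hR, hreach, hcase⟩
    exact (run_growC_round (h₁.frame hf₂ rfl rfl rfl) ((hS.frame hf₁ rfl).frame hf₂ rfl) hR
      hreach).mono le_rfl fun s₃ _ ⟨R', hR', hreach', hsub, hnbr⟩ =>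
        ⟨R', hR', hreach', hreach.isClosedIn_or_lt_card hreach' hsub hnbr hcase⟩
  · have hRuniv : R = Finset.univ :=
      (Finset.card_eq_iff_eq_univ R).1 ((Finset.card_le_univ R).antisymm (by simpa using hn))
    exact fun _ _ b _ _ => hRuniv ▸ Finset.mem_univ b

theorem run_disconnectedC (h : HoldsGraph G W s) (hS : HoldsClass s 1 S) :
    Run W disconnectedC (310 * (n + 1) ^ 3) s
      fun s' => HoldsTest n s' 9 (S.Nonempty ∧ ¬ CutConnected G S) := by
  refine ((run_reachC h hS).seq (L := 60 * (n + 1)) fun s₁ hf₁ ⟨R, hR, hreach, hclosed⟩ =>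
    ?_).mono_time (by have : n + 1 ≤ (n + 1) ^ 3 := Nat.le_self_pow (by decide) _; omega)
  have h₁ : HoldsGraph G W s₁ := h.frame hf₁ rfl rfl rfl
  have hS₁ : HoldsClass s₁ 1 S := hS.frame hf₁ rfl
  refine (h₁.run_anyC (fun i => i ∈ S ∧ i ∉ R) (by decide) (by decide) rfl (by decide)
    fun i => ?_).mono le_rfl fun s₂ _ ht => ht.congr (hreach.exists_notMem_iff hclosed)
  have h' : HoldsGraph G W (s₁.set 5 i) := h₁.set (by decide)
  exact Val.and h.one_lt (h'.val_status hS₁ (by simp) (by decide))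
    (h'.val_not (h'.val_mem hR (by simp)))

theorem run_privateC (h : HoldsGraph G W s) (hS : HoldsClass s 1 S) {v : Fin n}
    (hv : s.reg 6 = v) :
    Run W privateC (110 * (n + 1) ^ 2) s
      fun s' => HoldsTest n s' 18 (∃ w, (v = w ∨ G.Adj v w) ∧ w ∉ closedNbhd G S) := by
  refine (Run.countN (K := 60 * (n + 1)) (k := 30) (J := fun _ => True)
    (p := fun w : Fin n => (v = w ∨ G.Adj v w) ∧ w ∉ closedNbhd G S) h.add_two_le
    (by decide) (by decide) (by decide) rfl rfl rfl h.size (by decide) trivial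
    (fun _ _ _ => trivial) (fun _ _ _ => trivial) fun w s₁ hf₁ hw _ => ?_).mono (by nlinarith)
    fun s' _ hs' => HoldsTest.of_count hs'.1
  have h₁ : HoldsGraph G W s₁ := h.frame hf₁ rfl rfl rfl
  refine (run_dominatedC h₁ (hS.frame hf₁ rfl) hw (by decide) (by decide)).mono le_rfl
    fun s₂ hf₂ ht => ⟨?_, trivial⟩
  have h₂ : HoldsGraph G W s₂ := h₁.frame hf₂ rfl rfl rfl
  exact Val.and h.one_lt (h₂.val_closed ((hf₂.reg 6 rfl).trans ((hf₁.reg 6 rfl).trans hv))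
    ((hf₂.reg 7 rfl).trans hw)) (h₂.val_not (h₂.val_test ht))

theorem run_removeC (h : HoldsGraph G W s) (hS : HoldsClass s 1 S) {v : Fin n} (hv : v ∈ S)
    (hr : s.reg 6 = v) :
    Run W removeC (500 * (n + 1) ^ 3) s fun s' => s'.mem 1 = s.mem 1 ∧
      HoldsTest n s' 9 ((S.erase v).Nonempty ∧ ¬ CutConnected G (S.erase v)) ∧
      HoldsTest n s' 18 (∃ w, (v = w ∨ G.Adj v w) ∧ w ∉ closedNbhd G (S.erase v)) := by
  have h₁ : HoldsGraph G W (s.put 1 v 0) := h.put (by decide)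
  have hS₁ : HoldsClass (s.put 1 v 0) 1 (S.erase v) := hS.put_erase (by decide)
  refine (h.run_withStatusC hr (by decide) (by decide) ((hS v).2 hv) rfl
    ((run_disconnectedC h₁ hS₁).seq fun s₂ hf₂ h9 =>
      (run_privateC (h₁.frame hf₂ rfl rfl rfl) (hS₁.frame hf₂ rfl) ((hf₂.reg 6 rfl).trans hr)).mono
        le_rfl fun s₃ hf₃ h18 => ⟨(hf₃.mem 1 rfl).trans (hf₂.mem 1 rfl), h9.frame hf₃ rfl, h18⟩)
    fun s' hQ => hQ).mono_time ?_
  have h2 : (n + 1) ^ 2 ≤ (n + 1) ^ 3 := Nat.pow_le_pow_right (by omega) (by decide)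
  have h0 : 1 ≤ (n + 1) ^ 3 := Nat.one_le_pow _ _ (by omega)
  omega

theorem removable_iff {v : Fin n} :
    (¬ (S.Nonempty ∧ ¬ CutConnected G S) ∧ ¬ ∃ w, (v = w ∨ G.Adj v w) ∧ w ∉ closedNbhd G S) ↔
      CutConnected G S ∧ ∀ w, w = v ∨ G.Adj v w → w ∈ closedNbhd G S := by
  have hdom : (¬ ∃ w, (v = w ∨ G.Adj v w) ∧ w ∉ closedNbhd G S) ↔
      ∀ w, w = v ∨ G.Adj v w → w ∈ closedNbhd G S := by
    push Not
    simp only [eq_comm]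
  rw [hdom]
  refine and_congr_left fun hall => ?_
  have hS : S.Nonempty := by
    rcases mem_closedNbhd.1 (hall v (Or.inl rfl)) with hv | ⟨u, hu, -⟩
    exacts [⟨v, hv⟩, ⟨u, hu⟩]
  simp [hS]

theorem run_redundantC (h : HoldsGraph G W s) (hS : HoldsClass s 1 S) :
    Run W redundantC (600 * (n + 1) ^ 4) s fun s' => s'.mem 1 = s.mem 1 ∧
      HoldsTest n s' 12 (HasRedundantVertex G S) := by
  have h3 : 1 ≤ (n + 1) ^ 3 := Nat.one_le_pow _ _ (by omega)
  refine (Run.countN (k := 30) (K := 500 * (n + 1) ^ 3 + 10) (J := fun s' => s'.mem 1 = s.mem 1)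
    (p := fun v : Fin n => v ∈ S ∧ CutConnected G (S.erase v) ∧
      ∀ w, w = v ∨ G.Adj v w → w ∈ closedNbhd G (S.erase v)) h.add_two_le
    (by decide) (by decide) (by decide) rfl rfl rfl h.size (by decide) rfl
    (fun _ _ h => h) (fun _ _ h => h) fun v s₁ hf₁ hv hm₁ => ?_).mono (by nlinarith)
    fun s' _ hs' => ⟨hs'.2, HoldsTest.of_count hs'.1⟩
  have h₁ : HoldsGraph G W s₁ := h.of_mem_eq hf₁ rfl rfl hm₁
  have hS₁ : HoldsClass s₁ 1 S := hS.of_mem_eq hm₁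
  refine (Run.ite (K := 500 * (n + 1) ^ 3) (h₁.val_status hS₁ hv (by decide)) (fun hvS => ?_)
    fun hvS => ?_).mono_time (by simp only [statusE, Expr.cost]; omega)
  · refine (run_removeC h₁ hS₁ hvS hv).mono le_rfl fun s₂ hf₂ ⟨hm₂, h9, h18⟩ =>
      ⟨?_, hm₂.trans hm₁⟩
    have h₂ : HoldsGraph G W s₂ := h₁.of_mem_eq hf₂ rfl rfl hm₂
    exact (Val.and h.one_lt (h₂.val_not (h₂.val_test h9)) (h₂.val_not (h₂.val_test h18))).congr
      (removable_iff.trans (and_iff_right hvS).symm)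
  · refine (Run.seq (K := 2) (L := 2) (P := (· = s₁.set 9 1)) (Run.assign (Val.const h.one_lt) rfl)
      fun s₂ _ hs₂ => ?_).mono_time (by omega)
    subst hs₂
    refine Run.assign (Val.const (by have := h.one_lt; omega)) ⟨?_, hm₁⟩
    have h₂ : HoldsGraph G W ((s₁.set 9 1).set 18 0) := (h₁.set (by decide)).set (by decide)
    have h9 : HoldsTest n ((s₁.set 9 1).set 18 0) 9 True := ⟨by simp; omega, by simp⟩
    have h18 : HoldsTest n ((s₁.set 9 1).set 18 0) 18 False := ⟨by simp, by simp⟩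
    exact (Val.and h.one_lt (h₂.val_not (h₂.val_test h9)) (h₂.val_not (h₂.val_test h18))).congr
      (by simp [hvS])

end Tests

/-! ### Choice of the branching vertex -/

section Selection

variable {n : ℕ} {G : SimpleGraph (Fin n)} {D X : Finset (Fin n)} {v r : Fin n}

theorem gain_le : gain G D v ≤ n :=
  (Finset.card_le_univ _).trans_eq (Fintype.card_fin n)

variable (G) in
/-- The priority of `v` as a branching vertex: the gain, increased by more than every gain if the
inclusion of `v` creates a redundant vertex. -/
noncomputable def score (D : Finset (Fin n)) (v : Fin n) : ℕ :=
  gain G D v + 1 + ind (HasRedundantVertex G (insert v D)) * (n + 1)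

theorem lt_score_iff : n + 1 < score G D v ↔ HasRedundantVertex G (insert v D) := by
  have := gain_le (G := G) (D := D) (v := v)
  by_cases h : HasRedundantVertex G (insert v D)
  · refine iff_of_true ?_ h
    rw [score, ind_true h]
    omega
  · refine iff_of_false ?_ h
    rw [score, ind_false h]
    omega

theorem score_le : score G D v ≤ 2 * n + 2 := by
  have := gain_le (G := G) (D := D) (v := v)
  have := Nat.mul_le_mul_right (n + 1) (ind_le (HasRedundantVertex G (insert v D)))
  unfold score
  omega

variable (G) in
/-- The frontier vertices below `j`, in increasing order. -/
noncomputable def candidates (D X : Finset (Fin n)) (j : ℕ) : List (Fin n) :=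
  ((List.finRange n).take j).filter (· ∈ frontier G D X)

theorem candidates_succ {j : ℕ} (hj : j < n) :
    candidates G D X (j + 1) =
      candidates G D X j ++ if ⟨j, hj⟩ ∈ frontier G D X then [⟨j, hj⟩] else [] := by
  have hget : (List.finRange n)[j]? = some ⟨j, hj⟩ := by simp [hj]
  rw [candidates, List.take_add_one, hget, List.filter_append, candidates]
  simp [List.filter_cons]

theorem mem_candidates_self : v ∈ candidates G D X n ↔ v ∈ frontier G D X := by
  rw [candidates, List.take_of_length_le (by simp)]
  simp

variable (G r) in
/-- The first frontier vertex of largest score, or `r` if there is no frontier vertex. -/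
noncomputable def selectRule (D X : Finset (Fin n)) : Fin n :=
  ((candidates G D X n).argmax (score G D)).getD r

variable (r) in
theorem argmax_candidates (h : (frontier G D X).Nonempty) :
    (candidates G D X n).argmax (score G D) = some (selectRule G r D X) := by
  rw [selectRule]
  obtain ⟨v, hv⟩ := h
  cases ho : (candidates G D X n).argmax (score G D) with
  | none =>
    rw [List.argmax_eq_none] at ho
    simpa [ho] using mem_candidates_self.2 hv
  | some w => rfl

variable (G r) in
theorem isBranchingRule_selectRule : IsBranchingRule G (selectRule G r) := fun D X h => by
  have hmax := argmax_candidates r h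
  set v := selectRule G r D X
  have hle : ∀ u ∈ frontier G D X, score G D u ≤ score G D v := fun u hu =>
    List.le_of_mem_argmax (mem_candidates_self.2 hu) hmax
  refine ⟨mem_candidates_self.1 (List.argmax_mem hmax), or_iff_not_imp_left.2 fun hv => ?_⟩
  have hno : ∀ u ∈ frontier G D X, ¬ HasRedundantVertex G (insert u D) := fun u hu hred =>
    hv (lt_score_iff.1 ((lt_score_iff.2 hred).trans_le (hle u hu)))
  refine ⟨hno, fun u hu => ?_⟩
  have := hle u hu
  simp only [score, ind_false hv, ind_false (hno u hu)] at this
  omega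

variable (G D X) in
/-- Registers `13` and `14` hold the largest score of the frontier vertices below `j` and the
first vertex that has it. The score `0` stands for the absence of frontier vertices. -/
def HoldsBest (j : ℕ) (s : State) : Prop :=
  s.reg 13 = ((candidates G D X j).argmax (score G D)).elim 0 (score G D) ∧
    ∀ v ∈ (candidates G D X j).argmax (score G D), s.reg 14 = v

namespace HoldsBest

variable {j : ℕ} {s s' : State}

theorem congr (h : HoldsBest G D X j s) (h13 : s'.reg 13 = s.reg 13)
    (h14 : s'.reg 14 = s.reg 14) : HoldsBest G D X j s' := by
  rwa [HoldsBest, h13, h14]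

theorem reg_le (h : HoldsBest G D X j s) : s.reg 13 ≤ 2 * n + 2 := by
  rw [h.1]
  cases (candidates G D X j).argmax (score G D) with
  | none => exact Nat.zero_le _
  | some v => exact score_le

theorem reg_eq_zero_iff (h : HoldsBest G D X n s) : s.reg 13 = 0 ↔ frontier G D X = ∅ := by
  rw [h.1]
  refine ⟨fun h0 => ?_, fun hF => ?_⟩
  · by_contra hF
    obtain ⟨v, hv⟩ := Finset.nonempty_iff_ne_empty.2 hF
    rw [argmax_candidates v ⟨v, hv⟩] at h0
    simp [score] at h0
  · have hnil : candidates G D X n = [] :=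
      List.eq_nil_iff_forall_not_mem.2 fun v hv => by simpa [hF] using mem_candidates_self.1 hv
    simp [hnil]

theorem reg_eq_selectRule (h : HoldsBest G D X n s) (hF : (frontier G D X).Nonempty) :
    s.reg 14 = selectRule G r D X := h.2 _ (argmax_candidates r hF)

theorem lt_reg_iff (h : HoldsBest G D X n s) (hF : (frontier G D X).Nonempty) :
    n + 1 < s.reg 13 ↔ HasRedundantVertex G (insert (selectRule G r D X) D) := by
  rw [h.1, argmax_candidates r hF]
  exact lt_score_iff

theorem succ_of_notMem (h : HoldsBest G D X j s) {hj : j < n} (hF : ⟨j, hj⟩ ∉ frontier G D X) :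
    HoldsBest G D X (j + 1) s := by
  rwa [HoldsBest, candidates_succ hj, if_neg hF, List.append_nil]

theorem succ_of_lt (h : HoldsBest G D X j s) (hv : v ∈ frontier G D X) (hj : (v : ℕ) = j)
    (hlt : s.reg 13 < score G D v) (h13 : s'.reg 13 = score G D v) (h14 : s'.reg 14 = v) :
    HoldsBest G D X (j + 1) s' := by
  subst hj
  rw [h.1] at hlt
  rw [HoldsBest, candidates_succ v.2, if_pos hv, List.argmax_concat]
  cases ho : (candidates G D X v).argmax (score G D) <;> rw [ho] at hlt <;> simp_all

theorem succ_of_not_lt (h : HoldsBest G D X j s) (hv : v ∈ frontier G D X) (hj : (v : ℕ) = j)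
    (hlt : ¬ s.reg 13 < score G D v) : HoldsBest G D X (j + 1) s := by
  subst hj
  rw [h.1] at hlt
  rw [HoldsBest, candidates_succ v.2, if_pos hv, List.argmax_concat]
  cases ho : (candidates G D X v).argmax (score G D) with
  | none => simp [ho, score] at hlt
  | some w =>
    have hlt' : ¬ score G D w < score G D v := by simpa [ho] using hlt
    simpa [HoldsBest, ho, hlt'] using h

end HoldsBest

end Selection

/-! ### Programs for a node of the search tree -/

/-- Register `15` receives the score of the vertex in register `4`. -/
def scoreC : Cmd :=
  .seq (sumN 15 5 (.mul (adjE 4 5) (notE (memE 3 5))))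
    (.seq (withStatusC 4 1 0 redundantC)
      (.assign 15 (.add (.add (.reg 15) (.const 1))
        (.mul (testE 12) (.add (.reg 0) (.const 1))))))

/-- Replace the best score and its vertex by the current ones if the current score is larger. -/
def updateC : Cmd :=
  .ite (.lt (.reg 13) (.reg 15)) (.seq (.assign 13 (.reg 15)) (.assign 14 (.reg 4))) .skip

/-- Registers `13` and `14` receive the largest score of a frontier vertex and this vertex. -/
def selectC : Cmd :=
  .seq (.assign 13 (.const 0))
    (forN 4 (.ite (.mul (statusE 4 0) (memE 3 4)) (.seq scoreC updateC) .skip))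

/-- All tests at a node of the search tree. -/
def nodeC : Cmd :=
  .seq domC (.seq deadC (.seq selectC (.seq (anyC 17 (notE (memE 3 5)))
    (anyC 16 (.mul (statusE 5 1) (.lt (.reg 5) (.reg 1)))))))

section Node

variable {n W : ℕ} {G : SimpleGraph (Fin n)} {s s' : State} {D X : Finset (Fin n)}
  {v r : Fin n}

variable (n) in
/-- The status array represents the state `(D, X)` of the search. -/
def HoldsState (D X : Finset (Fin n)) (s : State) : Prop :=
  ∀ i : Fin n, s.mem 1 i = if i ∈ D then 1 else if i ∈ X then 2 else 0

namespace HoldsState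

theorem of_mem_eq (h : HoldsState n D X s) (hm : s'.mem 1 = s.mem 1) : HoldsState n D X s' :=
  fun i => by rw [hm, h i]

theorem chosen (h : HoldsState n D X s) : HoldsClass s 1 D := fun i => by
  rw [h i]
  split_ifs <;> simp_all

theorem excluded (h : HoldsState n D X s) (hDX : Disjoint D X) : HoldsClass s 2 X := fun i => by
  have : i ∈ D → i ∉ X := fun hi => Finset.disjoint_left.1 hDX hi
  rw [h i]
  split_ifs <;> simp_all

theorem undecided (h : HoldsState n D X s) : HoldsClass s 0 (D ∪ X)ᶜ := fun i => by
  rw [h i]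
  split_ifs <;> simp_all

end HoldsState

theorem run_scoreC (h : HoldsGraph G W s) (hD : HoldsClass s 1 D)
    (hdom : HoldsSet s 3 (closedNbhd G D)) (hr : s.reg 4 = v) (hv : s.mem 1 v = 0) :
    Run W scoreC (680 * (n + 1) ^ 4) s
      fun s' => s'.mem 1 = s.mem 1 ∧ s'.reg 15 = score G D v := by
  have hgain : count (fun i => G.Adj v i ∧ i ∉ closedNbhd G D) = gain G D v := by
    classical
    rw [count_eq_card, gain]
    congr 1
    ext i
    simp [mem_undominatedNbrs, mem_undominated, and_comm]
  have h1 : n + 1 ≤ (n + 1) ^ 4 := Nat.le_self_pow (by decide) _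
  refine ((Run.sumN (k := 39) (fun i => G.Adj v i ∧ i ∉ closedNbhd G D) h.add_two_le (by decide)
    (by decide) (by decide) h.size rfl (by decide) fun i => ?_).seq
      (L := 600 * (n + 1) ^ 4 + 6 + 14) fun s₁ hf₁ h15 => ?_).mono_time (by omega)
  · have h' : HoldsGraph G W (s.set 5 i) := h.set (by decide)
    exact Val.and h.one_lt (h'.val_adj (by simpa using hr) (by simp))
      (h'.val_not (h'.val_mem hdom (by simp)))
  have h₁ : HoldsGraph G W s₁ := h.frame hf₁ rfl rfl rfl
  have hm₁ : s₁.mem 1 = s.mem 1 := hf₁.mem 1 rfl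
  have hred := run_redundantC (h₁.put (l := v) (by decide)) (hD.of_mem_eq hm₁).put_insert
  refine (h₁.run_withStatusC (k := 1) ((hf₁.reg 4 rfl).trans hr) (by decide) (by decide)
    (by rw [hm₁, hv]) rfl hred fun s' hs' => hs').seq fun s₂ hf₂ ⟨hm₂, h12⟩ => ?_
  have h₂ : HoldsGraph G W s₂ := h₁.of_mem_eq hf₂ rfl rfl hm₂
  have hg := gain_le (G := G) (D := D) (v := v)
  have hi := Nat.mul_le_mul_right (n + 1) (ind_le (HasRedundantVertex G (insert v D)))
  have hb := h.bound
  have h15₂ : s₂.reg 15 = gain G D v := by rw [hf₂.reg 15 rfl, h15, hgain]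
  have hscore : Val W s₂ (.add (.add (.reg 15) (.const 1))
      (.mul (testE 12) (.add (.reg 0) (.const 1)))) (score G D v) :=
    Val.add (Val.add (Val.reg h15₂ (by omega)) (Val.const (by omega)) (by omega))
      (Val.mul (h₂.val_test h12) (Val.add (Val.reg h₂.size (by omega)) (Val.const (by omega))
        (by omega)) (by omega)) (by omega)
  refine (Run.assign hscore ?_).mono_time (by decide)
  exact ⟨hm₂.trans hm₁, by simp⟩

theorem run_updateC (h : HoldsGraph G W s) (hbest : HoldsBest G D X v s)
    (hr : s.reg 4 = v) (hv : v ∈ frontier G D X) (h15 : s.reg 15 = score G D v) :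
    Run W updateC 10 s fun s' => s'.mem 1 = s.mem 1 ∧ HoldsBest G D X (v + 1) s' := by
  have hb := h.bound
  have hle := hbest.reg_le
  have hle15 := score_le (G := G) (D := D) (v := v)
  have hlast : Val W s (.reg 13) (s.reg 13) := Val.reg rfl (by omega)
  refine (Run.ite (K := 4) (Val.lt h.one_lt hlast (Val.reg h15 (by omega)))
    (fun hlt => ?_) fun hlt => ?_).mono_time (by decide)
  · refine Run.seq (K := 2) (L := 2) (P := (· = s.set 13 (score G D v)))
      (Run.assign (Val.reg h15 (by omega)) rfl) fun s₁ _ hs₁ => ?_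
    subst hs₁
    have h4 : Val W (s.set 13 (score G D v)) (.reg 4) v := Val.reg (by simpa) (by omega)
    exact Run.assign h4 ⟨rfl, hbest.succ_of_lt hv rfl hlt (by simp) (by simp)⟩
  · exact (Run.skip ⟨rfl, hbest.succ_of_not_lt hv rfl hlt⟩).mono_time (by decide)

theorem run_selectC (h : HoldsGraph G W s) (hst : HoldsState n D X s)
    (hdom : HoldsSet s 3 (closedNbhd G D)) :
    Run W selectC (800 * (n + 1) ^ 5) s
      fun s' => s'.mem 1 = s.mem 1 ∧ HoldsBest G D X n s' := by
  have h4 : 1 ≤ (n + 1) ^ 4 := Nat.one_le_pow _ _ (by omega)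
  refine (Run.seq (K := 2) (L := (680 * (n + 1) ^ 4 + 10 + 10 + 12) * (n + 1))
    (P := (· = s.set 13 0)) (Run.assign (Val.const (by have := h.one_lt; omega)) rfl)
    fun s₁ _ hs₁ => ?_).mono_time (by nlinarith)
  subst hs₁
  refine Run.forN (fun j s' => s'.mem 1 = s.mem 1 ∧ HoldsBest G D X j s') h.add_two_le (by decide)
    rfl rfl h.size ⟨rfl, by simp [HoldsBest, candidates]⟩ ?_
  rintro j hj s₁ hf₁ (hij : s₁.reg 4 = (⟨j, hj⟩ : Fin n)) ⟨hm₁, hbest⟩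
  have h₁ : HoldsGraph G W s₁ := (h.set (by decide)).of_mem_eq hf₁ rfl rfl hm₁
  have hst₁ : HoldsState n D X s₁ := hst.of_mem_eq hm₁
  have hdom₁ : HoldsSet s₁ 3 (closedNbhd G D) := fun i => by rw [hf₁.mem 3 rfl]; exact hdom i
  refine (Run.ite (K := 680 * (n + 1) ^ 4 + 10) (Val.and h.one_lt
    (h₁.val_status hst₁.undecided hij (by decide)) (h₁.val_mem hdom₁ hij))
    (fun ⟨hund, hnbr⟩ => ?_) fun hno => ?_).mono_time
      (by simp only [statusE, memE, Expr.cost]; omega)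
  · have hF : ⟨j, hj⟩ ∈ frontier G D X := mem_frontier.2 ⟨hnbr, by simpa using hund⟩
    refine (run_scoreC h₁ hst₁.chosen hdom₁ hij ((hst₁.undecided _).2 hund)).seq
      fun s₂ hf₂ ⟨hm₂, h15⟩ => ?_
    exact (run_updateC (h₁.of_mem_eq hf₂ rfl rfl hm₂)
      (hbest.congr (hf₂.reg 13 rfl) (hf₂.reg 14 rfl)) ((hf₂.reg 4 rfl).trans hij) hF h15).mono
      le_rfl fun s₃ _ ⟨hm₃, hbest₃⟩ => ⟨hm₃.trans (hm₂.trans hm₁), hbest₃.congr rfl rfl⟩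
  · have hF : ⟨j, hj⟩ ∉ frontier G D X := fun hF => hno
      ⟨by simpa using (mem_frontier.1 hF).2, (mem_frontier.1 hF).1⟩
    exact (Run.skip ⟨hm₁, (hbest.succ_of_notMem hF).congr rfl rfl⟩).mono_time (by omega)

variable (G) in
/-- The results of the tests at the state `(D, X)` of the search from the vertex `r`. -/
structure NodeResult (r : Fin n) (D X : Finset (Fin n)) (s : State) : Prop where
  dead : HoldsTest n s 11 (IsDead G D X)
  best : HoldsBest G D X n s
  undominated : HoldsTest n s 17 (undominated G D ≠ ∅)
  first : HoldsTest n s 16 (∃ i ∈ D, i < r)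

theorem run_nodeC (h : HoldsGraph G W s) (hst : HoldsState n D X s) (hDX : Disjoint D X)
    (hr : s.reg 1 = r) :
    Run W nodeC (1200 * (n + 1) ^ 5) s fun s' => s'.mem 1 = s.mem 1 ∧ NodeResult G r D X s' := by
  have h2 : (n + 1) ^ 2 ≤ (n + 1) ^ 5 := Nat.pow_le_pow_right (by omega) (by decide)
  have h1 : n + 1 ≤ (n + 1) ^ 5 := Nat.le_self_pow (by decide) _
  refine ((run_domC h hst.chosen).seq (L := 110 * (n + 1) ^ 2 + (800 * (n + 1) ^ 5 +
    (60 * (n + 1) + 60 * (n + 1)))) fun s₁ hf₁ hdom₁ => ?_).mono_time (by omega)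
  have h₁ : HoldsGraph G W s₁ := h.frame hf₁ rfl rfl rfl
  have hst₁ : HoldsState n D X s₁ := hst.of_mem_eq (hf₁.mem 1 rfl)
  refine (run_deadC h₁ (hst₁.excluded hDX) hdom₁).seq fun s₂ hf₂ hdead => ?_
  have h₂ : HoldsGraph G W s₂ := h₁.frame hf₂ rfl rfl rfl
  have hdom₂ : HoldsSet s₂ 3 (closedNbhd G D) := hdom₁.frame hf₂ rfl
  refine (run_selectC h₂ (hst₁.of_mem_eq (hf₂.mem 1 rfl)) hdom₂).seq
    fun s₃ hf₃ ⟨hm₃, hbest⟩ => ?_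
  have h₃ : HoldsGraph G W s₃ := h₂.of_mem_eq hf₃ rfl rfl hm₃
  have hdom₃ : HoldsSet s₃ 3 (closedNbhd G D) := hdom₂.frame hf₃ rfl
  have hms₃ : s₃.mem 1 = s.mem 1 := by rw [hm₃, hf₂.mem 1 rfl, hf₁.mem 1 rfl]
  refine (h₃.run_anyC (fun i => i ∉ closedNbhd G D) (by decide) (by decide) rfl (by decide)
    fun i => ?_).seq fun s₄ hf₄ h17 => ?_
  · have h' : HoldsGraph G W (s₃.set 5 i) := h₃.set (by decide)
    exact h'.val_not (h'.val_mem hdom₃ (by simp))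
  have h₄ : HoldsGraph G W s₄ := h₃.frame hf₄ rfl rfl rfl
  have hms₄ : s₄.mem 1 = s.mem 1 := (hf₄.mem 1 rfl).trans hms₃
  have hD₄ : HoldsClass s₄ 1 D := (hst.of_mem_eq hms₄).chosen
  have hr₄ : s₄.reg 1 = r := by
    rw [hf₄.reg 1 rfl, hf₃.reg 1 rfl, hf₂.reg 1 rfl, hf₁.reg 1 rfl, hr]
  refine (h₄.run_anyC (fun i => i ∈ D ∧ i < r) (by decide) (by decide) rfl (by decide)
    fun i => ?_).mono le_rfl fun s₅ hf₅ h16 => ⟨(hf₅.mem 1 rfl).trans hms₄,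
      ((hdead.frame hf₃ rfl).frame hf₄ rfl).frame hf₅ rfl,
      (hbest.congr (hf₄.reg 13 rfl) (hf₄.reg 14 rfl)).congr (hf₅.reg 13 rfl) (hf₅.reg 14 rfl),
      (h17.frame hf₅ rfl).congr ?_, h16⟩
  · have h' : HoldsGraph G W (s₄.set 5 i) := h₄.set (by decide)
    exact Val.and h.one_lt (h'.val_status hD₄ (by simp) (by decide))
      (h'.val_lt (by simp) (by simpa using hr₄))
  · simp [← Finset.nonempty_iff_ne_empty, Finset.Nonempty, mem_undominated]

end Node

end CDSEnum

namespace WordRAM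

/-- The loop `while e c` comes from the state `s`, within `K` time units, back to the evaluation of
its condition in some state that satisfies `P`. The continuation-passing form dispenses with a
semantics of unfinished loops. -/
def LoopsTo (W : ℕ) (e : Expr) (c : Cmd) (K : ℕ) (s : State) (P : State → Prop) : Prop :=
  ∀ L Q, (∀ s', P s' → Run W (.while e c) L s' Q) → Run W (.while e c) (K + L) s Q

namespace LoopsTo

variable {W K L : ℕ} {e : Expr} {c : Cmd} {s : State} {P Q : State → Prop}

theorem of_run {v : ℕ} (he : Val W s e v) (hv : v ≠ 0) (hc : Run W c K s P) :
    LoopsTo W e c (e.cost + 1 + K) s P := fun L Q hQ => by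
  obtain ⟨hfits, rfl⟩ := he
  obtain ⟨t, s', ht, hx, hp⟩ := hc
  obtain ⟨t', s'', ht', hx', hq⟩ := hQ s' hp
  exact ⟨_, s'', by omega, .whileTrue e c s s' s'' t t' hfits hv hx hx', hq⟩

theorem trans (h : LoopsTo W e c K s P) (h' : ∀ s', P s' → LoopsTo W e c L s' Q) :
    LoopsTo W e c (K + L) s Q := fun M R hR => by
  rw [add_assoc]
  exact h _ _ fun s' hs' => h' s' hs' M R hR

theorem mono_time (h : LoopsTo W e c K s P) (hK : K ≤ L) : LoopsTo W e c L s P :=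
  fun M R hR => (h M R hR).mono_time (by omega)

theorem run (h : LoopsTo W e c K s P) (hP : ∀ s', P s' → Val W s' e 0) :
    Run W (.while e c) (K + (e.cost + 1)) s P :=
  h _ _ fun s' hs' => ⟨_, s', le_rfl, .whileFalse e c s' (hP s' hs').1 (hP s' hs').2, hs'⟩

end LoopsTo

end WordRAM

namespace CDSEnum

open WordRAM

/-! ### The depth-first traversal of the search tree -/

/-- Push the branching vertex in register `14` on the stack in array `2`, whose height is in
register `2`, and go to the first child. -/
def pushC : Cmd :=
  .seq (.store 2 (.reg 2) (.reg 14)) (.seq (.assign 2 (.add (.reg 2) (.const 1)))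
    (.ite (.lt (.add (.reg 0) (.const 1)) (.reg 13)) (.store 1 (.reg 14) (.const 2))
      (.store 1 (.reg 14) (.const 1))))

/-- Write the characteristic vector of the vertices of status `1`. -/
def writeC : Cmd := forN 5 (.output (statusE 5 1))

/-- Write the set of a leaf if it has to be listed, and start to backtrack. -/
def leafC : Cmd :=
  .seq (.ite (.mul (.mul (notE (testE 11)) (notE (testE 17))) (notE (testE 16))) writeC .skip)
    (.assign 3 (.const 2))

/-- Visit a node: go to its first child or treat it as a leaf. -/
def visitC : Cmd := .seq nodeC (.ite (.mul (notE (testE 11)) (testE 13)) pushC leafC)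

/-- Go from the first child, which includes the vertex in register `9`, to the second one. -/
def excludeC : Cmd := .seq (.store 1 (.reg 9) (.const 2)) (.assign 3 (.const 1))

/-- Go from the second child, which excludes the vertex in register `9`, to the parent. -/
def retreatC : Cmd :=
  .seq (.store 1 (.reg 9) (.const 0)) (.assign 2 (.sub (.reg 2) (.const 1)))

/-- Backtrack, or finish the traversal at the root. -/
def popC : Cmd :=
  .ite (.eq (.reg 2) (.const 0)) (.assign 3 (.const 0))
    (.seq (.assign 9 (.read 2 (.sub (.reg 2) (.const 1)))) (.ite (statusE 9 1) excludeC retreatC))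

/-- One move of the traversal: visit a new node if register `3` holds `1`, else backtrack. -/
def moveC : Cmd := .ite (.eq (.reg 3) (.const 1)) visitC popC

section Search

variable {n : ℕ} {G : SimpleGraph (Fin n)} {W m k : ℕ} {s s' : State} {c : Cmd}
  {D X D' X' : Finset (Fin n)} {r v : Fin n} {l : List (Fin n)} {o o' : List ℕ}

theorem HoldsGraph.put_of_ne (h : HoldsGraph G W s) {a i : ℕ} (h0 : 0 ≠ a) (h1 : 1 ≠ a) :
    HoldsGraph G W (s.put a i k) :=
  ⟨h.bound, h.size, by rw [State.put_mem_ne _ _ _ h0]; exact h.adj,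
    by rw [State.put_mem_ne _ _ _ h1]; exact h.status_le⟩

theorem HoldsState.put (h : HoldsState n D X s)
    (hne : ∀ i, i ≠ v → (i ∈ D' ↔ i ∈ D) ∧ (i ∈ X' ↔ i ∈ X))
    (hk : k = if v ∈ D' then 1 else if v ∈ X' then 2 else 0) :
    HoldsState n D' X' (s.put 1 v k) := fun i => by
  rw [State.put_mem]
  obtain rfl | hi := eq_or_ne i v
  · simpa using hk
  · obtain ⟨hD, hX⟩ := hne i hi
    rw [if_neg fun h => hi (Fin.ext h.2), h i]
    simp only [hD, hX]

/-- The stack holds the vertices of the list, its head on top. -/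
def HoldsStack (s : State) : List (Fin n) → Prop
  | [] => True
  | v :: l => s.mem 2 l.length = v ∧ HoldsStack s l

theorem HoldsStack.congr (hs : HoldsStack s l) (h : ∀ i < l.length, s'.mem 2 i = s.mem 2 i) :
    HoldsStack s' l := by
  induction l with
  | nil => trivial
  | cons v l ih =>
    simp only [List.length_cons] at h
    exact ⟨(h _ (by omega)).trans hs.1, ih hs.2 fun i hi => h i (by omega)⟩

variable (G W) in
/-- The traversal from the root `r` is at the node `(D, X)` and has written the output `o`. The
stack `l` holds the branching vertices above the node, and the mode `m` is `1` if the node is to be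
visited next, `2` if the subtree at the node has been traversed, and `0` if all is done. -/
structure IsAt (r : Fin n) (D X : Finset (Fin n)) (l : List (Fin n)) (m : ℕ) (o : List ℕ)
    (s : State) : Prop where
  graph : HoldsGraph G W s
  state : HoldsState n D X s
  root : s.reg 1 = r
  height : s.reg 2 = l.length
  mode : s.reg 3 = m
  stack : HoldsStack s l
  out : s.out = o

namespace IsAt

theorem frame (h : IsAt G W r D X l m o s) (hf : Frame c s s')
    (hreg : ∀ x < 4, c.wreg x = false) (hmem0 : c.wmem 0 = false) (hmem2 : c.wmem 2 = false)
    (hm : s'.mem 1 = s.mem 1) (ho : s'.out = o') : IsAt G W r D X l m o' s' where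
  graph := h.graph.of_mem_eq hf (hreg 0 (by decide)) hmem0 hm
  state := h.state.of_mem_eq hm
  root := (hf.reg 1 (hreg 1 (by decide))).trans h.root
  height := (hf.reg 2 (hreg 2 (by decide))).trans h.height
  mode := (hf.reg 3 (hreg 3 (by decide))).trans h.mode
  stack := h.stack.congr fun i _ => by rw [hf.mem 2 hmem2]
  out := ho

theorem set (h : IsAt G W r D X l m o s) {x : ℕ} (hx : 3 < x) :
    IsAt G W r D X l m o (s.set x k) := by
  obtain ⟨hg, hst, h1, h2, h3, hstk, ho⟩ := h
  refine ⟨hg.set (by omega), hst, ?_, ?_, ?_, hstk.congr fun _ _ => rfl, ho⟩ <;>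
    rwa [State.set_reg, if_neg (by omega)]

theorem set_mode (h : IsAt G W r D X l m o s) : IsAt G W r D X l k o (s.set 3 k) :=
  ⟨h.graph.set (by decide), h.state, by simpa using h.root, by simpa using h.height, by simp,
    h.stack.congr fun _ _ => rfl, h.out⟩

theorem put_status (h : IsAt G W r D X l m o s) (hk : k ≤ 2)
    (hne : ∀ i, i ≠ v → (i ∈ D' ↔ i ∈ D) ∧ (i ∈ X' ↔ i ∈ X))
    (hv : k = if v ∈ D' then 1 else if v ∈ X' then 2 else 0) :
    IsAt G W r D' X' l m o (s.put 1 v k) :=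
  ⟨h.graph.put hk, h.state.put hne hv, h.root, h.height, h.mode,
    h.stack.congr fun _ _ => congrFun (State.put_mem_ne s _ _ (by decide : (2 : ℕ) ≠ 1)) _, h.out⟩

theorem push (h : IsAt G W r D X l m o s) :
    IsAt G W r D X (v :: l) m o ((s.put 2 l.length v).set 2 (l.length + 1)) where
  graph := (h.graph.put_of_ne (by decide) (by decide)).set (by decide)
  state := h.state.of_mem_eq (State.put_mem_ne s l.length v (by decide : (1 : ℕ) ≠ 2))
  root := by simpa using h.root
  height := by simp
  mode := by simpa using h.mode
  stack := ⟨by simp [State.put_mem], h.stack.congr fun i hi => by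
    rw [State.set_mem, State.put_mem, if_neg fun h => hi.ne h.2]⟩
  out := h.out

theorem pop (h : IsAt G W r D X (v :: l) m o s) : IsAt G W r D X l m o (s.set 2 l.length) :=
  ⟨h.graph.set (by decide), h.state, by simpa using h.root, by simp, by simpa using h.mode,
    h.stack.2.congr fun _ _ => rfl, h.out⟩

end IsAt

theorem run_pushC (h : IsAt G W r D X l m o s) (hn : NodeResult G r D X s)
    (hF : (frontier G D X).Nonempty) (hl : l.length < n) :
    Run W pushC 20 s fun s' =>
      (HasRedundantVertex G (insert (selectRule G r D X) D) →
        IsAt G W r D (insert (selectRule G r D X) X) (selectRule G r D X :: l) m o s') ∧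
      (¬ HasRedundantVertex G (insert (selectRule G r D X) D) →
        IsAt G W r (insert (selectRule G r D X) D) X (selectRule G r D X :: l) m o s') := by
  have hb := h.graph.bound
  have hle := hn.best.reg_le
  have hred := hn.best.lt_reg_iff (r := r) hF
  have h14 := hn.best.reg_eq_selectRule (r := r) hF
  have hv := (mem_frontier.1 (isBranchingRule_selectRule G r D X hF).1).2
  generalize selectRule G r D X = v at *
  have hheight : Val W s (.reg 2) l.length := Val.reg h.height (by omega)
  refine (Run.seq (K := 3) (L := 4 + 9) (P := (· = s.put 2 l.length v))
    (Run.store hheight (h.graph.val_vertex h14) rfl) fun s₁ _ hs₁ => ?_).mono_time (by decide)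
  subst hs₁
  refine Run.seq (K := 4) (P := (· = (s.put 2 l.length v).set 2 (l.length + 1)))
    (Run.assign (Val.add (Val.reg h.height (by omega)) (Val.const (by omega)) (by omega)) rfl)
    fun s₁ _ hs₁ => ?_
  have h₁ : IsAt G W r D X (v :: l) m o s₁ := hs₁ ▸ h.push
  have hlast : s₁.reg 13 = s.reg 13 := by simp [hs₁]
  have hvertex : Val W s₁ (.reg 14) v := h₁.graph.val_vertex (by simp [hs₁, h14])
  have hguard : Val W s₁ (.lt (.add (.reg 0) (.const 1)) (.reg 13))
      (ind (n + 1 < s.reg 13)) :=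
    Val.lt (by omega) (Val.add (Val.reg h₁.graph.size (by omega)) (Val.const (by omega))
      (by omega)) (Val.reg hlast (by omega))
  refine Run.ite (K := 3) (hguard.congr hred) (fun hyes => ?_) fun hno => ?_
  · exact Run.store hvertex (Val.const (by omega)) ⟨fun _ => h₁.put_status le_rfl
      (fun i hi => by simp [hi]) (by simp_all), fun hno => absurd hyes hno⟩
  · exact Run.store hvertex (Val.const (by omega)) ⟨fun hyes => absurd hyes hno, fun _ =>
      h₁.put_status (by decide) (fun i hi => by simp [hi]) (by simp)⟩

theorem run_writeC (h : HoldsGraph G W s) (hD : HoldsClass s 1 D) :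
    Run W writeC (17 * (n + 1)) s
      fun s' => s'.mem 1 = s.mem 1 ∧ s'.out = s.out ++ charVector D := by
  refine (Run.forN (K := 5) (fun j s' => s'.out = s.out ++ (charVector D).take j)
    h.add_two_le (by decide) rfl rfl h.size (by simp) fun j hj s' hf hij ho => ?_).mono le_rfl
    fun s' hf ho => ⟨hf.mem 1 rfl, ?_⟩
  · have h' : HoldsGraph G W s' := h.frame hf rfl rfl rfl
    have hvec : (charVector D)[j]? = some (ind (⟨j, hj⟩ ∈ D)) := by
      simp [charVector, hj, ind]
    refine Run.output (h'.val_status (hD.frame hf rfl) (i := ⟨j, hj⟩) hij (by decide)) ?_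
    simp only [State.set_out, ho, List.take_add_one, hvec, Option.toList_some, List.append_assoc]
  · rw [ho, List.take_of_length_le (by simp [charVector])]

open Classical in
theorem run_leafC (h : IsAt G W r D X l m o s) (hn : NodeResult G r D X s) :
    Run W leafC (17 * (n + 1) + 20) s (IsAt G W r D X l 2
      (o ++ if ¬ IsDead G D X ∧ undominated G D = ∅ ∧ ∀ i ∈ D, r ≤ i then charVector D
        else [])) := by
  have hlisted : Val W s (.mul (.mul (notE (testE 11)) (notE (testE 17))) (notE (testE 16)))
      (ind (¬ IsDead G D X ∧ undominated G D = ∅ ∧ ∀ i ∈ D, r ≤ i)) :=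
    (Val.and h.graph.one_lt (Val.and h.graph.one_lt
      (h.graph.val_not (h.graph.val_test hn.dead))
      (h.graph.val_not (h.graph.val_test hn.undominated)))
      (h.graph.val_not (h.graph.val_test hn.first))).congr (by push Not; exact and_assoc)
  refine ((Run.ite (K := 17 * (n + 1)) (Q := fun s' => s'.mem 1 = s.mem 1 ∧ s'.out = o ++ _)
    hlisted (fun hyes => ?_) fun hno => ?_).seq (L := 2) fun s₁ hf₁ ⟨hm₁, ho₁⟩ =>
      Run.assign (Val.const (by have := h.graph.bound; omega))
        (h.frame hf₁ (by decide) rfl rfl hm₁ ho₁).set_mode).mono_time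
          (by simp only [testE, notE, Expr.cost]; omega)
  · rw [if_pos hyes, ← h.out]
    exact run_writeC h.graph h.state.chosen
  · rw [if_neg hno, ← h.out]
    exact (Run.skip ⟨rfl, (List.append_nil _).symm⟩).mono_time (by omega)

theorem run_visitC {Q : State → Prop} (h : IsAt G W r D X l m o s) (hDX : Disjoint D X)
    (hpush : ∀ s', IsAt G W r D X l m o s' → NodeResult G r D X s' → ¬ IsDead G D X →
      (frontier G D X).Nonempty → Run W pushC 20 s' Q)
    (hleaf : ∀ s', IsAt G W r D X l m o s' → NodeResult G r D X s' →
      IsDead G D X ∨ frontier G D X = ∅ → Run W leafC (17 * (n + 1) + 20) s' Q) :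
    Run W visitC (1300 * (n + 1) ^ 5) s Q := by
  have h1 : n + 1 ≤ (n + 1) ^ 5 := Nat.le_self_pow (by decide) _
  refine ((run_nodeC h.graph h.state hDX h.root).seq (L := 10 + (17 * (n + 1) + 20))
    fun s₁ hf₁ ⟨hm₁, hn⟩ => ?_).mono_time (by omega)
  have h₁ : IsAt G W r D X l m o s₁ :=
    h.frame hf₁ (by decide) rfl rfl hm₁ ((hf₁.out rfl).trans h.out)
  have hb := h.graph.bound
  have hle := hn.best.reg_le
  have hfrontier : Val W s₁ (testE 13) (ind (frontier G D X).Nonempty) := by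
    refine (Val.lt h.graph.one_lt (Val.const (by omega)) (Val.reg rfl (by omega))).congr ?_
    rw [Nat.pos_iff_ne_zero, ne_eq, hn.best.reg_eq_zero_iff, Finset.nonempty_iff_ne_empty]
  refine Run.ite (Val.and h.graph.one_lt (h₁.graph.val_not (h₁.graph.val_test hn.dead)) hfrontier)
    (fun ⟨hlive, hF⟩ => (hpush s₁ h₁ hn hlive hF).mono_time (by omega))
    fun hno => hleaf s₁ h₁ hn ?_
  rwa [not_and_or, not_not, Finset.not_nonempty_iff_eq_empty] at hno

theorem run_popC {Q : State → Prop} (h : IsAt G W r D X (v :: l) m o s) (hl : l.length < n)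
    (hexclude : ∀ s', IsAt G W r D X (v :: l) m o s' → s'.reg 9 = v → v ∈ D →
      Run W excludeC 7 s' Q)
    (hretreat : ∀ s', IsAt G W r D X (v :: l) m o s' → s'.reg 9 = v → v ∉ D →
      Run W retreatC 7 s' Q) :
    Run W popC 21 s Q := by
  have hb := h.graph.bound
  have hheight : Val W s (.reg 2) (l.length + 1) := Val.reg h.height (by omega)
  have htop : Val W s (.read 2 (.sub (.reg 2) (.const 1))) v :=
    Val.read (Val.sub hheight (Val.const h.graph.one_lt)) h.stack.1 (by omega)
  refine Run.ite (K := 5 + 12) (Val.eq h.graph.one_lt hheight (Val.const (by omega)))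
    (fun h0 => absurd h0 (by omega)) fun _ => ?_
  refine Run.seq (K := 5) (P := (· = s.set 9 v)) (Run.assign htop rfl) fun s₁ _ hs₁ => ?_
  have h₁ : IsAt G W r D X (v :: l) m o s₁ := hs₁ ▸ h.set (by decide)
  have h9 : s₁.reg 9 = v := by simp [hs₁]
  exact Run.ite (K := 7) (h₁.graph.val_status h₁.state.chosen h9 (by decide))
    (hexclude s₁ h₁ h9) (hretreat s₁ h₁ h9)

theorem run_excludeC (h : IsAt G W r (insert v D) X l m o s) (hv : v ∉ D) (h9 : s.reg 9 = v) :
    Run W excludeC 5 s (IsAt G W r D (insert v X) l 1 o) := by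
  have hb := h.graph.bound
  refine Run.seq (K := 3) (L := 2) (Run.store (h.graph.val_vertex h9) (Val.const (by omega))
    (h.put_status (D' := D) (X' := insert v X) le_rfl ?_ (by simp [hv])))
    fun s₁ _ h₁ => Run.assign (Val.const h.graph.one_lt) h₁.set_mode
  simp +contextual

theorem run_retreatC (h : IsAt G W r D (insert v X) (v :: l) m o s) (hD : v ∉ D) (hX : v ∉ X)
    (hl : l.length < n) (h9 : s.reg 9 = v) :
    Run W retreatC 7 s (IsAt G W r D X l m o) := by
  have hb := h.graph.bound
  refine Run.seq (K := 3) (L := 4) (Run.store (h.graph.val_vertex h9) (Val.const (by omega))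
    (h.put_status (D' := D) (X' := X) (by decide) ?_ (by simp [hD, hX])))
    fun s₁ _ h₁ => Run.assign (v := l.length) ?_ h₁.pop
  · simp +contextual
  · exact Val.sub (Val.reg h₁.height (by simp; omega)) (Val.const h.graph.one_lt)

theorem loopsTo_of_visitC {Q : State → Prop} (h : IsAt G W r D X l 1 o s)
    (hQ : Run W visitC (1300 * (n + 1) ^ 5) s Q) :
    LoopsTo W (.reg 3) moveC (1400 * (n + 1) ^ 5) s Q := by
  have h1 : 1 ≤ (n + 1) ^ 5 := Nat.one_le_pow _ _ (by omega)
  have hmode : Val W s (.reg 3) 1 := Val.reg h.mode h.graph.one_lt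
  exact (LoopsTo.of_run hmode (by decide) (Run.ite
    (Val.eq h.graph.one_lt hmode (Val.const h.graph.one_lt)) (fun _ => hQ)
    fun hne => absurd rfl hne)).mono_time (by simp only [Expr.cost]; omega)

theorem loopsTo_of_popC {Q : State → Prop} (h : IsAt G W r D X l 2 o s)
    (hQ : Run W popC 21 s Q) : LoopsTo W (.reg 3) moveC (1400 * (n + 1) ^ 5) s Q := by
  have hb := h.graph.bound
  have h1 : 1 ≤ (n + 1) ^ 5 := Nat.one_le_pow _ _ (by omega)
  have hmode : Val W s (.reg 3) 2 := Val.reg h.mode (by omega)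
  exact (LoopsTo.of_run hmode (by decide) (Run.ite
    (Val.eq h.graph.one_lt hmode (Val.const h.graph.one_lt)) (fun heq => absurd heq (by decide))
    fun _ => hQ)).mono_time (by simp only [Expr.cost]; omega)

theorem loopsTo_finish (h : IsAt G W r D X [] 2 o s) :
    LoopsTo W (.reg 3) moveC (1400 * (n + 1) ^ 5) s (IsAt G W r D X [] 0 o) := by
  have h0 : 0 < W := by have := h.graph.one_lt; omega
  refine loopsTo_of_popC h ((Run.ite (K := 2)
    (Val.eq h.graph.one_lt (Val.reg h.height h0) (Val.const h0)) (fun _ => ?_)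
    fun hne => absurd rfl hne).mono_time (by decide))
  exact Run.assign (Val.const h0) h.set_mode

theorem loopsTo_exclude (h : IsAt G W r (insert v D) X (v :: l) 2 o s) (hv : v ∉ D)
    (hl : l.length < n) : LoopsTo W (.reg 3) moveC (1400 * (n + 1) ^ 5) s
      (IsAt G W r D (insert v X) (v :: l) 1 o) :=
  loopsTo_of_popC h (run_popC h hl
    (fun _ h' h9 _ => (run_excludeC h' hv h9).mono_time (by decide))
    fun _ _ _ hno => absurd (Finset.mem_insert_self v D) hno)

theorem loopsTo_retreat (h : IsAt G W r D (insert v X) (v :: l) 2 o s) (hD : v ∉ D) (hX : v ∉ X)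
    (hl : l.length < n) :
    LoopsTo W (.reg 3) moveC (1400 * (n + 1) ^ 5) s (IsAt G W r D X l 2 o) :=
  loopsTo_of_popC h (run_popC h hl (fun _ _ _ hv => absurd hv hD)
    fun _ h' h9 _ => run_retreatC h' hD hX hl h9)

variable (G) in
/-- The sets written by the traversal of the search tree below the state `(D, X)`, up to depth
`m`: every minimal connected dominating set is found in the tree of each of its vertices, and
written only in that of the least one, `r`. -/
noncomputable def listed (r : Fin n) (m : ℕ) (D X : Finset (Fin n)) : List (Finset (Fin n)) :=
  (enumerated G (selectRule G r) m D X).filter fun E => ∀ i ∈ E, r ≤ i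

open Classical in
theorem flatMap_listed_of_leaf (hleaf : IsDead G D X ∨ frontier G D X = ∅) :
    (listed G r (m + 1) D X).flatMap charVector =
      if ¬ IsDead G D X ∧ undominated G D = ∅ ∧ ∀ i ∈ D, r ≤ i then charVector D else [] := by
  rw [listed, enumerated]
  by_cases hd : IsDead G D X
  · simp [hd]
  rw [if_neg hd, if_pos (hleaf.resolve_left hd)]
  split_ifs <;> simp_all

theorem stepCount_of_leaf {rule : Finset (Fin n) → Finset (Fin n) → Fin n}
    (hleaf : IsDead G D X ∨ frontier G D X = ∅) : stepCount G rule (m + 1) D X = 1 := by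
  rw [stepCount]
  rcases hleaf with h | h <;> simp [h]

theorem loopsTo_search (m : ℕ) (h : IsAt G W r D X l 1 o s) (hDX : Disjoint D X)
    (hm : (D ∪ X)ᶜ.card < m) (hl : l.length + (D ∪ X)ᶜ.card ≤ n) :
    LoopsTo W (.reg 3) moveC (1400 * (n + 1) ^ 5 * stepCount G (selectRule G r) m D X) s
      (IsAt G W r D X l 2 (o ++ (listed G r m D X).flatMap charVector)) := by
  induction m generalizing D X l o s with
  | zero => omega
  | succ m ih =>
    by_cases hleaf : IsDead G D X ∨ frontier G D X = ∅
    · rw [stepCount_of_leaf hleaf, mul_one, flatMap_listed_of_leaf hleaf]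
      exact loopsTo_of_visitC h (run_visitC h hDX
        (fun _ _ _ hlive hF => absurd hleaf (not_or.2 ⟨hlive, hF.ne_empty⟩))
        fun _ h' hn _ => run_leafC h' hn)
    obtain ⟨hlive, hF⟩ := not_or.1 hleaf
    have hF' : (frontier G D X).Nonempty := Finset.nonempty_iff_ne_empty.2 hF
    have hv := (isBranchingRule_selectRule G r D X hF').1
    obtain ⟨-, hvD, hvX⟩ := mem_frontier.1 hv
    have hleft := card_compl_insert_left hv
    have hright := card_compl_insert_right hv
    have hvisit := loopsTo_of_visitC h (run_visitC h hDX
      (fun _ h' hn _ hF => run_pushC h' hn hF (by omega)) fun _ _ _ hl => absurd hl hleaf)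
    rw [stepCount, listed, enumerated, if_neg hlive, if_neg hF, if_neg hlive, if_neg hF]
    set v := selectRule G r D X
    have hDX' := Finset.disjoint_insert_left.2 ⟨hvX, hDX⟩
    have hdel : ∀ o s, IsAt G W r D (insert v X) (v :: l) 1 o s → LoopsTo W (.reg 3) moveC
        (1400 * (n + 1) ^ 5 * stepCount G (selectRule G r) m D (insert v X) + 1400 * (n + 1) ^ 5)
        s (IsAt G W r D X l 2 (o ++ (listed G r m D (insert v X)).flatMap charVector)) :=
      fun o s h' => (ih h' (Finset.disjoint_insert_right.2 ⟨hvD, hDX⟩) (by omega)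
        (by rw [List.length_cons]; omega)).trans
          fun s' h'' => loopsTo_retreat h'' hvD hvX (by omega)
    by_cases hred : HasRedundantVertex G (insert v D)
    · simp only [if_pos hred, List.nil_append]
      exact (hvisit.trans fun s' h' => hdel o s' (h'.1 hred)).mono_time (by linarith)
    · simp only [if_neg hred, List.filter_append, List.flatMap_append, ← List.append_assoc]
      exact (((hvisit.trans fun s' h' => ih (h'.2 hred)
        hDX' (by omega) (by rw [List.length_cons]; omega)).trans
          fun s' h' => loopsTo_exclude h' hvD (by omega)).trans
            fun s' h' => hdel _ s' h').mono_time (by linarith)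

end Search

/-! ### The program -/

/-- Traverse the search tree whose root is the vertex in register `1`. -/
def rootC : Cmd :=
  .seq (fillN 1 5 .skip (.const 0)) (.seq (.store 1 (.reg 1) (.const 1))
    (.seq (.assign 2 (.const 0)) (.seq (.assign 3 (.const 1)) (.while (.reg 3) moveC))))

/-- Traverse the search trees of all vertices, writing the minimal connected dominating sets. -/
def enumerateC : Cmd := forN 1 rootC

section Enumerate

variable {n : ℕ} {G : SimpleGraph (Fin n)} {W : ℕ} {s : State} {r : Fin n} {o : List ℕ}

variable (n) in
/-- A bound for the number of leaves of a search tree of a graph with `n` vertices. -/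
noncomputable def leafBound : ℕ := ⌊(1.9884 : ℝ) ^ n⌋₊

theorem stepCount_singleton_le (r : Fin n) :
    stepCount G (selectRule G r) (n + 1) {r} ∅ ≤ 4 * (n + 1) * leafBound n + 1 := by
  have h := leafCount_singleton_le (isBranchingRule_selectRule G r) (n + 1) r
  rw [Fintype.card_fin] at h
  exact (stepCount_le _ _ _ _).trans (by gcongr; exact Nat.le_floor h)

theorem isAt_root (h : HoldsGraph G W s) (hr : s.reg 1 = r) (h0 : ∀ i : Fin n, s.mem 1 i = 0) :
    IsAt G W r {r} ∅ [] 1 s.out (((s.put 1 r 1).set 2 0).set 3 1) where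
  graph := ((h.put (by decide)).set (by decide)).set (by decide)
  state := by
    have hempty : HoldsState n ∅ ∅ s := fun i => by simp [h0]
    have hput : HoldsState n {r} ∅ (s.put 1 r 1) := hempty.put (by simp) (by simp)
    exact hput.of_mem_eq rfl
  root := by simpa using hr
  height := by simp
  mode := by simp
  stack := trivial
  out := rfl

theorem card_compl_root_lt (r : Fin n) : ({r} ∪ ∅ : Finset (Fin n))ᶜ.card < n := by
  have hn := r.pos
  rw [Finset.union_empty, Finset.card_compl, Fintype.card_fin, Finset.card_singleton]
  omega

theorem run_moveC_from_root (h : IsAt G W r {r} ∅ [] 1 o s) :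
    Run W (.while (.reg 3) moveC)
      (1400 * (n + 1) ^ 5 * stepCount G (selectRule G r) (n + 1) {r} ∅ + 1400 * (n + 1) ^ 5 + 2) s
      (IsAt G W r {r} ∅ [] 0 (o ++ (listed G r (n + 1) {r} ∅).flatMap charVector)) := by
  have hcard := card_compl_root_lt r
  have hW := h.graph.one_lt
  exact ((loopsTo_search (n + 1) h (Finset.disjoint_empty_right _) (by omega)
    (by rw [List.length_nil]; omega)).trans fun _ => loopsTo_finish).run
      fun s' h' => Val.reg h'.mode (by omega)

theorem time_rootC_le {N M T : ℕ} (hN : 1 ≤ N) (hT : T ≤ 4 * N * M + 1) :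
    22 * N + (1400 * N ^ 5 * T + 1400 * N ^ 5 + 9) ≤ 6000 * N ^ 6 * (M + 1) := by
  have h1 : 1 ≤ N ^ 5 := Nat.one_le_pow _ _ hN
  have h2 : N ≤ N ^ 5 := Nat.le_self_pow (by decide) N
  have h3 : N ^ 5 ≤ N ^ 6 := Nat.pow_le_pow_right hN (by decide)
  calc 22 * N + (1400 * N ^ 5 * T + 1400 * N ^ 5 + 9)
      ≤ 22 * N + (1400 * N ^ 5 * (4 * N * M + 1) + 1400 * N ^ 5 + 9) := by gcongr
    _ = 5600 * (N ^ 6 * M) + (22 * N + 2800 * N ^ 5 + 9) := by ring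
    _ ≤ 6000 * (N ^ 6 * M) + 6000 * N ^ 6 := by omega
    _ = 6000 * N ^ 6 * (M + 1) := by ring

theorem run_rootC (h : HoldsGraph G W s) (hr : s.reg 1 = r) :
    Run W rootC (6000 * (n + 1) ^ 6 * (leafBound n + 1)) s fun s' => HoldsGraph G W s' ∧
      s'.out = s.out ++ (listed G r (n + 1) {r} ∅).flatMap charVector := by
  have hb := h.bound
  refine Run.mono_time (K := 22 * (n + 1) + (3 + (2 + (2 + (1400 * (n + 1) ^ 5 *
    stepCount G (selectRule G r) (n + 1) {r} ∅ + 1400 * (n + 1) ^ 5 + 2))))) ?_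
      (le_trans (by omega) (time_rootC_le (Nat.succ_pos n) (stepCount_singleton_le (G := G) r)))
  refine Run.seq (Run.fillN (K := 1) (k := 1) (fun _ : Fin n => 0) h.add_two_le (by decide)
    rfl rfl rfl h.size le_rfl fun _ _ _ _ => Run.skip (Val.const (by omega)))
      fun s₁ hf₁ h0 => ?_
  have h₁ : HoldsGraph G W s₁ := h.of_status_le hf₁ rfl rfl fun i => by simp [h0]
  have hr₁ : s₁.reg 1 = r := (hf₁.reg 1 rfl).trans hr
  refine Run.seq (P := (· = s₁.put 1 r 1))
    (Run.store (h₁.val_vertex hr₁) (Val.const h.one_lt) rfl) fun s₂ _ hs₂ => ?_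
  refine Run.seq (P := (· = s₂.set 2 0)) (Run.assign (Val.const (by omega)) rfl)
    fun s₃ _ hs₃ => ?_
  refine Run.seq (P := (· = s₃.set 3 1)) (Run.assign (Val.const (by omega)) rfl)
    fun s₄ _ hs₄ => ?_
  have hroot : IsAt G W r {r} ∅ [] 1 s.out s₄ := by
    rw [hs₄, hs₃, hs₂, ← hf₁.out rfl]
    exact isAt_root h₁ hr₁ h0
  exact (run_moveC_from_root hroot).mono le_rfl fun s' _ h' => ⟨h'.graph, h'.out⟩

theorem nodup_listed_and_mem_iff (r : Fin n) :
    (listed G r (n + 1) {r} ∅).Nodup ∧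
      ∀ E, E ∈ listed G r (n + 1) {r} ∅ ↔ IsMinimalCDS G E ∧ r ∈ E ∧ ∀ i ∈ E, r ≤ i := by
  obtain ⟨hnodup, hmem⟩ := nodup_enumerated_and_mem_iff (isBranchingRule_selectRule G r) (n + 1)
    {r} ∅ (isSearchState_singleton r) (not_hasRedundantVertex_singleton r)
    ((card_compl_root_lt r).trans n.lt_succ_self)
  exact ⟨hnodup.filter _, fun E => by simp [listed, hmem, and_assoc]⟩

variable (G) in
/-- The minimal connected dominating sets of `G`, in the order in which they are written. -/
noncomputable def allListed : List (Finset (Fin n)) :=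
  (List.finRange n).flatMap fun r => listed G r (n + 1) {r} ∅

theorem nodup_allListed : (allListed G).Nodup := by
  refine List.nodup_flatMap.2 ⟨fun r _ => (nodup_listed_and_mem_iff r).1,
    (List.nodup_finRange n).imp fun {r r'} hne E hE hE' => hne ?_⟩
  obtain ⟨-, hr, hmin⟩ := ((nodup_listed_and_mem_iff r).2 E).1 hE
  obtain ⟨-, hr', hmin'⟩ := ((nodup_listed_and_mem_iff r').2 E).1 hE'
  exact le_antisymm (hmin r' hr') (hmin' r hr)

theorem mem_allListed (E : Finset (Fin n)) : E ∈ allListed G ↔ IsMinimalCDS G E := by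
  simp only [allListed, List.mem_flatMap, List.mem_finRange, true_and,
    (nodup_listed_and_mem_iff _).2]
  refine ⟨fun ⟨_, h, _⟩ => h, fun h => ?_⟩
  have hne : E.Nonempty := (isCDS_iff.1 h.1).2.1
  exact ⟨E.min' hne, h, E.min'_mem hne, fun i hi => E.min'_le i hi⟩

theorem time_enumerateC_le {N M : ℕ} (hN : 1 ≤ N) :
    (6000 * N ^ 6 * (M + 1) + 12) * N ≤ 6012 * N ^ 7 * (M + 1) := by
  have h1 : 1 ≤ N ^ 6 * (M + 1) := Nat.mul_pos (Nat.pow_pos hN) M.succ_pos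
  calc (6000 * N ^ 6 * (M + 1) + 12) * N
      ≤ (6000 * N ^ 6 * (M + 1) + 12 * (N ^ 6 * (M + 1))) * N := by gcongr; omega
    _ = 6012 * N ^ 7 * (M + 1) := by ring

theorem run_enumerateC (h : HoldsGraph G W s) :
    Run W enumerateC (6012 * (n + 1) ^ 7 * (leafBound n + 1)) s fun s' =>
      s'.out = s.out ++ (allListed G).flatMap charVector := by
  refine (Run.forN (fun j s' => HoldsGraph G W s' ∧ s'.out = s.out ++
    (((List.finRange n).take j).flatMap fun r => listed G r (n + 1) {r} ∅).flatMap charVector)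
    h.add_two_le (by decide) rfl rfl h.size ⟨h.set (by decide), by simp⟩ ?_).mono
      (time_enumerateC_le (Nat.succ_pos n)) ?_
  · rintro j hj s₁ - hij ⟨h₁, ho₁⟩
    refine (run_rootC h₁ (r := ⟨j, hj⟩) hij).mono le_rfl fun s₂ _ ⟨h₂, ho₂⟩ =>
      ⟨h₂.set (by decide), ?_⟩
    have hget : (List.finRange n)[j]? = some ⟨j, hj⟩ := by simp [hj]
    rw [State.set_out, ho₂, ho₁, List.take_add_one, hget, List.append_assoc]
    simp [List.flatMap_append]
  · rintro s' - ⟨-, ho⟩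
    rw [ho, List.take_of_length_le (by simp), allListed]

theorem rowMajor_inj {i j i' j' : Fin n} (h : (i : ℕ) * n + j = i' * n + j') :
    i = i' ∧ j = j' := by
  refine Prod.ext_iff.1 (finProdFinEquiv.injective (a₁ := (i, j)) (a₂ := (i', j')) (Fin.ext ?_))
  simpa [add_comm, mul_comm] using h

theorem holdsGraph_inputState (G : SimpleGraph (Fin n)) (hW : n * n + 20 * n + 100 ≤ W) :
    HoldsGraph G W (inputState G) where
  bound := hW
  size := by simp [inputState]
  adj i j := by
    have hiff : (0 = 0 ∧ ∃ i' j' : Fin n, (i : ℕ) * n + j = i' * n + j' ∧ G.Adj i' j') ↔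
        G.Adj i j := by
      refine ⟨fun ⟨_, i', j', heq, hadj⟩ => ?_, fun hadj => ⟨rfl, i, j, rfl, hadj⟩⟩
      obtain ⟨rfl, rfl⟩ := rowMajor_inj heq
      exact hadj
    classical exact if_congr hiff rfl rfl
  status_le i := by simp [inputState]

end Enumerate

theorem exists_add_one_pow_mul_pow_le {a b : ℝ} (ha : 0 < a) (hab : a < b) (k : ℕ) :
    ∃ C : ℝ, ∀ n : ℕ, ((n : ℝ) + 1) ^ k * a ^ n ≤ C * b ^ n := by
  have hb : 0 < b := ha.trans hab
  have hratio : 0 < a / b := div_pos ha hb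
  have hlt : |a / b| < 1 := by rwa [abs_of_pos hratio, div_lt_one hb]
  obtain ⟨B, hB⟩ := (tendsto_pow_const_mul_const_pow_of_abs_lt_one k hlt).bddAbove_range
  refine ⟨B / (a / b), fun n => ?_⟩
  have hle : ((n : ℝ) + 1) ^ k * (a / b) ^ n ≤ B / (a / b) := by
    rw [le_div_iff₀ hratio, mul_assoc, ← pow_succ]
    exact_mod_cast hB ⟨n + 1, rfl⟩
  calc ((n : ℝ) + 1) ^ k * a ^ n = ((n : ℝ) + 1) ^ k * (a / b) ^ n * b ^ n := by
        rw [mul_assoc, ← mul_pow, div_mul_cancel₀ a hb.ne']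
    _ ≤ B / (a / b) * b ^ n := by gcongr

theorem exists_time_enumerateC_le : ∃ C : ℝ, ∀ n : ℕ,
    ((6012 * (n + 1) ^ 7 * (leafBound n + 1) : ℕ) : ℝ) ≤ C * 1.9896 ^ n := by
  obtain ⟨C, hC⟩ :=
    exists_add_one_pow_mul_pow_le (a := 1.9884) (b := 1.9896) (by norm_num) (by norm_num) 7
  refine ⟨12024 * C, fun n => ?_⟩
  have hfloor : (leafBound n : ℝ) ≤ 1.9884 ^ n := Nat.floor_le (by positivity)
  have hone : (1 : ℝ) ≤ 1.9884 ^ n := one_le_pow₀ (by norm_num)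
  push_cast
  calc 6012 * ((n : ℝ) + 1) ^ 7 * (leafBound n + 1)
      ≤ 6012 * ((n : ℝ) + 1) ^ 7 * (1.9884 ^ n + 1.9884 ^ n) := by gcongr
    _ = 12024 * (((n : ℝ) + 1) ^ 7 * 1.9884 ^ n) := by ring
    _ ≤ 12024 * C * 1.9896 ^ n := by linarith [hC n]

theorem exists_enumerateC_exec {n W : ℕ} (G : SimpleGraph (Fin n))
    (hW : n * n + 20 * n + 100 ≤ W) :
    ∃ time final, Exec W enumerateC (inputState G) time final ∧
      IsMinimalCDSEnumeration G final.out ∧ time ≤ 6012 * (n + 1) ^ 7 * (leafBound n + 1) := by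
  obtain ⟨time, final, htime, hexec, hout⟩ := run_enumerateC (holdsGraph_inputState G hW)
  exact ⟨time, final, hexec, ⟨allListed G, nodup_allListed, mem_allListed, hout⟩, htime⟩

theorem exists_ncard_isMinimalCDS_le : ∃ C : ℝ, ∀ (V : Type*) [Fintype V] (G : SimpleGraph V),
    ({D : Finset V | IsMinimalCDS G D}.ncard : ℝ) ≤ C * (1.9896 : ℝ) ^ Fintype.card V := by
  obtain ⟨C, hC⟩ :=
    exists_add_one_pow_mul_pow_le (a := 1.9884) (b := 1.9896) (by norm_num) (by norm_num) 1
  refine ⟨C, fun V _ G => ((ncard_isMinimalCDS_le G).trans ?_).trans (hC _)⟩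
  rw [pow_one]
  gcongr
  exact le_add_of_nonneg_right zero_le_one

end CDSEnum

theorem mainTheorem1 :
    (∃ (prog : WordRAM.Cmd) (C : ℝ) (space : Polynomial ℕ),
      ∀ (n : ℕ) (G : SimpleGraph (Fin n)),
        ∃ (time : ℕ) (final : WordRAM.State),
          WordRAM.Exec (space.eval n) prog (WordRAM.inputState G) time final ∧
          IsMinimalCDSEnumeration G final.out ∧
          (time : ℝ) ≤ C * (1.9896 : ℝ) ^ n) ∧
    (∃ C : ℝ, ∀ (V : Type*) [Fintype V] (G : SimpleGraph V),
      ({D : Finset V | IsMinimalCDS G D}.ncard : ℝ) ≤ C * (1.9896 : ℝ) ^ Fintype.card V) := by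
  obtain ⟨C, hC⟩ := CDSEnum.exists_time_enumerateC_le
  refine ⟨⟨CDSEnum.enumerateC, C, (Polynomial.X + Polynomial.C 10) ^ 2, fun n G => ?_⟩,
    CDSEnum.exists_ncard_isMinimalCDS_le⟩
  have hspace : n * n + 20 * n + 100 ≤
      ((Polynomial.X + Polynomial.C 10) ^ 2 : Polynomial ℕ).eval n := by
    simp only [Polynomial.eval_pow, Polynomial.eval_add, Polynomial.eval_X, Polynomial.eval_C]
    exact le_of_eq (by ring)
  obtain ⟨time, final, hexec, hout, htime⟩ := CDSEnum.exists_enumerateC_exec G hspace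
  exact ⟨time, final, hexec, hout, (Nat.cast_le.2 htime).trans (hC n)⟩
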